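/- **Setting.** Let $M$ be a smooth, finite-dimensional, second countable Riemannian manifold, $f:M\to M$ a $C^\infty$ diffeomorphism, and $K\subset M$ a compact hyperbolic set: $f(K)=K$, and there are a continuous $f_*$-invariant splitting $T_KM=V^s\oplus V^u$ and constants $C>0$, $0<\lambda<1$ with $|f_*^{n}v|\le C\lambda^n|v|$ for $v\in V^s$ and $|f_*^{-n}v|\le C\lambda^n|v|$ for $v\in V^u$, $n\ge0$. Suppose $K$ is an attractor: $\bigcap_{n\ge0}f^n(U)=K$ for an open set $U$ (the basin). Let $\rho$ be a physical (SRB) measure on $K$, that is, an ergodic $f$-invariant Borel probability measure on $K$ such that for each $C^\infty$ function $\Phi:M\to\mathbb R$ one has $\frac1N\sum_{k=0}^{N-1}\Phi(f^kx)\to\rho(\Phi)$ for Lebesgue-almost every $x\in U$; here $\rho(g)=\int g\,d\rho$. Let $P^s,P^u$ be the projections of $T_KM=V^s\oplus V^u$. On covectors put $\mathcal P^{s}\eta=\eta\circ P^{s}$, $\mathcal P^{u}\eta=\eta\circ P^{u}$, and let $f^{*n}\eta=\eta\circ f_*^n\in T_x^*M$ for $\eta\in T^*_{f^nx}M$, $n\in\mathbb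 Z$; $|\eta|$ is the dual norm. For a field $\omega$ on $K$ write $\omega_n=\omega\circ f^n$. For $0<\alpha\le1$, a vector or covector field on $K$ is $\alpha$-Hölder if its components in charts are locally $\alpha$-Hölder with respect to the Riemannian distance; $\mathcal X(K)$ and $\mathcal X^*(K)$ are the spaces of vector and covector fields on $K$ that are $\alpha$-Hölder for some $\alpha\in(0,1]$. **Theorem (adjoint shadowing lemma for discrete time).** There are linear operators $S:\mathcal X(K)\to\mathcal X(K)$ and $\mathcal S:\mathcal X^*(K)\to\mathcal X^*(K)$, and there is $\alpha_0\in(0,1]$ such that both preserve the class of $\alpha$-Hölder fields for every $\alpha\in(0,\alpha_0]$, with the following properties. $S$ is the linear shadowing operator: for each $X\in\mathcal X(K)$ and each orbit $(x_n)_{n\in\mathbb Z}$ of $f$ in $K$, the sequence $v_n=S(X)(x_n)$ is the one and only bounded solution of $v_{n+1}=f_*v_n+X(x_{n+1})$. The operator $\mathcal S$ (the adjoint shadowing operator) is characterized in each of the following ways. (a) $\rho(\omega\,S(X))=\rho(\mathcal S(\omega)\,X)$ for all $\omega\in\mathcal X^*(K)$, $X\in\mathcal X(K)$. This determines $\mathcal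 S(\omega)$ on the support of $\rho$ (hence $\rho$-almost everywhere, and everywhere if $\operatorname{supp}\rho=K$): if $\omega,\nu\in\mathcal X^*(K)$, $0<\alpha\le 1$, and $\rho(\omega S(X))=\rho(\nu X)$ for all $\alpha$-Hölder $X$, then $\nu=\mathcal S(\omega)$ on $\operatorname{supp}\rho$. Hence, for each $C^\infty$ function $\Phi:M\to\mathbb R$, the covector field $d\Phi|_K$ is in $\mathcal X^*(K)$ and, with $\nu=\mathcal S(d\Phi)$, for every $X\in\mathcal X(K)$ the shadowing contribution is $$SC:=\rho(d\Phi\,S(X))=\rho(\mathcal S(d\Phi)\,X)=\lim_{N\to\infty}\frac1N\sum_{n=1}^N\nu_n(x)\,X_n(x)\quad\text{for }\rho\text{-almost every }x\in K;$$ moreover, for every continuous $g:M\to\mathbb R$ that equals $\nu X$ on $K$, $\frac1N\sum_{n=1}^N g(f^nx)\to SC$ for Lebesgue-almost every $x\in U$. (b) For every $\omega\in\mathcal X^*(K)$, at every point of $K$ both series below converge and $$\mathcal S(\omega)=\sum_{n\ge0}f^{*n}\mathcal P^s\omega_n-\sum_{n\le-1}f^{*n}\mathcal P^u\omega_n .$$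 (c) For every $\omega\in\mathcal X^*(K)$, $\nu=\mathcal S(\omega)$ is the one and only bounded covector field on $K$ with $\nu=f^*\nu_1+\omega$, $\nu_1=\nu\circ f$. The same holds on each orbit $(x_n)_{n\in\mathbb Z}$ of $f$ in $K$: $\eta_n=\mathcal S(\omega)(x_n)$ is the one and only bounded solution $\eta_n\in T^*_{x_n}M$ of $\eta_n=f^*\eta_{n+1}+\omega(x_n)$. -/

import Mathlib

open scoped Manifold ContDiff Topology NNReal Bundle
open MeasureTheory Filter Bundle

noncomputable section

namespace AdjointShadowing

section Holder

variable {A F : Type*} [PseudoEMetricSpace A] [NormedAddCommGroup F]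

/-- `g` is `α`-Hölder on a neighbourhood of `p`. -/
def HolderNear (α : ℝ≥0) (g : A → F) (p : A) : Prop :=
  ∃ C : ℝ≥0, ∃ W ∈ 𝓝 p, HolderOnWith C α g W

theorem HolderNear.add {α : ℝ≥0} {g h : A → F} {p : A} (hg : HolderNear α g p)
    (hh : HolderNear α h p) : HolderNear α (fun x => g x + h x) p := by
  obtain ⟨C, W, hW, hC⟩ := hg
  obtain ⟨C', W', hW', hC'⟩ := hh
  refine ⟨C + C', W ∩ W', inter_mem hW hW', ?_⟩
  intro x hx y hy
  calc edist (g x + h x) (g y + h y) ≤ edist (g x) (g y) + edist (h x) (h y) :=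
        edist_add_add_le _ _ _ _
    _ ≤ C * edist x y ^ (α : ℝ) + C' * edist x y ^ (α : ℝ) :=
        add_le_add (hC x hx.1 y hy.1) (hC' x hx.2 y hy.2)
    _ = ((C + C' : ℝ≥0) : ENNReal) * edist x y ^ (α : ℝ) := by
        rw [ENNReal.coe_add, add_mul]

theorem HolderNear.smul [NormedSpace ℝ F] {α : ℝ≥0} {g : A → F} {p : A} (c : ℝ) (hg : HolderNear α g p) :
    HolderNear α (fun x => c • g x) p := by
  obtain ⟨C, W, hW, hC⟩ := hg
  refine ⟨‖c‖₊ * C, W, hW, ?_⟩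
  intro x hx y hy
  calc edist (c • g x) (c • g y) ≤ ‖c‖₊ * edist (g x) (g y) := by
        rw [edist_smul₀]; rfl
    _ ≤ ‖c‖₊ * (C * edist x y ^ (α : ℝ)) := by
        gcongr
        exact hC x hx y hy
    _ = ((‖c‖₊ * C : ℝ≥0) : ENNReal) * edist x y ^ (α : ℝ) := by
        rw [ENNReal.coe_mul, mul_assoc]

theorem HolderNear.zero (α : ℝ≥0) (p : A) : HolderNear α (fun _ : A => (0 : F)) p :=
  ⟨0, Set.univ, univ_mem, fun x _ y _ => by simp⟩

theorem HolderNear.of_le {α β : ℝ≥0} {g : A → F} {p : A} (hg : HolderNear α g p) (h : β ≤ α) :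
    HolderNear β g p := by
  obtain ⟨C, W, hW, hC⟩ := hg
  have hb : Metric.eball p 1 ∈ 𝓝 p := Metric.eball_mem_nhds p one_pos
  refine ⟨_, W ∩ Metric.eball p 1, inter_mem hW hb,
    (hC.mono Set.inter_subset_left).of_le (D := 2) ?_ h⟩
  intro x hx y hy
  calc edist x y ≤ edist x p + edist p y := edist_triangle _ _ _
    _ ≤ 1 + 1 := add_le_add hx.2.le (by rw [edist_comm]; exact hy.2.le)
    _ = ((2 : ℝ≥0) : ENNReal) := by norm_num

end Holder

section Fields

variable (d : ℕ) {M : Type*} [EMetricSpace M] [ChartedSpace (EuclideanSpace ℝ (Fin d)) M]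

/-- Vector fields on `K`, i.e. sections of the tangent bundle of `M` restricted to `K`. -/
abbrev VectorField (K : Set M) : Type _ := (x : K) → TangentSpace (𝓡 d) (x : M)

/-- Covector fields on `K`, i.e. sections of the cotangent bundle of `M` restricted to `K`. -/
abbrev CovectorField (K : Set M) : Type _ := (x : K) → (TangentSpace (𝓡 d) (x : M) →L[ℝ] ℝ)

variable [IsManifold (𝓡 d) ∞ M] {K : Set M}

/-- The components of a vector field in the chart at `p`. -/
def vecCoord (p : K) (X : VectorField d K) (x : K) : EuclideanSpace ℝ (Fin d) :=
  (trivializationAt (EuclideanSpace ℝ (Fin d)) (TangentSpace (𝓡 d)) (p : M)).continuousLinearMapAt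
    ℝ (x : M) (X x)

/-- The components of a covector field in the chart at `p`. -/
def covCoord (p : K) (om : CovectorField d K) (x : K) : EuclideanSpace ℝ (Fin d) →L[ℝ] ℝ :=
  (om x).comp
    ((trivializationAt (EuclideanSpace ℝ (Fin d)) (TangentSpace (𝓡 d)) (p : M)).symmL ℝ (x : M))

/-- Around every point of `K` the chart components of the field are `α`-Hölder. -/
def IsHolderVectorField (α : ℝ≥0) (X : VectorField d K) : Prop :=
  ∀ p : K, HolderNear α (vecCoord d p X) p

/-- Around every point of `K` the chart components of the field are `α`-Hölder. -/
def IsHolderCovectorField (α : ℝ≥0) (om : CovectorField d K) : Prop :=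
  ∀ p : K, HolderNear α (covCoord d p om) p

variable (K)

/-- The Hölder continuous vector fields on `K` (of any exponent in `(0, 1]`). -/
def HolderVectorField : Submodule ℝ (VectorField d K) where
  carrier := {X | ∃ α : ℝ≥0, 0 < α ∧ α ≤ 1 ∧ IsHolderVectorField d α X}
  zero_mem' := ⟨1, one_pos, le_rfl, fun p => by
    have h : vecCoord d p (0 : VectorField d K) = fun _ => 0 := by
      funext x; simp [vecCoord]
    rw [h]; exact HolderNear.zero 1 p⟩
  add_mem' := by
    rintro X Y ⟨α, hα, hα1, hX⟩ ⟨β, hβ, hβ1, hY⟩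
    refine ⟨min α β, lt_min hα hβ, (min_le_left _ _).trans hα1, fun p => ?_⟩
    have h : vecCoord d p (X + Y) = fun x => vecCoord d p X x + vecCoord d p Y x := by
      funext x; simp [vecCoord]
    rw [h]
    exact ((hX p).of_le (min_le_left _ _)).add ((hY p).of_le (min_le_right _ _))
  smul_mem' := by
    rintro c X ⟨α, hα, hα1, hX⟩
    refine ⟨α, hα, hα1, fun p => ?_⟩
    have h : vecCoord d p (c • X) = fun x => c • vecCoord d p X x := by
      funext x; simp [vecCoord]
    rw [h]
    exact (hX p).smul c

/-- The Hölder continuous covector fields on `K` (of any exponent in `(0, 1]`). -/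
def HolderCovectorField : Submodule ℝ (CovectorField d K) where
  carrier := {om | ∃ α : ℝ≥0, 0 < α ∧ α ≤ 1 ∧ IsHolderCovectorField d α om}
  zero_mem' := ⟨1, one_pos, le_rfl, fun p => by
    have h : covCoord d p (0 : CovectorField d K) = fun _ => 0 := by
      funext x; simp [covCoord]
    rw [h]; exact HolderNear.zero 1 p⟩
  add_mem' := by
    rintro X Y ⟨α, hα, hα1, hX⟩ ⟨β, hβ, hβ1, hY⟩
    refine ⟨min α β, lt_min hα hβ, (min_le_left _ _).trans hα1, fun p => ?_⟩
    have h : covCoord d p (X + Y) = fun x => covCoord d p X x + covCoord d p Y x := by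
      funext x; simp [covCoord]
    rw [h]
    exact ((hX p).of_le (min_le_left _ _)).add ((hY p).of_le (min_le_right _ _))
  smul_mem' := by
    rintro c X ⟨α, hα, hα1, hX⟩
    refine ⟨α, hα, hα1, fun p => ?_⟩
    have h : covCoord d p (c • X) = fun x => c • covCoord d p X x := by
      funext x; simp [covCoord]
    rw [h]
    exact (hX p).smul c

/-- The differential of `Φ : M → ℝ`, as a covector field on `K`. -/
def differential (Φ : M → ℝ) : CovectorField d K :=
  fun x => (mfderiv (𝓡 d) 𝓘(ℝ, ℝ) Φ (x : M) : TangentSpace (𝓡 d) (x : M) →L[ℝ] ℝ)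

end Fields

section Dynamics

variable {d : ℕ} {M : Type*} [EMetricSpace M] [ChartedSpace (EuclideanSpace ℝ (Fin d)) M]
  {K : Set M}

/-- The iterate `fⁿ`, `n ∈ ℤ`, of a diffeomorphism. -/
def iter (f : M ≃ₘ⟮𝓡 d, 𝓡 d⟯ M) (n : ℤ) : M → M := ⇑((f.toEquiv : Equiv.Perm M) ^ n)

/-- The pushforward `f_*ⁿ : T_x M → T_{fⁿ x} M`, `n ∈ ℤ`. -/
def push (f : M ≃ₘ⟮𝓡 d, 𝓡 d⟯ M) (n : ℤ) (x : M) :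
    TangentSpace (𝓡 d) x →L[ℝ] TangentSpace (𝓡 d) (iter f n x) :=
  mfderiv (𝓡 d) (𝓡 d) (iter f n) x

theorem iter_mem {f : M ≃ₘ⟮𝓡 d, 𝓡 d⟯ M} (hK : f '' K = K) (n : ℤ) {x : M} (hx : x ∈ K) :
    iter f n x ∈ K := by
  have h1 : ∀ y ∈ K, f.toEquiv y ∈ K := fun y hy => hK ▸ Set.mem_image_of_mem f hy
  have h2 : ∀ y ∈ K, f.toEquiv.symm y ∈ K := by
    intro y hy
    rw [← hK] at hy
    obtain ⟨z, hz, rfl⟩ := hy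
    have : f.toEquiv.symm (f z) = z := f.toEquiv.symm_apply_apply z
    rwa [this]
  unfold iter
  induction n using Int.induction_on generalizing x with
  | zero => simpa using hx
  | succ n ih =>
    rw [zpow_add_one, Equiv.Perm.mul_apply]
    exact ih (h1 x hx)
  | pred n ih =>
    rw [zpow_sub_one, Equiv.Perm.mul_apply]
    exact ih (h2 x hx)

/-- `fⁿ` as a map of the invariant set `K` to itself. -/
def iterOn {f : M ≃ₘ⟮𝓡 d, 𝓡 d⟯ M} (hK : f '' K = K) (n : ℤ) (x : K) : K :=
  ⟨iter f n x, iter_mem hK n x.2⟩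

/-- `f` as a map of the invariant set `K` to itself. -/
def stepOn {f : M ≃ₘ⟮𝓡 d, 𝓡 d⟯ M} (hK : f '' K = K) (x : K) : K :=
  ⟨f x, hK.subset (Set.mem_image_of_mem f x.2)⟩

variable (d) in
/-- A splitting `T_K M = Vˢ ⊕ Vᵘ`. -/
structure Splitting (K : Set M) where
  /-- The stable subspaces. -/
  Vs : (x : K) → Submodule ℝ (TangentSpace (𝓡 d) (x : M))
  /-- The unstable subspaces. -/
  Vu : (x : K) → Submodule ℝ (TangentSpace (𝓡 d) (x : M))
  isCompl : ∀ x, IsCompl (Vs x) (Vu x)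

instance (x : M) : FiniteDimensional ℝ (TangentSpace (𝓡 d) x) :=
  inferInstanceAs (FiniteDimensional ℝ (EuclideanSpace ℝ (Fin d)))

instance (x : M) : T2Space (TangentSpace (𝓡 d) x) :=
  inferInstanceAs (T2Space (EuclideanSpace ℝ (Fin d)))

/-- The oblique projection onto `Vˢ` along `Vᵘ`. -/
def Splitting.Ps (V : Splitting d K) (x : K) :
    TangentSpace (𝓡 d) (x : M) →L[ℝ] TangentSpace (𝓡 d) (x : M) :=
  LinearMap.toContinuousLinearMap ((V.Vs x).projection (V.Vu x) (V.isCompl x))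

/-- The oblique projection onto `Vᵘ` along `Vˢ`. -/
def Splitting.Pu (V : Splitting d K) (x : K) :
    TangentSpace (𝓡 d) (x : M) →L[ℝ] TangentSpace (𝓡 d) (x : M) :=
  LinearMap.toContinuousLinearMap ((V.Vu x).projection (V.Vs x) (V.isCompl x).symm)

/-- The adjoint projection `𝒫ˢ` on covectors. -/
def Splitting.adjPs (V : Splitting d K) (x : K) (η : TangentSpace (𝓡 d) (x : M) →L[ℝ] ℝ) :
    TangentSpace (𝓡 d) (x : M) →L[ℝ] ℝ :=
  η.comp (V.Ps x)

/-- The adjoint projection `𝒫ᵘ` on covectors. -/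
def Splitting.adjPu (V : Splitting d K) (x : K) (η : TangentSpace (𝓡 d) (x : M) →L[ℝ] ℝ) :
    TangentSpace (𝓡 d) (x : M) →L[ℝ] ℝ :=
  η.comp (V.Pu x)

/-- The splitting is continuous: in the chart at any `p ∈ K` the projection onto `Vˢ` along `Vᵘ`
is continuous at `p`. -/
def Splitting.IsContinuous [IsManifold (𝓡 d) ∞ M] (V : Splitting d K) : Prop :=
  ∀ p : K, ContinuousAt (fun x : K =>
    let e := trivializationAt (EuclideanSpace ℝ (Fin d)) (TangentSpace (𝓡 d)) (p : M)
    ((e.continuousLinearMapAt ℝ (x : M)).comp ((V.Ps x).comp (e.symmL ℝ (x : M))) :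
      EuclideanSpace ℝ (Fin d) →L[ℝ] EuclideanSpace ℝ (Fin d))) p

/-- `K` is a compact hyperbolic set of `f` with stable/unstable splitting `V`. -/
structure IsHyperbolicSet [IsManifold (𝓡 d) ∞ M]
    [RiemannianBundle (fun x : M => TangentSpace (𝓡 d) x)]
    (f : M ≃ₘ⟮𝓡 d, 𝓡 d⟯ M) (K : Set M) (V : Splitting d K) : Prop where
  isCompact : IsCompact K
  image_eq : f '' K = K
  isContinuous : V.IsContinuous
  map_Vs : ∀ x : K, (V.Vs x).map
    (mfderiv (𝓡 d) (𝓡 d) f (x : M) :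
      TangentSpace (𝓡 d) (x : M) →ₗ[ℝ] TangentSpace (𝓡 d) (f x)) = V.Vs (stepOn image_eq x)
  map_Vu : ∀ x : K, (V.Vu x).map
    (mfderiv (𝓡 d) (𝓡 d) f (x : M) :
      TangentSpace (𝓡 d) (x : M) →ₗ[ℝ] TangentSpace (𝓡 d) (f x)) = V.Vu (stepOn image_eq x)
  exists_rate : ∃ C lam : ℝ, 0 < C ∧ 0 < lam ∧ lam < 1 ∧ ∀ (x : K) (n : ℕ),
    (∀ v ∈ V.Vu x, ‖push f (-(n : ℤ)) (x : M) v‖ ≤ C * lam ^ n * ‖v‖) ∧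
    (∀ v ∈ V.Vs x, ‖push f (n : ℤ) (x : M) v‖ ≤ C * lam ^ n * ‖v‖)

/-- `K` is an attractor of `f` with basin `U`. -/
def IsAttractor (f : M ≃ₘ⟮𝓡 d, 𝓡 d⟯ M) (K U : Set M) : Prop :=
  IsOpen U ∧ ⋂ n : ℕ, iter f n '' U = K

variable (d) in
/-- `A` has Lebesgue measure zero, i.e. measure zero in every chart. -/
def IsLebesgueNull (A : Set M) : Prop :=
  ∀ p : M, volume (extChartAt (𝓡 d) p '' (A ∩ (extChartAt (𝓡 d) p).source)) = 0

/-- `ρ` is a physical (SRB) measure of `f` on `K`, with basin `U`: an ergodic invariant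
probability measure on `K` such that for every smooth observable, the time average along the
orbit of Lebesgue-almost every point of `U` is the `ρ`-average. -/
structure IsSRBMeasure [MeasurableSpace M] (f : M ≃ₘ⟮𝓡 d, 𝓡 d⟯ M) (K U : Set M)
    (hK : f '' K = K) (ρ : Measure K) : Prop where
  isProbabilityMeasure : IsProbabilityMeasure ρ
  ergodic : Ergodic (stepOn hK) ρ
  physical : ∀ Φ : M → ℝ, ContMDiff (𝓡 d) 𝓘(ℝ, ℝ) ∞ Φ →
    IsLebesgueNull d {x ∈ U | ¬ Tendsto
      (fun N : ℕ => (1 / (N : ℝ)) * ∑ k ∈ Finset.range N, Φ (iter f k x)) atTop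
      (𝓝 (∫ y : K, Φ y ∂ρ))}

/-- `v n ∈ T_{x n} M` solves the inhomogeneous tangent equation
`v (n+1) = f_* (v n) + X (x (n+1))` along the orbit `x`. It is written as the equality
`(x (n+1), v (n+1) - X (x (n+1))) = (f (x n), f_* (v n))` in the tangent bundle. -/
def IsTangentSolution (f : M ≃ₘ⟮𝓡 d, 𝓡 d⟯ M) (X : VectorField d K) (x : ℤ → K)
    (v : (n : ℤ) → TangentSpace (𝓡 d) (x n : M)) : Prop :=
  ∀ n : ℤ, (⟨(x (n + 1) : M), v (n + 1) - X (x (n + 1))⟩ : TangentBundle (𝓡 d) M) =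
    tangentMap (𝓡 d) (𝓡 d) f ⟨(x n : M), v n⟩

/-- `η n ∈ T*_{x n} M` solves the inhomogeneous adjoint equation
`η n = f^* (η (n+1)) + om (x n)` along the orbit `x`: for all `u ∈ T_{x n} M`,
with `w = f_* u ∈ T_{x (n+1)} M`, one has `η n u = η (n+1) w + om (x n) u`. -/
def IsAdjointSolution (f : M ≃ₘ⟮𝓡 d, 𝓡 d⟯ M) (om : CovectorField d K) (x : ℤ → K)
    (η : (n : ℤ) → (TangentSpace (𝓡 d) (x n : M) →L[ℝ] ℝ)) : Prop :=
  ∀ (n : ℤ) (u : TangentSpace (𝓡 d) (x n : M)) (w : TangentSpace (𝓡 d) (x (n + 1) : M)),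
    tangentMap (𝓡 d) (𝓡 d) f ⟨(x n : M), u⟩ = ⟨(x (n + 1) : M), w⟩ →
      η n u = η (n + 1) w + om (x n) u

/-- `v` is the shadowing field of `X`: along every orbit in `K` its values form the one and only
bounded solution of the inhomogeneous tangent equation. -/
def IsShadowingField [RiemannianBundle (fun x : M => TangentSpace (𝓡 d) x)]
    (f : M ≃ₘ⟮𝓡 d, 𝓡 d⟯ M) (X v : VectorField d K) : Prop :=
  ∀ x : ℤ → K, (∀ n, (x (n + 1) : M) = f (x n)) →
    ∀ u : (n : ℤ) → TangentSpace (𝓡 d) (x n : M),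
      ((∃ B : ℝ, ∀ n, ‖u n‖ ≤ B) ∧ IsTangentSolution f X x u) ↔ ∀ n, u n = v (x n)

/-- The pullback `f^{*n} η ∈ T*_x M` of `η ∈ T*_{fⁿ x} M`, `n ∈ ℤ`. -/
def pull {f : M ≃ₘ⟮𝓡 d, 𝓡 d⟯ M} (hK : f '' K = K) (n : ℤ) (x : K)
    (η : TangentSpace (𝓡 d) (iterOn hK n x : M) →L[ℝ] ℝ) :
    TangentSpace (𝓡 d) (x : M) →L[ℝ] ℝ :=
  η.comp (push f n (x : M))

/-- The pullback `f^* η ∈ T*_x M` of `η ∈ T*_{f x} M`. -/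
def pullOne {f : M ≃ₘ⟮𝓡 d, 𝓡 d⟯ M} (hK : f '' K = K) (x : K)
    (η : TangentSpace (𝓡 d) (stepOn hK x : M) →L[ℝ] ℝ) :
    TangentSpace (𝓡 d) (x : M) →L[ℝ] ℝ :=
  η.comp (mfderiv (𝓡 d) (𝓡 d) f (x : M))

end Dynamics

end AdjointShadowing

end

open AdjointShadowing

/-! The equation `v_{n+1} = f_* v_n + X_{n+1}` is solved by a Green series: stable components of the
forcing are pushed forward from the past, unstable components are pulled back from the future, and
hyperbolicity makes both series geometric. A bounded homogeneous solution vanishes, because its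
stable part has been contracted since arbitrarily remote times and its unstable part is recovered by
contraction from arbitrarily late ones. The adjoint equation `η_n = f^* η_{n+1} + ω_n` is the same
problem for the dual cocycle over the inverse map. Existence, uniqueness and the expansion in
pullbacks therefore come from one abstract theory: `HyperbolicCocycle`, `solve`,
`bounded_solution_iff`, `dual`.

Hölder regularity of the solution requires none of the splitting. Along the orbits of `x` and `y`
the difference of the two solutions is a bounded sequence that solves the equation over the orbit of
`x`, with a forcing of size at most a constant times `L^(α|n|) d(x,y)^α`. The a priori estimate
`norm_le_of_orbit` tolerates this growth as long as `lam * L^α < 1`, which is how the small exponent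
arises (`exists_holder_solve`).

The manifold enters through `exists_tangentEmbedding`: over the compact set `K` the tangent bundle
embeds smoothly into a trivial bundle, so that the derivative of `f` becomes a cocycle of operators
on one fixed space `E`, with the projection `Φ 0 x` onto the embedded fibre in place of the
identity.

Duality is a telescoping identity (`integral_shadowOp_eq`): for `v = S(X)` and `ν = 𝒮(ω)` the two
step equations give `ω v = ν v - (ν v)∘f + (ν X)∘f`, and invariance of `ρ` removes the coboundary.
Uniqueness on the support follows by testing against bump fields (`eq_of_integral_eq`). The time
averages come from Birkhoff's theorem for `ρ`-almost every point, and from uniform smooth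
approximation of continuous observables for Lebesgue-almost every point of the basin. -/

noncomputable section
namespace AdjointShadowing

/-! ### Birkhoff's pointwise theorem for ergodic maps. -/

section Birkhoff

variable {Ω : Type*} {T : Ω → Ω} {h : Ω → ℝ}

/-- The running maximum of the Birkhoff sums of `h` of length at most `N`. -/
def maxBirkhoff (T : Ω → Ω) (h : Ω → ℝ) : ℕ → Ω → ℝ
  | 0 => fun _ => 0
  | N + 1 => fun x => max 0 (h x + maxBirkhoff T h N (T x))

theorem maxBirkhoff_nonneg (N : ℕ) (x : Ω) : 0 ≤ maxBirkhoff T h N x := by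
  cases N with
  | zero => exact le_rfl
  | succ N => exact le_max_left _ _

theorem maxBirkhoff_le_succ (N : ℕ) (x : Ω) : maxBirkhoff T h N x ≤ maxBirkhoff T h (N + 1) x := by
  induction N generalizing x with
  | zero => exact maxBirkhoff_nonneg 1 x
  | succ N ih =>
    have := ih (T x)
    simp only [maxBirkhoff] at this ⊢
    gcongr

theorem monotone_maxBirkhoff (x : Ω) : Monotone fun N => maxBirkhoff T h N x :=
  monotone_nat_of_le_succ fun N => maxBirkhoff_le_succ N x

theorem birkhoffSum_le_maxBirkhoff (N : ℕ) (x : Ω) : birkhoffSum T h N x ≤ maxBirkhoff T h N x := by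
  induction N generalizing x with
  | zero => simp [maxBirkhoff]
  | succ N ih =>
    rw [birkhoffSum_succ']
    exact (add_le_add le_rfl (ih (T x))).trans (le_max_right _ _)

/-- By invariance and monotonicity in `N` the left side has nonnegative integral, whereas the right
side equals `h x` once `maxBirkhoff T h N (T x)` exceeds `-h x`. Comparing the two facts plays the
role of the maximal ergodic inequality. -/
theorem maxBirkhoff_succ_sub (N : ℕ) (x : Ω) :
    maxBirkhoff T h (N + 1) x - maxBirkhoff T h N (T x) = max (-maxBirkhoff T h N (T x)) (h x) := by
  simp only [maxBirkhoff]
  rw [← max_sub_sub_right, zero_sub, add_sub_cancel_right]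

variable [MeasurableSpace Ω] {μ : Measure Ω}

theorem integral_comp_of_measurePreserving (hT : MeasurePreserving T μ μ) {g : Ω → ℝ}
    (hg : Measurable g) : ∫ x, g (T x) ∂μ = ∫ x, g x ∂μ := by
  conv_rhs => rw [← hT.map_eq]
  exact (integral_map hT.measurable.aemeasurable hg.aestronglyMeasurable).symm

theorem measurable_maxBirkhoff (hT : Measurable T) (hh : Measurable h) (N : ℕ) :
    Measurable (maxBirkhoff T h N) := by
  induction N with
  | zero => exact measurable_const
  | succ N ih => exact measurable_const.max (hh.add (ih.comp hT))

theorem integrable_maxBirkhoff (hT : MeasurePreserving T μ μ) (hi : Integrable h μ)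
    (N : ℕ) : Integrable (maxBirkhoff T h N) μ := by
  induction N with
  | zero => exact integrable_zero _ _ _
  | succ N ih =>
    exact (integrable_zero _ _ _).sup (hi.add (hT.integrable_comp_of_integrable ih))

/-- If `h` has negative integral then almost surely its Birkhoff sums are bounded above. -/
theorem ae_bddAbove_birkhoffSum [IsProbabilityMeasure μ] (hT : Ergodic T μ) (hh : Measurable h)
    (hi : Integrable h μ) (hneg : ∫ x, h x ∂μ < 0) :
    ∀ᵐ x ∂μ, ∃ C : ℝ, ∀ N, birkhoffSum T h N x ≤ C := by
  have hmp := hT.toMeasurePreserving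
  let B : Set Ω := {x | ∀ m : ℕ, ∃ N, (m : ℝ) < maxBirkhoff T h N x}
  have hB : MeasurableSet B := by
    have : B = ⋂ m : ℕ, ⋃ N, {x | (m : ℝ) < maxBirkhoff T h N x} := by
      ext x; simp [B]
    rw [this]
    exact .iInter fun m => .iUnion fun N =>
      measurableSet_lt measurable_const (measurable_maxBirkhoff hmp.measurable hh N)
  -- Passing from `x` to `T x` changes the maxima by the finite amount `h x`, up to a shift of `N`,
  -- so their divergence is an invariant event.
  have hinv : T ⁻¹' B = B := by
    ext x
    simp only [B, Set.mem_preimage, Set.mem_ofPred_eq]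
    constructor
    · intro H m
      obtain ⟨k, hk⟩ := exists_nat_gt ((m : ℝ) - h x)
      obtain ⟨N, hN⟩ := H k
      refine ⟨N + 1, lt_of_lt_of_le ?_ (le_max_right _ _)⟩
      linarith
    · intro H m
      obtain ⟨k, hk⟩ := exists_nat_gt ((m : ℝ) + h x)
      obtain ⟨N, hN⟩ := H k
      refine ⟨N, ?_⟩
      have h1 : (k : ℝ) < maxBirkhoff T h (N + 1) x := hN.trans_le (maxBirkhoff_le_succ N x)
      simp only [maxBirkhoff, lt_max_iff] at h1
      rcases h1 with h1 | h1
      · exact absurd h1 (not_lt.2 k.cast_nonneg)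
      · linarith
  rcases hT.measure_self_or_compl_eq_zero hB hinv with h0 | h0
  · have : ∀ᵐ x ∂μ, x ∉ B := measure_eq_zero_iff_ae_notMem.1 h0
    filter_upwards [this] with x hx
    simp only [B, Set.mem_ofPred_eq, not_forall, not_exists, not_lt] at hx
    obtain ⟨m, hm⟩ := hx
    exact ⟨m, fun N => (birkhoffSum_le_maxBirkhoff N x).trans (hm N)⟩
  -- If the maxima diverge almost surely, the differences of `maxBirkhoff_succ_sub` converge to `h`
  -- under the majorant `|h|`; their nonnegative integrals then force `∫ h ≥ 0`.
  · exfalso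
    have hBae : ∀ᵐ x ∂μ, x ∈ B := h0
    have hlim : Tendsto (fun N => ∫ x, max (-maxBirkhoff T h N (T x)) (h x) ∂μ) atTop
        (𝓝 (∫ x, h x ∂μ)) := by
      refine tendsto_integral_of_dominated_convergence (fun x => |h x|) (fun N => ?_) hi.abs
        (fun N => ?_) ?_
      · exact (((measurable_maxBirkhoff hmp.measurable hh N).comp hmp.measurable).neg.max
          hh).aestronglyMeasurable
      · refine Eventually.of_forall fun x => ?_
        rw [Real.norm_eq_abs, abs_le]
        exact ⟨(neg_abs_le _).trans (le_max_right _ _),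
          max_le ((neg_nonpos.2 (maxBirkhoff_nonneg _ _)).trans (abs_nonneg _)) (le_abs_self _)⟩
      · filter_upwards [hBae] with x hx
        rw [← hinv] at hx
        obtain ⟨m, hm⟩ := exists_nat_gt (-h x)
        obtain ⟨N, hN⟩ := hx m
        refine tendsto_const_nhds.congr' ?_
        filter_upwards [eventually_ge_atTop N] with k hk
        have := monotone_maxBirkhoff (T := T) (h := h) (T x) hk
        simp only at this
        rw [max_eq_right]
        linarith
    refine absurd (ge_of_tendsto' hlim fun N => ?_) (not_le.2 hneg)
    simp_rw [← maxBirkhoff_succ_sub]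
    have h1 := integrable_maxBirkhoff hmp hi N
    have h3 : Integrable (fun x => maxBirkhoff T h N (T x)) μ := hmp.integrable_comp_of_integrable h1
    rw [integral_sub (integrable_maxBirkhoff hmp hi _) h3]
    have h2 : ∫ x, maxBirkhoff T h N (T x) ∂μ = ∫ x, maxBirkhoff T h N x ∂μ :=
      integral_comp_of_measurePreserving hmp (measurable_maxBirkhoff hmp.measurable hh N)
    rw [h2, sub_nonneg]
    exact integral_mono h1 (integrable_maxBirkhoff hmp hi _) fun x => maxBirkhoff_le_succ N x

theorem ae_eventually_birkhoffSum_le [IsProbabilityMeasure μ] (hT : Ergodic T μ)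
    (hh : Measurable h) (hi : Integrable h μ) :
    ∀ᵐ x ∂μ, ∀ c > ∫ y, h y ∂μ, ∀ᶠ N : ℕ in atTop, birkhoffSum T h N x ≤ N * c := by
  -- Subtracting slightly more than the mean makes the integral negative. Countably many margins `1
  -- / (m + 1)` keep the exceptional set null.
  have key : ∀ m : ℕ, ∀ᵐ x ∂μ, ∃ C : ℝ, ∀ N,
      birkhoffSum T (fun x => h x - (∫ y, h y ∂μ + 1 / (m + 1 : ℝ))) N x ≤ C := by
    intro m
    refine ae_bddAbove_birkhoffSum hT (hh.sub_const _) (hi.sub (integrable_const _)) ?_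
    rw [integral_sub hi (integrable_const _)]
    simp only [integral_const, probReal_univ, one_smul]
    have : (0 : ℝ) < 1 / (m + 1 : ℝ) := by positivity
    linarith
  filter_upwards [ae_all_iff.2 key] with x hx c hc
  obtain ⟨m, hm⟩ := exists_nat_one_div_lt (sub_pos.2 hc)
  obtain ⟨C, hC⟩ := hx m
  have hpos : 0 < c - (∫ y, h y ∂μ + 1 / (m + 1 : ℝ)) := by linarith
  obtain ⟨N₀, hN₀⟩ := exists_nat_gt (C / (c - (∫ y, h y ∂μ + 1 / (m + 1 : ℝ))))
  filter_upwards [eventually_ge_atTop N₀] with N hN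
  have h1 := hC N
  have h2 : birkhoffSum T (fun x => h x - (∫ y, h y ∂μ + 1 / (m + 1 : ℝ))) N x =
      birkhoffSum T h N x - N * (∫ y, h y ∂μ + 1 / (m + 1 : ℝ)) := by
    simp only [birkhoffSum, Finset.sum_sub_distrib, Finset.sum_const, Finset.card_range,
      nsmul_eq_mul]
  rw [h2] at h1
  rw [div_lt_iff₀ hpos] at hN₀
  have h3 : (N₀ : ℝ) ≤ N := by exact_mod_cast hN
  nlinarith

/-- **Birkhoff's pointwise ergodic theorem** for ergodic transformations. -/
theorem ae_tendsto_birkhoffAverage [IsProbabilityMeasure μ] (hT : Ergodic T μ)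
    (hh : Measurable h) (hi : Integrable h μ) :
    ∀ᵐ x ∂μ, Tendsto (fun N => birkhoffAverage ℝ T h N x) atTop (𝓝 (∫ y, h y ∂μ)) := by
  -- The one-sided bound for `h` controls the upper limit, the one for `-h` the lower limit.
  filter_upwards [ae_eventually_birkhoffSum_le hT hh hi,
    ae_eventually_birkhoffSum_le hT hh.neg hi.neg] with x h1 h2
  have hn : ∀ N, birkhoffSum T (-h) N x = -birkhoffSum T h N x := by
    intro N; simp [birkhoffSum]
  rw [tendsto_order]
  constructor
  · intro a ha
    obtain ⟨b, hab, hb⟩ := exists_between ha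
    have := h2 (-b) (by simp only [Pi.neg_apply, integral_neg]; linarith)
    filter_upwards [this, eventually_gt_atTop 0] with N hN hN0
    have hN0' : (0 : ℝ) < N := by exact_mod_cast hN0
    rw [hn] at hN
    rw [birkhoffAverage, smul_eq_mul, inv_mul_eq_div, lt_div_iff₀ hN0']
    nlinarith
  · intro a ha
    obtain ⟨b, hb, hab⟩ := exists_between ha
    filter_upwards [h1 b hb, eventually_gt_atTop 0] with N hN hN0
    have hN0' : (0 : ℝ) < N := by exact_mod_cast hN0
    rw [birkhoffAverage, smul_eq_mul, inv_mul_eq_div, div_lt_iff₀ hN0']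
    nlinarith

end Birkhoff

end AdjointShadowing
end

/-! ### Hyperbolic linear cocycles: Green series, a priori estimate, Hölder dependence, duality. -/

noncomputable section
namespace AdjointShadowing

/-- A uniformly hyperbolic linear cocycle over an invertible map `T` of `K`. The fibre over `x` is
the range of the projection `Φ 0 x` of the fixed space `E`, and `Ps x`, `Pu x` are the projections
to the stable and unstable parts of the fibre. -/
structure HyperbolicCocycle (K E : Type*) [NormedAddCommGroup E] [NormedSpace ℝ E] where
  /-- The base dynamics. -/
  T : Equiv.Perm K
  /-- The propagators. -/
  Φ : ℤ → K → E →L[ℝ] E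
  /-- The stable projections. -/
  Ps : K → E →L[ℝ] E
  /-- The unstable projections. -/
  Pu : K → E →L[ℝ] E
  /-- The constant in the hyperbolicity estimates. -/
  C : ℝ
  /-- The rate in the hyperbolicity estimates. -/
  lam : ℝ
  C_nonneg : 0 ≤ C
  lam_nonneg : 0 ≤ lam
  lam_lt_one : lam < 1
  Φ_add : ∀ m n x, Φ (m + n) x = Φ m ((T ^ n) x) * Φ n x
  Ps_add_Pu : ∀ x, Ps x + Pu x = Φ 0 x
  Φ_zero_Ps : ∀ x, Φ 0 x * Ps x = Ps x
  Φ_zero_Pu : ∀ x, Φ 0 x * Pu x = Pu x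
  Ps_comm : ∀ n x, Ps ((T ^ n) x) * Φ n x = Φ n x * Ps x
  Pu_comm : ∀ n x, Pu ((T ^ n) x) * Φ n x = Φ n x * Pu x
  norm_Φ_Ps : ∀ (n : ℕ) x, ‖Φ n x * Ps x‖ ≤ C * lam ^ n
  norm_Φ_Pu : ∀ (n : ℕ) x, ‖Φ (-(n : ℤ)) x * Pu x‖ ≤ C * lam ^ n

namespace HyperbolicCocycle

variable {K E : Type*} [NormedAddCommGroup E] [NormedSpace ℝ E]
  (c : HyperbolicCocycle K E) {X : K → E}

theorem zpow_zpow (m n : ℤ) (x : K) : (c.T ^ m) ((c.T ^ n) x) = (c.T ^ (m + n)) x := by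
  rw [zpow_add, Equiv.Perm.mul_apply]

theorem zpow_apply_apply (m : ℤ) (x : K) : (c.T ^ m) (c.T x) = (c.T ^ (m + 1)) x := by
  rw [zpow_add_one, Equiv.Perm.mul_apply]

theorem norm_Φ_zero_le (x : K) : ‖c.Φ 0 x‖ ≤ 2 * c.C := by
  have h1 := c.norm_Φ_Ps 0 x
  have h2 := c.norm_Φ_Pu 0 x
  simp only [Nat.cast_zero, neg_zero, c.Φ_zero_Ps, c.Φ_zero_Pu, pow_zero, mul_one] at h1 h2
  rw [← c.Ps_add_Pu]
  exact (norm_add_le _ _).trans (by linarith)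

theorem Φ_zero_mul (n : ℤ) (x : K) : c.Φ 0 ((c.T ^ n) x) * c.Φ n x = c.Φ n x := by
  rw [← c.Φ_add, zero_add]

/-- The terms of the stable part of the Green series. -/
def sTerm (X : K → E) (x : K) (n : ℕ) : E :=
  c.Φ n ((c.T ^ (-(n : ℤ))) x) (c.Ps ((c.T ^ (-(n : ℤ))) x) (X ((c.T ^ (-(n : ℤ))) x)))

/-- The terms of the unstable part of the Green series. -/
def uTerm (X : K → E) (x : K) (n : ℕ) : E :=
  c.Φ (-((n : ℤ) + 1)) ((c.T ^ ((n : ℤ) + 1)) x)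
    (c.Pu ((c.T ^ ((n : ℤ) + 1)) x) (X ((c.T ^ ((n : ℤ) + 1)) x)))

/-- The bounded solution of `v (T x) = Φ 1 x (v x) + X (T x)`, as a Green series. -/
def solve (X : K → E) (x : K) : E := ∑' n, c.sTerm X x n - ∑' n, c.uTerm X x n

theorem norm_Φ_Ps_apply (n : ℕ) (x : K) (w : E) :
    ‖c.Φ n x (c.Ps x w)‖ ≤ c.C * c.lam ^ n * ‖w‖ :=
  (ContinuousLinearMap.le_opNorm (c.Φ n x * c.Ps x) w).trans
    (mul_le_mul_of_nonneg_right (c.norm_Φ_Ps n x) (norm_nonneg _))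

theorem norm_Φ_Pu_apply (n : ℕ) (x : K) (w : E) :
    ‖c.Φ (-(n : ℤ)) x (c.Pu x w)‖ ≤ c.C * c.lam ^ n * ‖w‖ :=
  (ContinuousLinearMap.le_opNorm (c.Φ (-(n : ℤ)) x * c.Pu x) w).trans
    (mul_le_mul_of_nonneg_right (c.norm_Φ_Pu n x) (norm_nonneg _))

theorem norm_sTerm_le {B : ℝ} (hB : ∀ x, ‖X x‖ ≤ B) (x : K) (n : ℕ) :
    ‖c.sTerm X x n‖ ≤ c.C * B * c.lam ^ n := by
  refine (c.norm_Φ_Ps_apply n _ _).trans ?_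
  rw [mul_right_comm]
  have h1 := pow_nonneg c.lam_nonneg n
  have h2 := c.C_nonneg
  gcongr
  exact hB _

theorem norm_uTerm_le {B : ℝ} (hB : ∀ x, ‖X x‖ ≤ B) (x : K) (n : ℕ) :
    ‖c.uTerm X x n‖ ≤ c.C * B * c.lam ^ n := by
  have h := c.norm_Φ_Pu_apply (n + 1) ((c.T ^ ((n : ℤ) + 1)) x) (X ((c.T ^ ((n : ℤ) + 1)) x))
  push_cast at h
  refine h.trans ?_
  have h1 := pow_nonneg c.lam_nonneg n
  have h2 := c.C_nonneg
  -- The unstable series starts at time `1`, so its bound is one power of `lam` better than needed;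
  -- the weaker bound gives both series the same majorant.
  have h3 : c.lam ^ (n + 1) ≤ c.lam ^ n :=
    pow_le_pow_of_le_one c.lam_nonneg c.lam_lt_one.le n.le_succ
  calc c.C * c.lam ^ (n + 1) * ‖X ((c.T ^ ((n : ℤ) + 1)) x)‖ ≤ c.C * c.lam ^ n * B := by
        gcongr
        exact hB _
    _ = c.C * B * c.lam ^ n := by ring

theorem summable_const_mul_lam_pow (B : ℝ) : Summable fun n : ℕ => B * c.lam ^ n :=
  (summable_geometric_of_lt_one c.lam_nonneg c.lam_lt_one).mul_left B

theorem exists_norm_solve_le {B : ℝ} (hB : ∀ x, ‖X x‖ ≤ B) : ∃ B', ∀ x, ‖c.solve X x‖ ≤ B' := by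
  have hs := c.summable_const_mul_lam_pow (c.C * B)
  refine ⟨∑' n, c.C * B * c.lam ^ n + ∑' n, c.C * B * c.lam ^ n, fun x =>
    (norm_sub_le _ _).trans (add_le_add ?_ ?_)⟩
  · exact tsum_of_norm_bounded hs.hasSum (c.norm_sTerm_le hB x)
  · exact tsum_of_norm_bounded hs.hasSum (c.norm_uTerm_le hB x)

theorem sTerm_succ (x : K) (n : ℕ) : c.sTerm X (c.T x) (n + 1) = c.Φ 1 x (c.sTerm X x n) := by
  have h1 : (c.T ^ (-((n + 1 : ℕ) : ℤ))) (c.T x) = (c.T ^ (-(n : ℤ))) x := by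
    rw [c.zpow_apply_apply]; congr 2; push_cast; ring
  have h2 := c.Φ_add 1 n ((c.T ^ (-(n : ℤ))) x)
  rw [c.zpow_zpow, add_neg_cancel, zpow_zero, Equiv.Perm.one_apply] at h2
  rw [sTerm, sTerm, h1, ← mul_apply_eq_comp (c.Φ 1 x), ← h2]
  congr 3; push_cast; ring

theorem sTerm_zero (x : K) : c.sTerm X x 0 = c.Ps x (X x) := by
  simp only [sTerm, Nat.cast_zero, neg_zero, zpow_zero, Equiv.Perm.one_apply]
  rw [← mul_apply_eq_comp, c.Φ_zero_Ps]

theorem Φ_one_uTerm_succ (x : K) (n : ℕ) :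
    c.Φ 1 x (c.uTerm X x (n + 1)) = c.uTerm X (c.T x) n := by
  have h1 : (c.T ^ ((n : ℤ) + 1)) (c.T x) = (c.T ^ (((n + 1 : ℕ) : ℤ) + 1)) x := by
    rw [c.zpow_apply_apply]; congr 2
  have h2 := c.Φ_add 1 (-(((n + 1 : ℕ) : ℤ) + 1)) ((c.T ^ (((n + 1 : ℕ) : ℤ) + 1)) x)
  rw [c.zpow_zpow, neg_add_cancel, zpow_zero, Equiv.Perm.one_apply] at h2
  rw [uTerm, uTerm, h1, ← mul_apply_eq_comp (c.Φ 1 x), ← h2]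
  congr 3

theorem Φ_one_uTerm_zero (x : K) : c.Φ 1 x (c.uTerm X x 0) = c.Pu (c.T x) (X (c.T x)) := by
  have h2 := c.Φ_add 1 (-1) (c.T x)
  rw [c.zpow_apply_apply, neg_add_cancel, add_neg_cancel, zpow_zero, Equiv.Perm.one_apply] at h2
  simp only [uTerm, Nat.cast_zero, zero_add, zpow_one]
  rw [← mul_apply_eq_comp (c.Φ 1 x), ← h2, ← mul_apply_eq_comp,
    c.Φ_zero_Pu]

/-- No bound on `X` is needed, since scalars pass through `tsum` even without summability. -/
theorem solve_smul (a : ℝ) (x : K) : c.solve (fun x => a • X x) x = a • c.solve X x := by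
  have h1 : c.sTerm (fun x => a • X x) x = fun n => a • c.sTerm X x n := by
    ext n; simp [sTerm]
  have h2 : c.uTerm (fun x => a • X x) x = fun n => a • c.uTerm X x n := by
    ext n; simp [uTerm]
  rw [solve, solve, h1, h2, tsum_const_smul'', tsum_const_smul'', smul_sub]

section Complete

variable [CompleteSpace E]

theorem summable_sTerm {B : ℝ} (hB : ∀ x, ‖X x‖ ≤ B) (x : K) : Summable (c.sTerm X x) :=
  .of_norm_bounded (c.summable_const_mul_lam_pow (c.C * B)) (c.norm_sTerm_le hB x)

theorem summable_uTerm {B : ℝ} (hB : ∀ x, ‖X x‖ ≤ B) (x : K) : Summable (c.uTerm X x) :=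
  .of_norm_bounded (c.summable_const_mul_lam_pow (c.C * B)) (c.norm_uTerm_le hB x)

/-- `Φ 1 x` maps the stable series at `x` to the one at `T x` without its zeroth term `Ps X`, and
the unstable series at `x` to the one at `T x` with the additional term `Pu X`. The two
discrepancies add up to `Φ 0 X`. -/
theorem solve_step {B : ℝ} (hB : ∀ x, ‖X x‖ ≤ B) (x : K) :
    c.solve X (c.T x) = c.Φ 1 x (c.solve X x) + c.Φ 0 (c.T x) (X (c.T x)) := by
  have hs := c.summable_sTerm hB
  have hu := c.summable_uTerm hB
  rw [solve, solve, map_sub, (hs (c.T x)).tsum_eq_zero_add, (hu x).tsum_eq_zero_add, map_add,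
    ContinuousLinearMap.map_tsum _ (hs x),
    ContinuousLinearMap.map_tsum _ ((summable_nat_add_iff 1).2 (hu x))]
  simp_rw [c.sTerm_succ, c.Φ_one_uTerm_succ, c.sTerm_zero, c.Φ_one_uTerm_zero]
  rw [← c.Ps_add_Pu, add_apply]
  abel

/-- Every term of the series is the value of a propagator ending over `x`, hence lies in the fibre
over `x`. -/
theorem Φ_zero_solve {B : ℝ} (hB : ∀ x, ‖X x‖ ≤ B) (x : K) :
    c.Φ 0 x (c.solve X x) = c.solve X x := by
  rw [solve, map_sub, ContinuousLinearMap.map_tsum _ (c.summable_sTerm hB x),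
    ContinuousLinearMap.map_tsum _ (c.summable_uTerm hB x)]
  congr 2 <;> ext n
  · have h := c.Φ_zero_mul n ((c.T ^ (-(n : ℤ))) x)
    rw [c.zpow_zpow, add_neg_cancel, zpow_zero, Equiv.Perm.one_apply] at h
    rw [sTerm, ← mul_apply_eq_comp (c.Φ 0 x), h]
  · have h := c.Φ_zero_mul (-((n : ℤ) + 1)) ((c.T ^ ((n : ℤ) + 1)) x)
    rw [c.zpow_zpow, neg_add_cancel, zpow_zero, Equiv.Perm.one_apply] at h
    rw [uTerm, ← mul_apply_eq_comp (c.Φ 0 x), h]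

theorem solve_add {Y : K → E} {B B' : ℝ} (hB : ∀ x, ‖X x‖ ≤ B) (hB' : ∀ x, ‖Y x‖ ≤ B') (x : K) :
    c.solve (fun x => X x + Y x) x = c.solve X x + c.solve Y x := by
  have h1 : c.sTerm (fun x => X x + Y x) x = fun n => c.sTerm X x n + c.sTerm Y x n := by
    ext n; simp [sTerm]
  have h2 : c.uTerm (fun x => X x + Y x) x = fun n => c.uTerm X x n + c.uTerm Y x n := by
    ext n; simp [uTerm]
  rw [solve, solve, solve, h1, h2, (c.summable_sTerm hB x).tsum_add (c.summable_sTerm hB' x),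
    (c.summable_uTerm hB x).tsum_add (c.summable_uTerm hB' x)]
  abel

end Complete

section Orbit

variable {x : ℤ → K} {v e : ℤ → E}

/-- Variation of constants for the stable component, unrolled over `N` past steps; `Ps` passes
through the propagators by `Ps_comm`. Only the projection of `v` enters, so `v` need not lie in the
fibres. -/
theorem Ps_eq_add_sum (hx : ∀ n, x (n + 1) = c.T (x n))
    (hv : ∀ n, v (n + 1) = c.Φ 1 (x n) (v n) + e (n + 1)) (N : ℕ) :
    c.Ps (x 0) (v 0) = c.Φ N (x (-(N : ℤ))) (c.Ps (x (-(N : ℤ))) (v (-(N : ℤ)))) +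
      ∑ k ∈ Finset.range N, c.Φ k (x (-(k : ℤ))) (c.Ps (x (-(k : ℤ))) (e (-(k : ℤ)))) := by
  induction N with
  | zero =>
    simp only [Nat.cast_zero, neg_zero, Finset.range_zero, Finset.sum_empty, add_zero]
    rw [← mul_apply_eq_comp, c.Φ_zero_Ps]
  | succ N ih =>
    have hN : -(N : ℤ) = -((N + 1 : ℕ) : ℤ) + 1 := by push_cast; ring
    set y := x (-((N + 1 : ℕ) : ℤ))
    have h1 : x (-(N : ℤ)) = c.T y := by rw [hN, hx]
    have h2 : v (-(N : ℤ)) = c.Φ 1 y (v (-((N + 1 : ℕ) : ℤ))) + e (-(N : ℤ)) := by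
      rw [hN, hv]
    have h3 := c.Ps_comm 1 y
    rw [zpow_one] at h3
    have h4 : c.Φ ((N + 1 : ℕ) : ℤ) y = c.Φ N (c.T y) * c.Φ 1 y := by
      have := c.Φ_add N 1 y
      rwa [zpow_one] at this
    rw [ih, Finset.sum_range_succ, h1, h4, mul_apply_eq_comp,
      ← mul_apply_eq_comp (c.Φ 1 y), ← h3, mul_apply_eq_comp]
    conv_lhs => rw [h2, map_add, map_add]
    abel

/-- Variation of constants for the unstable component, unrolled over `N` future steps, the direction
in which the inverse propagators contract. -/
theorem Pu_eq_sub_sum (hx : ∀ n, x (n + 1) = c.T (x n))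
    (hv : ∀ n, v (n + 1) = c.Φ 1 (x n) (v n) + e (n + 1)) (N : ℕ) :
    c.Pu (x 0) (v 0) = c.Φ (-(N : ℤ)) (x N) (c.Pu (x N) (v N)) -
      ∑ k ∈ Finset.range N, c.Φ (-((k + 1 : ℕ) : ℤ)) (x ((k + 1 : ℕ) : ℤ))
        (c.Pu (x ((k + 1 : ℕ) : ℤ)) (e ((k + 1 : ℕ) : ℤ))) := by
  induction N with
  | zero =>
    simp only [Nat.cast_zero, neg_zero, Finset.range_zero, Finset.sum_empty, sub_zero]
    rw [← mul_apply_eq_comp, c.Φ_zero_Pu]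
  | succ N ih =>
    have h1 : x ((N + 1 : ℕ) : ℤ) = c.T (x N) := by push_cast; rw [hx]
    have h2 : v ((N + 1 : ℕ) : ℤ) = c.Φ 1 (x N) (v N) + e ((N + 1 : ℕ) : ℤ) := by
      push_cast; rw [hv]
    have h3 := c.Pu_comm 1 (x N)
    rw [zpow_one] at h3
    have h4 : c.Φ (-((N + 1 : ℕ) : ℤ)) (c.T (x N)) * c.Φ 1 (x N) = c.Φ (-(N : ℤ)) (x N) := by
      have := c.Φ_add (-((N + 1 : ℕ) : ℤ)) 1 (x N)
      rw [zpow_one] at this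
      rw [← this]; congr 1; push_cast; ring
    rw [ih, Finset.sum_range_succ, h1, h2, map_add, map_add,
      ← mul_apply_eq_comp (c.Pu _) (c.Φ 1 _), h3, mul_apply_eq_comp,
      ← mul_apply_eq_comp (c.Φ (-((N + 1 : ℕ) : ℤ)) _) (c.Φ 1 _), h4]
    abel

/-- The constant in the a priori estimate of bounded solutions. -/
def estimateConst (θ : ℝ) : ℝ := 1 + 2 * c.C + 2 * (c.C * (1 - c.lam * θ)⁻¹)

theorem sum_lam_mul_pow_le {θ : ℝ} (hθ : 0 ≤ θ) (h : c.lam * θ < 1) (N : ℕ) :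
    ∑ k ∈ Finset.range N, (c.lam * θ) ^ k ≤ (1 - c.lam * θ)⁻¹ := by
  have h0 := mul_nonneg c.lam_nonneg hθ
  rw [← tsum_geometric_of_lt_one h0 h]
  exact (summable_geometric_of_lt_one h0 h).sum_le_tsum _ fun k _ => pow_nonneg h0 k

theorem norm_le_of_forall_le_add {a b : ℝ} {w : E} (h : ∀ N : ℕ, ‖w‖ ≤ c.C * c.lam ^ N * a + b) :
    ‖w‖ ≤ b := by
  have : Tendsto (fun N : ℕ => c.C * c.lam ^ N * a + b) atTop (𝓝 (c.C * 0 * a + b)) :=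
    (((tendsto_pow_atTop_nhds_zero_of_lt_one c.lam_nonneg c.lam_lt_one).const_mul _).mul_const
      _).add_const _
  simpa using ge_of_tendsto' this h

/-- A priori estimate: a bounded solution along an orbit is controlled at time zero by the forcing
term, even if the latter grows exponentially at a rate slower than the hyperbolicity. -/
theorem norm_le_of_orbit (hx : ∀ n, x (n + 1) = c.T (x n))
    (hv : ∀ n, v (n + 1) = c.Φ 1 (x n) (v n) + e (n + 1)) {A B θ : ℝ} (hA : ∀ n, ‖v n‖ ≤ A)
    (hθ : 0 ≤ θ) (hθl : c.lam * θ < 1) (he : ∀ n, ‖e n‖ ≤ B * θ ^ n.natAbs) :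
    ‖v 0‖ ≤ c.estimateConst θ * B := by
  have hB : 0 ≤ B := by simpa using (norm_nonneg _).trans (he 0)
  have hC := c.C_nonneg
  have hl := c.lam_nonneg
  have hterm : ∀ (k : ℕ) (r : ℝ), r ≤ B * θ ^ k →
      c.C * c.lam ^ k * r ≤ c.C * B * (c.lam * θ) ^ k := by
    intro k r hr
    have := pow_nonneg hl k
    calc c.C * c.lam ^ k * r ≤ c.C * c.lam ^ k * (B * θ ^ k) := by gcongr
      _ = c.C * B * (c.lam * θ) ^ k := by rw [mul_pow]; ring
  -- The boundary term is at most `C * lam ^ N * A` and disappears as `N → ∞`; the forcing terms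
  -- form a geometric sum of ratio `lam * θ`.
  have hs : ‖c.Ps (x 0) (v 0)‖ ≤ c.C * B * (1 - c.lam * θ)⁻¹ := by
    refine c.norm_le_of_forall_le_add (a := A) fun N => ?_
    rw [c.Ps_eq_add_sum hx hv N]
    refine (norm_add_le _ _).trans (add_le_add ?_ ((norm_sum_le _ _).trans ?_))
    · refine (c.norm_Φ_Ps_apply _ _ _).trans ?_
      have := pow_nonneg hl N
      gcongr
      exact hA _
    · calc _ ≤ ∑ k ∈ Finset.range N, c.C * B * (c.lam * θ) ^ k :=
            Finset.sum_le_sum fun k _ => (c.norm_Φ_Ps_apply _ _ _).trans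
              (hterm k _ (by simpa using he (-(k : ℤ))))
        _ ≤ _ := by
            rw [← Finset.mul_sum]
            have := c.sum_lam_mul_pow_le hθ hθl N
            gcongr
  have hu : ‖c.Pu (x 0) (v 0)‖ ≤ c.C * B * (1 - c.lam * θ)⁻¹ := by
    refine c.norm_le_of_forall_le_add (a := A) fun N => ?_
    rw [c.Pu_eq_sub_sum hx hv N]
    refine (norm_sub_le _ _).trans (add_le_add ?_ ((norm_sum_le _ _).trans ?_))
    · refine (c.norm_Φ_Pu_apply _ _ _).trans ?_
      have := pow_nonneg hl N
      gcongr
      exact hA _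
    · calc _ ≤ ∑ k ∈ Finset.range N, c.C * B * (c.lam * θ) ^ (k + 1) :=
            Finset.sum_le_sum fun k _ => (c.norm_Φ_Pu_apply _ _ _).trans
              (hterm (k + 1) _ (he ((k + 1 : ℕ) : ℤ)))
        -- The unstable sum starts at exponent `1`; adding the nonnegative zeroth term makes the
        -- same geometric bound applicable.
        _ ≤ ∑ k ∈ Finset.range (N + 1), c.C * B * (c.lam * θ) ^ k := by
            rw [Finset.sum_range_succ']
            exact le_add_of_nonneg_right (by positivity)
        _ ≤ _ := by
            rw [← Finset.mul_sum]
            have := c.sum_lam_mul_pow_le hθ hθl (N + 1)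
            gcongr
  -- `v 0` may leave the fibre, but `v 0 - e 0` is a value of `Φ 1` and so is fixed by `Φ 0`. The
  -- part of `v 0` transverse to the fibre is therefore that of `e 0`.
  have hdec : v 0 = e 0 - c.Φ 0 (x 0) (e 0) + (c.Ps (x 0) (v 0) + c.Pu (x 0) (v 0)) := by
    have h0 := hv (-1)
    have h1 := hx (-1)
    rw [neg_add_cancel] at h0 h1
    have h2 := c.Φ_zero_mul 1 (x (-1))
    rw [zpow_one, ← h1] at h2
    rw [← add_apply, c.Ps_add_Pu]
    have h3 : c.Φ 0 (x 0) (v 0) = c.Φ 1 (x (-1)) (v (-1)) + c.Φ 0 (x 0) (e 0) := by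
      conv_lhs => rw [h0, map_add, ← mul_apply_eq_comp, h2]
    rw [h3]
    conv_lhs => rw [h0]
    abel
  have he0 : ‖e 0‖ ≤ B := by simpa using he 0
  have hΦ : ‖c.Φ 0 (x 0) (e 0)‖ ≤ 2 * c.C * B :=
    (ContinuousLinearMap.le_opNorm _ _).trans
      (mul_le_mul (c.norm_Φ_zero_le _) he0 (norm_nonneg _) (by positivity))
  rw [hdec]
  refine (norm_add_le _ _).trans ?_
  have h1 := norm_sub_le (e 0) (c.Φ 0 (x 0) (e 0))
  have h2 := norm_add_le (c.Ps (x 0) (v 0)) (c.Pu (x 0) (v 0))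
  have h3 : c.estimateConst θ * B = B + 2 * c.C * B + (c.C * B * (1 - c.lam * θ)⁻¹ +
      c.C * B * (1 - c.lam * θ)⁻¹) := by unfold estimateConst; ring
  rw [h3]
  linarith

/-- Bounded solutions of the homogeneous equation vanish. -/
theorem eq_zero_of_orbit (hx : ∀ n, x (n + 1) = c.T (x n))
    (hv : ∀ n, v (n + 1) = c.Φ 1 (x n) (v n)) {A : ℝ} (hA : ∀ n, ‖v n‖ ≤ A) (n : ℤ) : v n = 0 := by
  -- The estimate concerns time zero, so the orbit is re-based at `n`; for zero forcing `B = 0` and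
  -- `θ = 1` are admissible.
  have := c.norm_le_of_orbit (x := fun m => x (n + m)) (v := fun m => v (n + m)) (e := 0)
    (A := A) (B := 0) (θ := 1)
    (fun m => by rw [← add_assoc, hx]) (fun m => by rw [← add_assoc, hv]; simp)
    (fun m => hA _) zero_le_one (by simpa using c.lam_lt_one) (by simp)
  simpa using this

variable [CompleteSpace E]

/-- Along every orbit, `solve X` is the unique bounded solution. -/
theorem bounded_solution_iff {B : ℝ} (hB : ∀ x, ‖X x‖ ≤ B) (hX : ∀ x, c.Φ 0 x (X x) = X x)
    (hx : ∀ n, x (n + 1) = c.T (x n)) :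
    ((∃ A, ∀ n, ‖v n‖ ≤ A) ∧ ∀ n, v (n + 1) = c.Φ 1 (x n) (v n) + X (x (n + 1))) ↔
      ∀ n, v n = c.solve X (x n) := by
  obtain ⟨B', hB'⟩ := c.exists_norm_solve_le hB
  have hstep : ∀ n, c.solve X (x (n + 1)) = c.Φ 1 (x n) (c.solve X (x n)) + X (x (n + 1)) := by
    intro n
    rw [hx, c.solve_step hB, hX]
  constructor
  · rintro ⟨⟨A, hA⟩, hv⟩ n
    refine sub_eq_zero.1 (c.eq_zero_of_orbit (v := fun n => v n - c.solve X (x n)) (A := A + B') hx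
      (fun n => ?_) (fun n => ?_) n)
    · rw [hv, hstep, map_sub]; abel
    · exact (norm_sub_le _ _).trans (add_le_add (hA n) (hB' _))
  · intro hv
    refine ⟨⟨B', fun n => by rw [hv]; exact hB' _⟩, fun n => ?_⟩
    rw [hv, hv, hstep]

end Orbit

section Regularity

/-- `D` is expanded at most by the factor `L ≥ 1` under `T` and `T⁻¹`. -/
structure IsLipschitzBase (D : K → K → ℝ) (L : ℝ) : Prop where
  nonneg : ∀ x y, 0 ≤ D x y
  one_le : 1 ≤ L
  le_T : ∀ x y, D (c.T x) (c.T y) ≤ L * D x y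
  le_T_symm : ∀ x y, D (c.T⁻¹ x) (c.T⁻¹ y) ≤ L * D x y

variable {c}

theorem IsLipschitzBase.le_zpow {D : K → K → ℝ} {L : ℝ} (h : c.IsLipschitzBase D L) (n : ℤ)
    (x y : K) : D ((c.T ^ n) x) ((c.T ^ n) y) ≤ L ^ n.natAbs * D x y := by
  have h0 := h.one_le
  induction n using Int.induction_on generalizing x y with
  | zero => simp
  | succ n ih =>
    rw [zpow_add_one, Equiv.Perm.mul_apply, Equiv.Perm.mul_apply]
    have h1 : ((n : ℤ) + 1).natAbs = n + 1 := by omega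
    rw [h1, pow_succ, mul_assoc]
    refine (ih _ _).trans ?_
    rw [Int.natAbs_natCast]
    have := h.le_T x y
    gcongr
  | pred n ih =>
    rw [zpow_sub_one, Equiv.Perm.mul_apply, Equiv.Perm.mul_apply]
    have h1 : (-(n : ℤ) - 1).natAbs = n + 1 := by omega
    rw [h1, pow_succ, mul_assoc]
    refine (ih _ _).trans ?_
    rw [Int.natAbs_neg, Int.natAbs_natCast]
    have := h.le_T_symm x y
    gcongr

variable [CompleteSpace E]

/-- `solve` preserves Hölder regularity, if the exponent is small. -/
theorem exists_holder_solve {D : K → K → ℝ} {L α a b B : ℝ} (hD : c.IsLipschitzBase D L)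
    (hα : 0 ≤ α) (hLα : c.lam * L ^ α < 1) (ha : ∀ x y, ‖c.Φ 1 x - c.Φ 1 y‖ ≤ a * D x y ^ α)
    (hb : ∀ x y, ‖X x - X y‖ ≤ b * D x y ^ α) (hB : ∀ x, ‖X x‖ ≤ B)
    (hX : ∀ x, c.Φ 0 x (X x) = X x) :
    ∃ b', ∀ x y, ‖c.solve X x - c.solve X y‖ ≤ b' * D x y ^ α := by
  obtain ⟨B', hB'⟩ := c.exists_norm_solve_le hB
  have hL0 : 0 ≤ L := zero_le_one.trans hD.one_le
  refine ⟨c.estimateConst (L ^ α) * (|a| * L ^ α * |B'| + |b|), fun x y => ?_⟩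
  have hDα : 0 ≤ D x y ^ α := Real.rpow_nonneg (hD.nonneg x y) α
  have hpow : ∀ n : ℤ, D ((c.T ^ n) x) ((c.T ^ n) y) ^ α ≤ (L ^ α) ^ n.natAbs * D x y ^ α := by
    intro n
    refine (Real.rpow_le_rpow (hD.nonneg _ _) (hD.le_zpow n x y) hα).trans_eq ?_
    rw [Real.mul_rpow (by positivity) (hD.nonneg _ _), ← Real.rpow_natCast, ← Real.rpow_natCast,
      ← Real.rpow_mul hL0, ← Real.rpow_mul hL0, mul_comm α]
  have hstep : ∀ (n : ℤ) (z : K), c.solve X ((c.T ^ (n + 1)) z) =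
      c.Φ 1 ((c.T ^ n) z) (c.solve X ((c.T ^ n) z)) + X ((c.T ^ (n + 1)) z) := by
    intro n z
    have : (c.T ^ (n + 1)) z = c.T ((c.T ^ n) z) := by
      rw [add_comm, zpow_add, zpow_one, Equiv.Perm.mul_apply]
    rw [this, c.solve_step hB, hX]
  have hL1 : 1 ≤ L ^ α := Real.one_le_rpow hD.one_le hα
  -- The difference of the solutions is regarded as a solution over the orbit of `x`. The mismatch
  -- of the propagators, applied to the bounded solution over `y`, is moved into the forcing; this
  -- is why the estimate must allow vectors outside the fibres.
  have key := c.norm_le_of_orbit (x := fun n => (c.T ^ n) x)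
    (v := fun n => c.solve X ((c.T ^ n) x) - c.solve X ((c.T ^ n) y))
    (e := fun n => (c.Φ 1 ((c.T ^ (n - 1)) x) - c.Φ 1 ((c.T ^ (n - 1)) y))
      (c.solve X ((c.T ^ (n - 1)) y)) + (X ((c.T ^ n) x) - X ((c.T ^ n) y)))
    (A := B' + B') (B := (|a| * L ^ α * |B'| + |b|) * D x y ^ α) (θ := L ^ α)
    (fun n => by rw [add_comm, zpow_add, zpow_one, Equiv.Perm.mul_apply])
    (fun n => ?_) (fun n => (norm_sub_le _ _).trans (add_le_add (hB' _) (hB' _)))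
    (by positivity) hLα (fun n => ?_)
  · simp only [zpow_zero, Equiv.Perm.one_apply] at key
    rwa [← mul_assoc] at key
  · simp only [add_sub_cancel_right, hstep, map_sub, sub_apply]
    abel
  -- The propagator in the forcing at time `n` sits at time `n - 1`, and `|n - 1| ≤ |n| + 1` costs
  -- the extra factor `L ^ α`.
  · have h1 : ‖c.Φ 1 ((c.T ^ (n - 1)) x) - c.Φ 1 ((c.T ^ (n - 1)) y)‖ ≤
        |a| * (L ^ α * (L ^ α) ^ n.natAbs * D x y ^ α) := by
      refine (ha _ _).trans ((mul_le_mul_of_nonneg_right (le_abs_self a)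
        (Real.rpow_nonneg (hD.nonneg _ _) α)).trans ?_)
      gcongr
      refine (hpow (n - 1)).trans ?_
      rw [← pow_succ']
      gcongr
      omega
    have h2 : ‖X ((c.T ^ n) x) - X ((c.T ^ n) y)‖ ≤ |b| * ((L ^ α) ^ n.natAbs * D x y ^ α) := by
      refine (hb _ _).trans ((mul_le_mul_of_nonneg_right (le_abs_self b)
        (Real.rpow_nonneg (hD.nonneg _ _) α)).trans ?_)
      gcongr
      exact hpow n
    refine (norm_add_le _ _).trans ((add_le_add ((ContinuousLinearMap.le_opNorm _ _).trans
      (mul_le_mul h1 ((hB' _).trans (le_abs_self B')) (norm_nonneg _) (by positivity))) h2).trans_eq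
      ?_)
    ring

end Regularity

section Dual

/-- The dual cocycle over the inverse of the base map. -/
def dual : HyperbolicCocycle K (E →L[ℝ] ℝ) where
  T := c.T⁻¹
  -- Over the base `T⁻¹`, time `n` leads from `x` to `T ^ (-n) x`; a covector at `x` is pulled back
  -- there by the propagator that starts at `T ^ (-n) x`.
  Φ n x := ContinuousLinearMap.precomp ℝ (c.Φ n ((c.T ^ (-n)) x))
  Ps x := ContinuousLinearMap.precomp ℝ (c.Ps x)
  Pu x := ContinuousLinearMap.precomp ℝ (c.Pu x)
  C := c.C
  lam := c.lam
  C_nonneg := c.C_nonneg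
  lam_nonneg := c.lam_nonneg
  lam_lt_one := c.lam_lt_one
  Φ_add m n x := by
    ext η w
    have h := c.Φ_add n m ((c.T ^ (-(m + n))) x)
    rw [c.zpow_zpow] at h
    simp only [ContinuousLinearMap.precomp_apply, mul_apply_eq_comp,
      ContinuousLinearMap.comp_apply, inv_zpow', c.zpow_zpow]
    rw [add_comm m n] at h ⊢
    rw [h, mul_apply_eq_comp]
    congr 4
    · congr 2; ring
    · congr 2; ring
  Ps_add_Pu x := by
    ext η w
    simp [← c.Ps_add_Pu]
  Φ_zero_Ps x := by
    ext η w
    have h := congrArg (fun F : E →L[ℝ] E => F w) (c.Ps_comm 0 x)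
    rw [c.Φ_zero_Ps] at h
    simpa using congrArg η h
  Φ_zero_Pu x := by
    ext η w
    have h := congrArg (fun F : E →L[ℝ] E => F w) (c.Pu_comm 0 x)
    rw [c.Φ_zero_Pu] at h
    simpa using congrArg η h
  Ps_comm n x := by
    ext η w
    have h := c.Ps_comm n ((c.T ^ (-n)) x)
    rw [c.zpow_zpow, add_neg_cancel, zpow_zero, Equiv.Perm.one_apply] at h
    have h := congrArg (fun F : E →L[ℝ] E => η (F w)) h
    simpa [inv_zpow'] using h.symm
  Pu_comm n x := by
    ext η w
    have h := c.Pu_comm n ((c.T ^ (-n)) x)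
    rw [c.zpow_zpow, add_neg_cancel, zpow_zero, Equiv.Perm.one_apply] at h
    have h := congrArg (fun F : E →L[ℝ] E => η (F w)) h
    simpa [inv_zpow'] using h.symm
  -- Duality reverses composition, so the projection now acts after the propagator. `Ps_comm`
  -- restores the order in which the decay is known, and stable covectors contract at the same rate.
  norm_Φ_Ps n x := by
    have h := c.Ps_comm n ((c.T ^ (-(n : ℤ))) x)
    rw [c.zpow_zpow, add_neg_cancel, zpow_zero, Equiv.Perm.one_apply] at h
    have hn := c.norm_Φ_Ps n ((c.T ^ (-(n : ℤ))) x)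
    rw [← h] at hn
    refine ContinuousLinearMap.opNorm_le_bound _ ((norm_nonneg _).trans hn) fun η => ?_
    rw [mul_comm]
    exact (ContinuousLinearMap.opNorm_comp_le η (c.Ps x * c.Φ n ((c.T ^ (-(n : ℤ))) x))).trans
      (mul_le_mul_of_nonneg_left hn (norm_nonneg _))
  norm_Φ_Pu n x := by
    have h := c.Pu_comm (-(n : ℤ)) ((c.T ^ (n : ℤ)) x)
    rw [c.zpow_zpow, neg_add_cancel, zpow_zero, Equiv.Perm.one_apply] at h
    have hn := c.norm_Φ_Pu n ((c.T ^ (n : ℤ)) x)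
    rw [← h] at hn
    refine ContinuousLinearMap.opNorm_le_bound _ ((norm_nonneg _).trans hn) fun η => ?_
    rw [mul_comm, neg_neg]
    exact (ContinuousLinearMap.opNorm_comp_le η (c.Pu x * c.Φ (-n) ((c.T ^ (n : ℤ)) x))).trans
      (mul_le_mul_of_nonneg_left hn (norm_nonneg _))

end Dual

end HyperbolicCocycle

end AdjointShadowing
end

/-! ### Calculus of local Hölder functions, and global Hölder estimates on compact spaces. -/

noncomputable section
namespace AdjointShadowing

section LocalHolder

variable {A F G : Type*} [PseudoEMetricSpace A] [NormedAddCommGroup F] [NormedAddCommGroup G]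
  {α : ℝ≥0} {p : A}

theorem HolderNear.continuousAt {g : A → F} (hg : HolderNear α g p) (hα : 0 < α) :
    ContinuousAt g p := by
  obtain ⟨C, W, hW, hC⟩ := hg
  exact (hC.continuousOn hα).continuousAt hW

theorem HolderNear.congr {g h : A → F} (hg : HolderNear α g p) (hgh : g =ᶠ[𝓝 p] h) :
    HolderNear α h p := by
  obtain ⟨C, W, hW, hC⟩ := hg
  refine ⟨C, W ∩ {x | g x = h x}, inter_mem hW hgh, fun x hx y hy => ?_⟩
  have h1 : g x = h x := hx.2
  have h2 : g y = h y := hy.2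
  rw [← h1, ← h2]
  exact hC x hx.1 y hy.1

theorem HolderNear.prodMk {g : A → F} {h : A → G} (hg : HolderNear α g p) (hh : HolderNear α h p) :
    HolderNear α (fun x => (g x, h x)) p := by
  obtain ⟨C, W, hW, hC⟩ := hg
  obtain ⟨C', W', hW', hC'⟩ := hh
  refine ⟨max C C', W ∩ W', inter_mem hW hW', fun x hx y hy => ?_⟩
  rw [Prod.edist_eq]
  refine max_le ((hC x hx.1 y hy.1).trans ?_) ((hC' x hx.2 y hy.2).trans ?_)
  · gcongr; exact le_max_left _ _
  · gcongr; exact le_max_right _ _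

/-- A `C¹` map is locally Lipschitz. Evaluation and scalar multiplication are smooth as maps of a
pair, so their product rules are instances of this. -/
theorem HolderNear.contDiffAt_comp [NormedSpace ℝ F] [NormedSpace ℝ G] {g : A → F} {φ : F → G}
    (hφ : ContDiffAt ℝ 1 φ (g p)) (hg : HolderNear α g p) (hα : 0 < α) :
    HolderNear α (fun x => φ (g x)) p := by
  have hcont := hg.continuousAt hα
  obtain ⟨C, W, hW, hC⟩ := hg
  obtain ⟨L, s, hs, hL⟩ := hφ.exists_lipschitzOnWith
  refine ⟨L * C, W ∩ g ⁻¹' s, inter_mem hW (hcont hs), fun x hx y hy => ?_⟩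
  calc edist (φ (g x)) (φ (g y)) ≤ L * edist (g x) (g y) := hL hx.2 hy.2
    _ ≤ L * (C * edist x y ^ (α : ℝ)) := by
        gcongr
        exact hC x hx.1 y hy.1
    _ = ((L * C : ℝ≥0) : ENNReal) * edist x y ^ (α : ℝ) := by
        rw [ENNReal.coe_mul, mul_assoc]

theorem HolderNear.const (a : F) : HolderNear α (fun _ : A => a) p :=
  ⟨0, Set.univ, univ_mem, fun x _ y _ => by simp⟩

theorem HolderNear.clm_apply [NormedSpace ℝ F] [NormedSpace ℝ G] {g : A → F →L[ℝ] G} {h : A → F}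
    (hg : HolderNear α g p) (hh : HolderNear α h p) (hα : 0 < α) :
    HolderNear α (fun x => g x (h x)) p :=
  HolderNear.contDiffAt_comp (φ := fun q : (F →L[ℝ] G) × F => q.1 q.2)
    isBoundedBilinearMap_apply.contDiff.contDiffAt (hg.prodMk hh) hα

set_option maxSynthPendingDepth 3 in
theorem HolderNear.clm_comp {H : Type*} [NormedAddCommGroup H] [NormedSpace ℝ H] [NormedSpace ℝ F]
    [NormedSpace ℝ G] {g : A → G →L[ℝ] H} {h : A → F →L[ℝ] G}
    (hg : HolderNear α g p) (hh : HolderNear α h p) (hα : 0 < α) :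
    HolderNear α (fun x => (g x).comp (h x)) p :=
  ((HolderNear.const (α := α) (p := p) (ContinuousLinearMap.compL ℝ F G H)).clm_apply hg hα).clm_apply
    hh hα

theorem HolderNear.comp_lipschitzOnWith {B : Type*} [PseudoEMetricSpace B] {g : A → F} {h : B → A}
    {q : B} (hg : HolderNear α g (h q)) {L : ℝ≥0} {W' : Set B} (hW' : W' ∈ 𝓝 q)
    (hh : LipschitzOnWith L h W') : HolderNear α (fun x => g (h x)) q := by
  obtain ⟨C, W, hW, hC⟩ := hg
  have hc : ContinuousAt h q := hh.continuousOn.continuousAt hW'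
  refine ⟨C * L ^ (α : ℝ), W' ∩ h ⁻¹' W, inter_mem hW' (hc hW), fun x hx y hy => ?_⟩
  calc edist (g (h x)) (g (h y)) ≤ C * edist (h x) (h y) ^ (α : ℝ) := hC _ hx.2 _ hy.2
    _ ≤ C * (L * edist x y) ^ (α : ℝ) := by
        gcongr
        exact hh hx.1 hy.1
    _ = _ := by
        rw [ENNReal.mul_rpow_of_nonneg _ _ α.coe_nonneg, ENNReal.coe_mul,
          ENNReal.coe_rpow_of_nonneg _ α.coe_nonneg, mul_assoc]

end LocalHolder

section TruncDist

variable {A : Type*} [PseudoEMetricSpace A]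

/-- The distance truncated at `1`. -/
def truncDist (x y : A) : ℝ := (min (edist x y) 1).toReal

theorem min_edist_ne_top (x y : A) : min (edist x y) 1 ≠ ⊤ :=
  ((min_le_right _ _).trans_lt ENNReal.one_lt_top).ne

theorem truncDist_nonneg (x y : A) : 0 ≤ truncDist x y := ENNReal.toReal_nonneg

theorem truncDist_le_one (x y : A) : truncDist x y ≤ 1 :=
  ENNReal.toReal_le_of_le_ofReal zero_le_one (by simp)

theorem ofReal_truncDist_le (x y : A) : ENNReal.ofReal (truncDist x y) ≤ edist x y := by
  rw [truncDist, ENNReal.ofReal_toReal (min_edist_ne_top x y)]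
  exact min_le_left _ _

/-- Distances between components of `M` may be infinite, while the cocycle estimates need a
real-valued `D`. Truncation makes every distance finite and changes nothing locally. -/
theorem edist_eq_truncDist {x y : A} (h : edist x y ≤ 1) :
    edist x y = ENNReal.ofReal (truncDist x y) := by
  rw [truncDist, ENNReal.ofReal_toReal (min_edist_ne_top x y), min_eq_left h]

/-- On a compact space a local estimate by a power of the distance is global. -/
theorem exists_forall_le_truncDist_rpow [CompactSpace A] {Q : A → A → ℝ} {α B : ℝ} (hα : 0 ≤ α)
    (hB : ∀ x y, Q x y ≤ B)
    (hloc : ∀ p, ∃ C : ℝ, ∃ W ∈ 𝓝 p, ∀ x ∈ W, ∀ y ∈ W, Q x y ≤ C * truncDist x y ^ α) :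
    ∃ C, 0 ≤ C ∧ ∀ x y, Q x y ≤ C * truncDist x y ^ α := by
  choose C W hW hC using hloc
  obtain ⟨t, -, ht⟩ := isCompact_univ.elim_nhds_subcover (fun p : A => interior (W p))
    (fun p _ => interior_mem_nhds.2 (hW p))
  obtain ⟨δ, hδ, hδt⟩ := lebesgue_number_lemma_of_emetric (c := fun p : t => interior (W p))
    isCompact_univ (fun _ => isOpen_interior) (by simpa [Set.iUnion_subtype] using ht)
  have hd : 0 < (min δ 1).toReal := by
    refine ENNReal.toReal_pos (lt_min hδ one_pos).ne' ?_
    exact ((min_le_right _ _).trans_lt ENNReal.one_lt_top).ne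
  -- The sum serves pairs closer than the Lebesgue number `δ`, which lie in one set of the finite
  -- subcover; the quotient serves the remaining pairs, whose truncated distance is at least `min δ
  -- 1`.
  refine ⟨∑ p ∈ t, |C p| + |B| / (min δ 1).toReal ^ α, by positivity, fun x y => ?_⟩
  have hpow := Real.rpow_nonneg (truncDist_nonneg x y) α
  by_cases hxy : edist y x < δ
  · obtain ⟨p, hp⟩ := hδt x trivial
    have hx : x ∈ W p := interior_subset (hp (Metric.mem_eball_self hδ))
    have hy : y ∈ W p := interior_subset (hp hxy)
    refine (hC p x hx y hy).trans (mul_le_mul_of_nonneg_right ?_ hpow)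
    have h1 : |C p| ≤ ∑ p ∈ t, |C p| :=
      Finset.single_le_sum (f := fun p => |C p|) (fun _ _ => abs_nonneg _) p.2
    have h2 : 0 ≤ |B| / (min δ 1).toReal ^ α := by positivity
    linarith [le_abs_self (C p)]
  · have h1 : (min δ 1).toReal ≤ truncDist x y := by
      refine ENNReal.toReal_mono (min_edist_ne_top x y) (min_le_min_right _ ?_)
      rw [edist_comm]; exact not_lt.1 hxy
    have h2 : (min δ 1).toReal ^ α ≤ truncDist x y ^ α := Real.rpow_le_rpow hd.le h1 hα
    have h3 : 0 < (min δ 1).toReal ^ α := Real.rpow_pos_of_pos hd α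
    calc Q x y ≤ |B| := (hB x y).trans (le_abs_self B)
      _ = |B| / (min δ 1).toReal ^ α * (min δ 1).toReal ^ α := by field_simp
      _ ≤ (∑ p ∈ t, |C p| + |B| / (min δ 1).toReal ^ α) * truncDist x y ^ α := by
          gcongr
          exact le_add_of_nonneg_left (Finset.sum_nonneg fun _ _ => abs_nonneg _)

variable {F : Type*} [NormedAddCommGroup F] {α : ℝ≥0} {g : A → F}

theorem continuous_of_holderNear (hα : 0 < α) (hg : ∀ p, HolderNear α g p) : Continuous g :=
  continuous_iff_continuousAt.2 fun p => (hg p).continuousAt hα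

theorem exists_norm_le_of_holderNear [CompactSpace A] (hα : 0 < α) (hg : ∀ p, HolderNear α g p) :
    ∃ B, ∀ x, ‖g x‖ ≤ B := by
  obtain ⟨B, hB⟩ := isCompact_univ.exists_bound_of_continuousOn
    (continuous_of_holderNear hα hg).continuousOn
  exact ⟨B, fun x => hB x trivial⟩

theorem edist_le_one_nhds (p : A) : ∃ W ∈ 𝓝 p, ∀ x ∈ W, ∀ y ∈ W, edist x y ≤ 1 := by
  refine ⟨Metric.eball p 2⁻¹, Metric.eball_mem_nhds p (by norm_num), fun x hx y hy => ?_⟩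
  calc edist x y ≤ edist x p + edist p y := edist_triangle _ _ _
    _ ≤ 2⁻¹ + 2⁻¹ := add_le_add hx.le (by rw [edist_comm]; exact hy.le)
    _ = 1 := ENNReal.inv_two_add_inv_two

theorem exists_norm_sub_le_of_holderNear [CompactSpace A] (hα : 0 < α)
    (hg : ∀ p, HolderNear α g p) :
    ∃ C, 0 ≤ C ∧ ∀ x y, ‖g x - g y‖ ≤ C * truncDist x y ^ (α : ℝ) := by
  obtain ⟨B, hB⟩ := exists_norm_le_of_holderNear hα hg
  refine exists_forall_le_truncDist_rpow (B := B + B) α.coe_nonneg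
    (fun x y => (norm_sub_le _ _).trans (add_le_add (hB x) (hB y))) fun p => ?_
  obtain ⟨C, W, hW, hC⟩ := hg p
  obtain ⟨W', hW', h1⟩ := edist_le_one_nhds p
  refine ⟨C, W ∩ W', inter_mem hW hW', fun x hx y hy => ?_⟩
  have h := hC x hx.1 y hy.1
  rw [edist_eq_truncDist (h1 x hx.2 y hy.2), edist_dist, dist_eq_norm,
    ENNReal.ofReal_rpow_of_nonneg (truncDist_nonneg _ _) α.coe_nonneg, ← ENNReal.ofReal_coe_nnreal,
    ← ENNReal.ofReal_mul C.coe_nonneg] at h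
  exact (ENNReal.ofReal_le_ofReal_iff
    (mul_nonneg C.coe_nonneg (Real.rpow_nonneg (truncDist_nonneg _ _) _))).1 h

theorem holderNear_of_forall_norm_sub_le {C : ℝ}
    (h : ∀ x y, ‖g x - g y‖ ≤ C * truncDist x y ^ (α : ℝ)) (p : A) : HolderNear α g p := by
  refine ⟨|C|.toNNReal, Set.univ, univ_mem, fun x _ y _ => ?_⟩
  have ht := truncDist_nonneg x y
  rw [edist_dist, dist_eq_norm]
  calc ENNReal.ofReal ‖g x - g y‖ ≤ ENNReal.ofReal (|C| * truncDist x y ^ (α : ℝ)) :=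
        ENNReal.ofReal_le_ofReal ((h x y).trans
          (mul_le_mul_of_nonneg_right (le_abs_self C) (Real.rpow_nonneg ht _)))
    _ = ENNReal.ofReal |C| * ENNReal.ofReal (truncDist x y) ^ (α : ℝ) := by
        rw [ENNReal.ofReal_mul (abs_nonneg C), ENNReal.ofReal_rpow_of_nonneg ht α.coe_nonneg]
    _ ≤ ENNReal.ofReal |C| * edist x y ^ (α : ℝ) := by
        gcongr
        exact ofReal_truncDist_le x y

end TruncDist

end AdjointShadowing
end

/-! ### Smooth maps on a Riemannian manifold are locally Lipschitz. -/

noncomputable section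
namespace AdjointShadowing

section Lipschitz

open Manifold

variable {E : Type*} [NormedAddCommGroup E] [NormedSpace ℝ E] {H : Type*} [TopologicalSpace H]
  {I : ModelWithCorners ℝ E H} {M : Type*} [PseudoEMetricSpace M] [ChartedSpace H M]
  [RiemannianBundle (fun x : M => TangentSpace I x)]
  {E' : Type*} [NormedAddCommGroup E'] [NormedSpace ℝ E'] {H' : Type*} [TopologicalSpace H']
  {I' : ModelWithCorners ℝ E' H'} {N : Type*} [PseudoEMetricSpace N] [ChartedSpace H' N]
  [RiemannianBundle (fun x : N => TangentSpace I' x)]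

/-- A `C¹` map does not increase the length of a path by more than the bound on its derivative. -/
theorem pathELength_comp_le {f : M → N} {γ : ℝ → M} {C : ℝ≥0} (hγ : ContMDiff 𝓘(ℝ, ℝ) I 1 γ)
    (hf : ∀ t ∈ Set.Icc (0 : ℝ) 1, ContMDiffAt I I' 1 f (γ t))
    (hC : ∀ t ∈ Set.Icc (0 : ℝ) 1, ∀ v, ‖mfderiv I I' f (γ t) v‖ₑ ≤ C * ‖v‖ₑ) :
    pathELength I' (f ∘ γ) 0 1 ≤ C * pathELength I γ 0 1 := by
  rw [pathELength_eq_lintegral_mfderivWithin_Icc, pathELength_eq_lintegral_mfderivWithin_Icc,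
    ← lintegral_const_mul' _ _ ENNReal.coe_ne_top]
  refine setLIntegral_mono' measurableSet_Icc fun t ht => ?_
  have h1 : mfderivWithin 𝓘(ℝ, ℝ) I' (f ∘ γ) (Set.Icc 0 1) t =
      (mfderiv I I' f (γ t)).comp (mfderivWithin 𝓘(ℝ, ℝ) I γ (Set.Icc 0 1) t) := by
    apply mfderiv_comp_mfderivWithin
    · exact (hf t ht).mdifferentiableAt one_ne_zero
    · exact (hγ.mdifferentiable one_ne_zero).mdifferentiableOn _ ht
    · rw [uniqueMDiffWithinAt_iff_uniqueDiffWithinAt]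
      exact uniqueDiffOn_Icc zero_lt_one _ ht
  have h2 : mfderivWithin 𝓘(ℝ, ℝ) I' (f ∘ γ) (Set.Icc 0 1) t 1 =
      (mfderiv I I' f (γ t)) (mfderivWithin 𝓘(ℝ, ℝ) I γ (Set.Icc 0 1) t 1) := DFunLike.congr_fun h1 1
  rw [h2]
  exact hC t ht _

variable [IsRiemannianManifold I M] [IsRiemannianManifold I' N]

/-- A `C¹` map between Riemannian manifolds is locally Lipschitz. -/
theorem exists_lipschitzOnWith_of_mfderiv {f : M → N} {p : M} {C : ℝ≥0}
    (hf : ∀ᶠ y in 𝓝 p, ContMDiffAt I I' 1 f y)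
    (hC : ∀ᶠ y in 𝓝 p, ∀ v, ‖mfderiv I I' f y v‖ₑ ≤ C * ‖v‖ₑ) :
    ∃ W ∈ 𝓝 p, LipschitzOnWith C f W := by
  obtain ⟨r, hr, hball⟩ := EMetric.mem_nhds_iff.1 (hf.and hC)
  -- Points of the ball of radius `r / 3` are less than `2r / 3` apart, so a nearly shortest path
  -- between them stays in the ball of radius `r`, where the derivative bound holds.
  have hr3 : 0 < r / 3 := ENNReal.div_pos hr.ne' (by norm_num)
  refine ⟨Metric.eball p (r / 3), Metric.eball_mem_nhds p hr3, fun x hx y hy => ?_⟩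
  have hxy : edist x y < r / 3 + r / 3 := by
    refine (edist_triangle _ p _).trans_lt (ENNReal.add_lt_add hx ?_)
    rw [edist_comm]; exact hy
  have key : ∀ L, edist x y < L → L < r / 3 + r / 3 → edist (f x) (f y) ≤ C * L := by
    intro L hL hLr
    rw [IsRiemannianManifold.out (I := I) x y] at hL
    obtain ⟨γ, hγx, hγy, hγ, hlen, -⟩ :=
      exists_lt_locally_constant_of_riemannianEDist_lt hL zero_lt_one
    have hmem : ∀ t ∈ Set.Icc (0 : ℝ) 1, γ t ∈ Metric.eball p r := by
      intro t ht
      have h1 : edist x (γ t) ≤ pathELength I γ 0 1 := by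
        rw [IsRiemannianManifold.out (I := I) x (γ t)]
        exact (riemannianEDist_le_pathELength hγ.contMDiffOn hγx rfl ht.1).trans
          (pathELength_mono le_rfl ht.2)
      calc edist (γ t) p ≤ edist (γ t) x + edist x p := edist_triangle _ _ _
        _ < (r / 3 + r / 3) + r / 3 := by
            refine ENNReal.add_lt_add ?_ hx
            rw [edist_comm]
            exact h1.trans_lt (hlen.trans hLr)
        _ = r := ENNReal.add_thirds r
    have hfγ : ∀ t ∈ Set.Icc (0 : ℝ) 1, ContMDiffAt I I' 1 f (γ t) := fun t ht =>
      (hball (hmem t ht)).1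
    rw [IsRiemannianManifold.out (I := I') (f x) (f y)]
    refine (riemannianEDist_le_pathELength (γ := f ∘ γ) (fun t ht => ?_) (by simp [hγx])
      (by simp [hγy]) zero_le_one).trans ((pathELength_comp_le (I := I) hγ hfγ
        fun t ht => (hball (hmem t ht)).2).trans (by gcongr))
    exact ((hfγ t ht).comp t (hγ t)).contMDiffWithinAt
  -- The distance is only an infimum of lengths, so the estimate is proved for every `L` slightly
  -- above it and then passed to the limit.
  have hne : (𝓝[>] (edist x y)).NeBot := nhdsGT_neBot_of_exists_gt ⟨_, hxy⟩
  have ht : Tendsto (fun L => (C : ENNReal) * L) (𝓝[>] (edist x y)) (𝓝 (C * edist x y)) :=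
    (ENNReal.Tendsto.const_mul tendsto_id (Or.inr ENNReal.coe_ne_top)).mono_left
      nhdsWithin_le_nhds
  refine ge_of_tendsto ht ?_
  filter_upwards [self_mem_nhdsWithin, nhdsWithin_le_nhds (Iio_mem_nhds hxy)] with L h1 h2
  exact key L h1 h2

end Lipschitz

section Chart

variable {d : ℕ} {M : Type*} [EMetricSpace M]
    [ChartedSpace (EuclideanSpace ℝ (Fin d)) M] [IsManifold (𝓡 d) ∞ M]

/-- The derivative of a smooth map in the trivializations of the tangent bundle is smooth. -/
theorem contMDiffAt_mfderiv_coord {E' : Type*} [NormedAddCommGroup E'] [NormedSpace ℝ E']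
    {H' : Type*} [TopologicalSpace H'] {I' : ModelWithCorners ℝ E' H'} {N : Type*}
    [TopologicalSpace N] [ChartedSpace H' N] [IsManifold I' ∞ N] {f : M → N} {p : M}
    (hf : ContMDiffAt (𝓡 d) I' ∞ f p) :
    ContMDiffAt (𝓡 d) 𝓘(ℝ, EuclideanSpace ℝ (Fin d) →L[ℝ] E') ∞ (fun x =>
      ((trivializationAt E' (TangentSpace I') (f p)).continuousLinearMapAt ℝ (f x)).comp
        ((mfderiv (𝓡 d) I' f x).comp
          ((trivializationAt (EuclideanSpace ℝ (Fin d)) (TangentSpace (𝓡 d)) p).symmL ℝ x))) p :=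
  ContMDiffAt.mfderiv_const (m := ∞) (n := ∞) hf le_rfl

variable [RiemannianBundle (fun x : M => TangentSpace (𝓡 d) x)]
    [IsContMDiffRiemannianBundle (𝓡 d) ∞ (EuclideanSpace ℝ (Fin d))
      (fun x : M => TangentSpace (𝓡 d) x)]

theorem isContinuousRiemannianBundle_tangentSpace :
    IsContinuousRiemannianBundle (EuclideanSpace ℝ (Fin d))
      (fun x : M => TangentSpace (𝓡 d) x) := by
  obtain ⟨g, hg, h⟩ := IsContMDiffRiemannianBundle.exists_contMDiff (IB := 𝓡 d) (n := ∞)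
    (F := EuclideanSpace ℝ (Fin d)) (E := fun x : M => TangentSpace (𝓡 d) x)
  exact ⟨g, hg.continuous, h⟩

/-- One half of the local equivalence of the Riemannian norm with the Euclidean norm of chart
components, from continuity of the metric. -/
theorem eventually_norm_tangentCoord_le (p : M) : ∃ C : ℝ, 0 ≤ C ∧ ∀ᶠ y in 𝓝 p,
    ∀ v : TangentSpace (𝓡 d) y, ‖(trivializationAt (EuclideanSpace ℝ (Fin d))
      (TangentSpace (𝓡 d)) p).continuousLinearMapAt ℝ y v‖ ≤ C * ‖v‖ := by
  have := isContinuousRiemannianBundle_tangentSpace (d := d) (M := M)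
  obtain ⟨C, h0, hC⟩ := eventually_norm_trivializationAt_lt (EuclideanSpace ℝ (Fin d))
    (fun x : M => TangentSpace (𝓡 d) x) p
  refine ⟨C, h0.le, hC.mono fun y hy v => ?_⟩
  exact ContinuousLinearMap.le_of_opNorm_le _ hy.le v

theorem eventually_norm_tangentCoord_symm_le (p : M) : ∃ C : ℝ, 0 ≤ C ∧ ∀ᶠ y in 𝓝 p,
    ∀ v : EuclideanSpace ℝ (Fin d), ‖(trivializationAt (EuclideanSpace ℝ (Fin d))
      (TangentSpace (𝓡 d)) p).symmL ℝ y v‖ ≤ C * ‖v‖ := by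
  have := isContinuousRiemannianBundle_tangentSpace (d := d) (M := M)
  obtain ⟨C, h0, hC⟩ := eventually_norm_symmL_trivializationAt_lt (EuclideanSpace ℝ (Fin d))
    (fun x : M => TangentSpace (𝓡 d) x) p
  refine ⟨C, h0.le, hC.mono fun y hy v => ?_⟩
  exact ContinuousLinearMap.le_of_opNorm_le _ hy.le v

variable [IsRiemannianManifold (𝓡 d) M]

theorem exists_lipschitzOnWith_extChartAt (p : M) :
    ∃ C, ∃ W ∈ 𝓝 p, LipschitzOnWith C (extChartAt (𝓡 d) p) W := by
  have : IsManifold (𝓡 d) 1 M := .of_le (n := ∞) (by simp)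
  obtain ⟨C, h0, hC⟩ := eventually_norm_tangentCoord_le (d := d) p
  have hsrc := (chartAt (EuclideanSpace ℝ (Fin d)) p).open_source.mem_nhds (mem_chart_source _ p)
  refine ⟨C.toNNReal, exists_lipschitzOnWith_of_mfderiv (I := 𝓡 d)
    (I' := 𝓘(ℝ, EuclideanSpace ℝ (Fin d))) ?_ ?_⟩
  · filter_upwards [hsrc] with y hy
    exact contMDiffAt_extChartAt' hy
  · filter_upwards [hC, hsrc] with y hy hys v
    have h := hy v
    rw [TangentBundle.continuousLinearMapAt_trivializationAt hys] at h
    rw [← ofReal_norm, ← ofReal_norm, norm_tangentSpace_vectorSpace]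
    refine (ENNReal.ofReal_le_ofReal h).trans_eq ?_
    rw [ENNReal.ofReal_mul h0]; rfl

theorem exists_lipschitzOnWith_of_contMDiff {f : M → M} (hf : ContMDiff (𝓡 d) (𝓡 d) ∞ f) (p : M) :
    ∃ C, ∃ W ∈ 𝓝 p, LipschitzOnWith C f W := by
  obtain ⟨C₁, h₁, hC₁⟩ := eventually_norm_tangentCoord_le (d := d) p
  obtain ⟨C₂, h₂, hC₂⟩ := eventually_norm_tangentCoord_symm_le (d := d) (f p)
  have hcoord := (contMDiffAt_mfderiv_coord (hf p)).continuousAt.norm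
  have hb := hcoord.eventually_lt continuousAt_const (lt_add_one _)
  set e := trivializationAt (EuclideanSpace ℝ (Fin d)) (TangentSpace (𝓡 d)) p with he
  set e' := trivializationAt (EuclideanSpace ℝ (Fin d)) (TangentSpace (𝓡 d)) (f p) with he'
  set B := _ + (1 : ℝ) with hB
  have hB0 : 0 ≤ B := by positivity
  have hsrc := e.open_baseSet.mem_nhds (FiberBundle.mem_baseSet_trivializationAt' p)
  have hsrc' := hf.continuous.continuousAt.preimage_mem_nhds
    (e'.open_baseSet.mem_nhds (FiberBundle.mem_baseSet_trivializationAt' (f p)))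
  refine ⟨(C₂ * (B * C₁)).toNNReal, exists_lipschitzOnWith_of_mfderiv (I := 𝓡 d) (I' := 𝓡 d)
    (Eventually.of_forall fun y => (hf y).of_le (by simp)) ?_⟩
  filter_upwards [hC₁, hf.continuous.continuousAt.eventually hC₂, hb, hsrc, hsrc'] with y h1 h2 h3 h4 h5 v
  -- In trivializations the derivative varies continuously, hence is locally bounded by `B`; the
  -- factors `C₁` and `C₂` convert to and from the Riemannian norms.
  have key : mfderiv (𝓡 d) (𝓡 d) f y v = e'.symmL ℝ (f y) (((e'.continuousLinearMapAt ℝ (f y)).comp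
        ((mfderiv (𝓡 d) (𝓡 d) f y).comp (e.symmL ℝ y))) (e.continuousLinearMapAt ℝ y v)) := by
    simp only [ContinuousLinearMap.comp_apply]
    rw [e.symmL_continuousLinearMapAt h4, e'.symmL_continuousLinearMapAt h5]
  rw [← ofReal_norm, ← ofReal_norm]
  have : ‖mfderiv (𝓡 d) (𝓡 d) f y v‖ ≤ C₂ * (B * C₁) * ‖v‖ := by
    rw [key]
    refine (h2 _).trans ?_
    rw [mul_assoc, mul_assoc]
    refine mul_le_mul_of_nonneg_left ?_ h₂
    exact (ContinuousLinearMap.le_opNorm _ _).trans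
      (mul_le_mul h3.le (h1 v) (norm_nonneg _) hB0)
  refine (ENNReal.ofReal_le_ofReal this).trans_eq ?_
  rw [ENNReal.ofReal_mul (by positivity)]; rfl

/-- A smooth function on a Riemannian manifold is locally Lipschitz. -/
theorem holderNear_one_of_contMDiffAt {F : Type*} [NormedAddCommGroup F] [NormedSpace ℝ F]
    {g : M → F} {p : M} (hg : ContMDiffAt (𝓡 d) 𝓘(ℝ, F) ∞ g p) : HolderNear 1 g p := by
  obtain ⟨C, W, hW, hC⟩ := exists_lipschitzOnWith_extChartAt (d := d) p
  have h1 : HolderNear 1 (extChartAt (𝓡 d) p) p := ⟨C, W, hW, holderOnWith_one.2 hC⟩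
  have h2 : ContDiffAt ℝ 1 (g ∘ (extChartAt (𝓡 d) p).symm) (extChartAt (𝓡 d) p p) := by
    have := (contMDiffAt_iff.1 hg).2
    simp only [extChartAt_model_space_eq_id] at this
    rw [ModelWithCorners.range_eq_univ, contDiffWithinAt_univ] at this
    exact this.of_le (by simp)
  refine (HolderNear.contDiffAt_comp h2 h1 one_pos).congr ?_
  filter_upwards [extChartAt_source_mem_nhds (I := 𝓡 d) p] with x hx
  simp only [Function.comp_apply, (extChartAt (𝓡 d) p).left_inv hx]

theorem holderNear_one_subtype {F : Type*} [NormedAddCommGroup F] [NormedSpace ℝ F] {K : Set M}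
    {g : M → F} {p : K} (hg : ContMDiffAt (𝓡 d) 𝓘(ℝ, F) ∞ g p) :
    HolderNear 1 (fun x : K => g x) p :=
  (holderNear_one_of_contMDiffAt hg).comp_lipschitzOnWith (h := Subtype.val) univ_mem
    (LipschitzWith.subtype_val K).lipschitzOnWith

end Chart

end AdjointShadowing
end

/-! ### Embedding the tangent bundle over a compact set into a trivial bundle. -/

noncomputable section
namespace AdjointShadowing

section Embedding

variable {d : ℕ} {M : Type*} [EMetricSpace M]
    [ChartedSpace (EuclideanSpace ℝ (Fin d)) M]

/-- Off the closed support the product vanishes in a neighbourhood, so a `G` that is smooth only on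
a chart domain may be extended by a cutoff. -/
theorem contMDiffAt_smul_of_mem_tsupport {F : Type*} [NormedAddCommGroup F] [NormedSpace ℝ F]
    {φ : M → ℝ} {G : M → F} {p : M} (hφ : ContMDiffAt (𝓡 d) 𝓘(ℝ, ℝ) ∞ φ p)
    (hG : p ∈ tsupport φ → ContMDiffAt (𝓡 d) 𝓘(ℝ, F) ∞ G p) :
    ContMDiffAt (𝓡 d) 𝓘(ℝ, F) ∞ (fun x => φ x • G x) p := by
  by_cases hp : p ∈ tsupport φ
  · exact hφ.smul (hG hp)
  · refine (contMDiffAt_const (c := (0 : F))).congr_of_eventuallyEq ?_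
    filter_upwards [(isClosed_tsupport φ).isOpen_compl.mem_nhds hp] with x hx
    rw [image_eq_zero_of_notMem_tsupport hx, zero_smul]

variable [IsManifold (𝓡 d) ∞ M]

variable (d) in
/-- The trivialization of the tangent bundle given by the chart at `p`. -/
abbrev tangentTriv (p : M) :=
  trivializationAt (EuclideanSpace ℝ (Fin d)) (TangentSpace (𝓡 d) : M → Type _) p

variable (d) in
/-- A smooth embedding of `T_K M` into a trivial bundle with fibre `E`, with a smooth left
inverse. -/
structure TangentEmbedding (K : Set M) (E : Type*) [NormedAddCommGroup E] [NormedSpace ℝ E] where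
  /-- The embedding of the tangent spaces. -/
  emb : (x : M) → TangentSpace (𝓡 d) x →L[ℝ] E
  /-- The left inverse of the embedding. -/
  ret : (x : M) → E →L[ℝ] TangentSpace (𝓡 d) x
  ret_emb : ∀ x ∈ K, ∀ v, ret x (emb x v) = v
  contMDiffAt_emb : ∀ p ∈ K, ContMDiffAt (𝓡 d) 𝓘(ℝ, EuclideanSpace ℝ (Fin d) →L[ℝ] E) ∞
    (fun x => (emb x).comp ((tangentTriv d p).symmL ℝ x)) p
  contMDiffAt_ret : ∀ p ∈ K, ContMDiffAt (𝓡 d) 𝓘(ℝ, E →L[ℝ] EuclideanSpace ℝ (Fin d)) ∞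
    (fun x => ((tangentTriv d p).continuousLinearMapAt ℝ x).comp (ret x)) p

theorem mem_baseSet_tangentTriv (p : M) : p ∈ (tangentTriv d p).baseSet :=
  FiberBundle.mem_baseSet_trivializationAt' p

theorem baseSet_tangentTriv_mem_nhds (p : M) : (tangentTriv d p).baseSet ∈ 𝓝 p :=
  (tangentTriv d p).open_baseSet.mem_nhds (mem_baseSet_tangentTriv p)

theorem contMDiffAt_tangentTriv_comp_symmL {p q x : M} (hp : x ∈ (tangentTriv d p).baseSet)
    (hq : x ∈ (tangentTriv d q).baseSet) :
    ContMDiffAt (𝓡 d) 𝓘(ℝ, EuclideanSpace ℝ (Fin d) →L[ℝ] EuclideanSpace ℝ (Fin d)) ∞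
      (fun y => ((tangentTriv d q).continuousLinearMapAt ℝ y).comp
        ((tangentTriv d p).symmL ℝ y)) x := by
  refine (contMDiffAt_coordChangeL (IB := 𝓡 d) (n := ∞) (e := tangentTriv d p)
    (e' := tangentTriv d q) hp hq).congr_of_eventuallyEq ?_
  filter_upwards [(tangentTriv d p).open_baseSet.mem_nhds hp,
    (tangentTriv d q).open_baseSet.mem_nhds hq] with y h1 h2
  ext1 v
  rw [ContinuousLinearEquiv.coe_coe, Trivialization.coordChangeL_apply _ _ ⟨h1, h2⟩,
    ContinuousLinearMap.comp_apply, Trivialization.symmL_apply,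
    Trivialization.continuousLinearMapAt_apply, Trivialization.coe_linearMapAt_of_mem _ h2]
  exact h1

/-- The tangent bundle over a compact set embeds into a trivial bundle. -/
theorem exists_tangentEmbedding [SigmaCompactSpace M] {K : Set M} (hK : IsCompact K) :
    ∃ t : Finset M, Nonempty (TangentEmbedding d K (t → EuclideanSpace ℝ (Fin d))) := by
  classical
  obtain ⟨t, -, ht⟩ := hK.elim_nhds_subcover (fun p : M => (tangentTriv d p).baseSet)
    (fun p _ => baseSet_tangentTriv_mem_nhds p)
  obtain ⟨φ, hφ⟩ := SmoothPartitionOfUnity.exists_isSubordinate (𝓡 d) hK.isClosed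
    (fun p : t => (tangentTriv d (p : M)).baseSet) (fun p => (tangentTriv d (p : M)).open_baseSet)
    (by simpa [Set.iUnion_subtype] using ht)
  have hsmooth : ∀ j, ContMDiff (𝓡 d) 𝓘(ℝ, ℝ) ∞ (φ j) := fun j => (φ j).contMDiff
  -- The weight `φ j` occurs once in the embedding and once in its left inverse, so the composite is
  -- multiplication by `s`; division by `s`, nonzero on `K`, normalizes it.
  let s : M → ℝ := fun x => ∑ j, φ j x ^ 2
  have hs : ContMDiff (𝓡 d) 𝓘(ℝ, ℝ) ∞ s := contMDiff_finsetSum fun j _ => (hsmooth j).pow 2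
  have hs0 : ∀ x ∈ K, s x ≠ 0 := by
    intro x hx h
    have h1 := φ.sum_eq_one hx
    rw [finsum_eq_sum_of_fintype] at h1
    rw [Finset.sum_eq_zero_iff_of_nonneg (fun _ _ => sq_nonneg _)] at h
    rw [Finset.sum_eq_zero (fun j hj => pow_eq_zero_iff two_ne_zero |>.1 (h j hj))] at h1
    exact zero_ne_one h1
  have hmem : ∀ j x, φ j x ≠ 0 → x ∈ (tangentTriv d (j : M)).baseSet := fun j x hx =>
    hφ j (subset_tsupport _ hx)
  refine ⟨t, ⟨{
    emb := fun x => ∑ j, φ j x • (ContinuousLinearMap.single ℝ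
      (fun _ : t => EuclideanSpace ℝ (Fin d)) j).comp ((tangentTriv d (j : M)).continuousLinearMapAt ℝ x)
    ret := fun x => ∑ j, φ j x • (s x)⁻¹ • ((tangentTriv d (j : M)).symmL ℝ x).comp
      (ContinuousLinearMap.proj (R := ℝ) (φ := fun _ : t => EuclideanSpace ℝ (Fin d)) j)
    ret_emb := ?_
    contMDiffAt_emb := ?_
    contMDiffAt_ret := ?_ }⟩⟩
  · intro x hx v
    have h1 : ∀ j : t, (∑ k, φ k x • (ContinuousLinearMap.single ℝ
        (fun _ : t => EuclideanSpace ℝ (Fin d)) k).comp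
          ((tangentTriv d (k : M)).continuousLinearMapAt ℝ x)) v j =
        φ j x • (tangentTriv d (j : M)).continuousLinearMapAt ℝ x v := by
      intro j
      rw [sum_apply, Finset.sum_apply, Finset.sum_eq_single j]
      · simp
      · intro k _ hk
        simp [Pi.single_eq_of_ne hk.symm]
      · simp
    rw [sum_apply]
    have h2 : ∀ j : t, (φ j x • (s x)⁻¹ • ((tangentTriv d (j : M)).symmL ℝ x).comp
      (ContinuousLinearMap.proj (R := ℝ) (φ := fun _ : t => EuclideanSpace ℝ (Fin d)) j))
        ((∑ k, φ k x • (ContinuousLinearMap.single ℝ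
        (fun _ : t => EuclideanSpace ℝ (Fin d)) k).comp
          ((tangentTriv d (k : M)).continuousLinearMapAt ℝ x)) v) = ((s x)⁻¹ * φ j x ^ 2) • v := by
      intro j
      simp only [smul_apply, ContinuousLinearMap.comp_apply, ContinuousLinearMap.proj_apply]
      rw [h1 j, map_smul]
      by_cases hj : φ j x = 0
      · simp [hj]
      · rw [Trivialization.symmL_continuousLinearMapAt _ (hmem j x hj), smul_smul, smul_smul]
        congr 1; ring
    rw [Finset.sum_congr rfl fun j _ => h2 j, ← Finset.sum_smul, ← Finset.mul_sum,
      inv_mul_cancel₀ (hs0 x hx), one_smul]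
  · intro p hp
    have h : ∀ j : t, ContMDiffAt (𝓡 d)
        𝓘(ℝ, EuclideanSpace ℝ (Fin d) →L[ℝ] (t → EuclideanSpace ℝ (Fin d))) ∞
        (fun x => φ j x • (ContinuousLinearMap.single ℝ (fun _ : t => EuclideanSpace ℝ (Fin d)) j).comp
          (((tangentTriv d (j : M)).continuousLinearMapAt ℝ x).comp
            ((tangentTriv d p).symmL ℝ x))) p := fun j =>
      contMDiffAt_smul_of_mem_tsupport (hsmooth j p) fun hj =>
        (contMDiffAt_const (c := ContinuousLinearMap.single ℝ
          (fun _ : t => EuclideanSpace ℝ (Fin d)) j)).clm_comp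
          (contMDiffAt_tangentTriv_comp_symmL (mem_baseSet_tangentTriv p) (hφ j hj))
    refine (contMDiffAt_finsetSum (t := Finset.univ) fun j _ => h j).congr_of_eventuallyEq
      (Eventually.of_forall fun x => ?_)
    ext1 v
    simp [sum_apply]
  · intro p hp
    have h : ∀ j : t, ContMDiffAt (𝓡 d)
        𝓘(ℝ, (t → EuclideanSpace ℝ (Fin d)) →L[ℝ] EuclideanSpace ℝ (Fin d)) ∞
        (fun x => φ j x • (s x)⁻¹ • (((tangentTriv d p).continuousLinearMapAt ℝ x).comp
            ((tangentTriv d (j : M)).symmL ℝ x)).comp (ContinuousLinearMap.proj (R := ℝ)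
              (φ := fun _ : t => EuclideanSpace ℝ (Fin d)) j)) p := fun j =>
      contMDiffAt_smul_of_mem_tsupport (hsmooth j p) fun hj =>
        ((hs p).inv₀ (hs0 p hp)).smul
          ((contMDiffAt_tangentTriv_comp_symmL (hφ j hj) (mem_baseSet_tangentTriv p)).clm_comp
            contMDiffAt_const)
    refine (contMDiffAt_finsetSum (t := Finset.univ) fun j _ => h j).congr_of_eventuallyEq
      (Eventually.of_forall fun x => ?_)
    ext1 v
    simp [sum_apply]

end Embedding

end AdjointShadowing
end

/-! ### Regularity and norms of fields, read in the embedding. -/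

noncomputable section
namespace AdjointShadowing

namespace TangentEmbedding

variable {d : ℕ} {M : Type*} [EMetricSpace M]
  [ChartedSpace (EuclideanSpace ℝ (Fin d)) M] [IsManifold (𝓡 d) ∞ M]
  {K : Set M} {E : Type*} [NormedAddCommGroup E] [NormedSpace ℝ E] (b : TangentEmbedding d K E)

theorem eventually_mem_baseSet (p : K) :
    ∀ᶠ x : K in 𝓝 p, (x : M) ∈ (tangentTriv d (p : M)).baseSet :=
  continuous_subtype_val.continuousAt.eventually (baseSet_tangentTriv_mem_nhds (p : M))

theorem emb_eq_coord {p x : M} (hx : x ∈ (tangentTriv d p).baseSet) (v : TangentSpace (𝓡 d) x) :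
    b.emb x v = ((b.emb x).comp ((tangentTriv d p).symmL ℝ x))
      ((tangentTriv d p).continuousLinearMapAt ℝ x v) := by
  rw [ContinuousLinearMap.comp_apply, Trivialization.symmL_continuousLinearMapAt _ hx]

theorem ret_eq_coord {p x : M} (hx : x ∈ (tangentTriv d p).baseSet) (w : E) :
    b.ret x w = (tangentTriv d p).symmL ℝ x
      ((((tangentTriv d p).continuousLinearMapAt ℝ x).comp (b.ret x)) w) := by
  rw [ContinuousLinearMap.comp_apply, Trivialization.symmL_continuousLinearMapAt _ hx]

theorem continuousAt_conj {A : (x : K) → TangentSpace (𝓡 d) (x : M) →L[ℝ] TangentSpace (𝓡 d) (x : M)}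
    {p : K} (hA : ContinuousAt (fun x : K =>
      (((tangentTriv d (p : M)).continuousLinearMapAt ℝ (x : M)).comp
        ((A x).comp ((tangentTriv d (p : M)).symmL ℝ (x : M))) :
          EuclideanSpace ℝ (Fin d) →L[ℝ] EuclideanSpace ℝ (Fin d))) p) :
    ContinuousAt (fun x : K => (b.emb x).comp ((A x).comp (b.ret x))) p := by
  have h1 := (b.contMDiffAt_emb p p.2).continuousAt.comp_of_eq
    (continuous_subtype_val.continuousAt (x := p)) rfl
  have h2 := (b.contMDiffAt_ret p p.2).continuousAt.comp_of_eq
    (continuous_subtype_val.continuousAt (x := p)) rfl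
  refine (h1.clm_comp (hA.clm_comp h2)).congr ?_
  filter_upwards [eventually_mem_baseSet (d := d) p] with x hx
  ext w
  simp only [ContinuousLinearMap.comp_apply, Function.comp_apply]
  rw [Trivialization.symmL_continuousLinearMapAt _ hx,
    Trivialization.symmL_continuousLinearMapAt _ hx]

/-- The derivative of a smooth map, in the embedding. -/
theorem contMDiffAt_conj_mfderiv {f : M → M} (hf : ContMDiff (𝓡 d) (𝓡 d) ∞ f) {p : M} (hp : p ∈ K)
    (hfp : f p ∈ K) : ContMDiffAt (𝓡 d) 𝓘(ℝ, E →L[ℝ] E) ∞ (fun x =>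
      (b.emb (f x)).comp ((mfderiv (𝓡 d) (𝓡 d) f x).comp (b.ret x))) p := by
  have h1 := (b.contMDiffAt_emb (f p) hfp).comp p (hf p)
  have h2 := contMDiffAt_mfderiv_coord (hf p)
  have h3 := b.contMDiffAt_ret p hp
  refine (h1.clm_comp (h2.clm_comp h3)).congr_of_eventuallyEq ?_
  filter_upwards [baseSet_tangentTriv_mem_nhds (d := d) p,
    hf.continuous.continuousAt.preimage_mem_nhds
      (baseSet_tangentTriv_mem_nhds (d := d) (f p))] with x hx hfx
  ext w
  simp only [ContinuousLinearMap.comp_apply, Function.comp_apply]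
  rw [Trivialization.symmL_continuousLinearMapAt _ hfx,
    Trivialization.symmL_continuousLinearMapAt _ hx]

variable [RiemannianBundle (fun x : M => TangentSpace (𝓡 d) x)]
    [IsContMDiffRiemannianBundle (𝓡 d) ∞ (EuclideanSpace ℝ (Fin d))
      (fun x : M => TangentSpace (𝓡 d) x)]

theorem exists_uniform_bound (hK : IsCompact K) {Q : M → ℝ → Prop}
    (hmono : ∀ x C C', C ≤ C' → Q x C → Q x C')
    (hloc : ∀ p ∈ K, ∃ C, ∀ᶠ x in 𝓝 p, Q x C) : ∃ C, 0 ≤ C ∧ ∀ x ∈ K, Q x C := by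
  choose! C hC using hloc
  obtain ⟨t, htK, ht⟩ := hK.elim_nhds_subcover (fun p => {x | Q x (C p)}) hC
  refine ⟨∑ p ∈ t, |C p|, Finset.sum_nonneg fun _ _ => abs_nonneg _, fun x hx => ?_⟩
  obtain ⟨p, hp, hxp⟩ := Set.mem_iUnion₂.1 (ht hx)
  exact hmono x _ _ ((le_abs_self _).trans
    (Finset.single_le_sum (f := fun p => |C p|) (fun _ _ => abs_nonneg _) hp)) hxp

theorem exists_norm_emb_le (hK : IsCompact K) :
    ∃ C, 0 ≤ C ∧ ∀ x ∈ K, ∀ v, ‖b.emb x v‖ ≤ C * ‖v‖ := by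
  refine exists_uniform_bound hK (Q := fun x C => ∀ v, ‖b.emb x v‖ ≤ C * ‖v‖)
    (fun x C C' h hQ v => (hQ v).trans (mul_le_mul_of_nonneg_right h (norm_nonneg _)))
    fun p hp => ?_
  obtain ⟨C, h0, hC⟩ := eventually_norm_tangentCoord_le (d := d) p
  have hb := (b.contMDiffAt_emb p hp).continuousAt.norm.eventually_lt continuousAt_const
    (lt_add_one _)
  refine ⟨(‖(b.emb p).comp ((tangentTriv d p).symmL ℝ p)‖ + 1) * C, ?_⟩
  filter_upwards [hC, hb, baseSet_tangentTriv_mem_nhds (d := d) p] with x h1 h2 hx v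
  rw [b.emb_eq_coord hx, mul_assoc]
  exact (ContinuousLinearMap.le_opNorm _ _).trans
    (mul_le_mul h2.le (h1 v) (norm_nonneg _) (by positivity))

theorem exists_norm_ret_le (hK : IsCompact K) :
    ∃ C, 0 ≤ C ∧ ∀ x ∈ K, ∀ w, ‖b.ret x w‖ ≤ C * ‖w‖ := by
  refine exists_uniform_bound hK (Q := fun x C => ∀ w, ‖b.ret x w‖ ≤ C * ‖w‖)
    (fun x C C' h hQ v => (hQ v).trans (mul_le_mul_of_nonneg_right h (norm_nonneg _)))
    fun p hp => ?_
  obtain ⟨C, h0, hC⟩ := eventually_norm_tangentCoord_symm_le (d := d) p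
  have hb := (b.contMDiffAt_ret p hp).continuousAt.norm.eventually_lt continuousAt_const
    (lt_add_one _)
  refine ⟨C * (‖((tangentTriv d p).continuousLinearMapAt ℝ p).comp (b.ret p)‖ + 1), ?_⟩
  filter_upwards [hC, hb, baseSet_tangentTriv_mem_nhds (d := d) p] with x h1 h2 hx w
  rw [b.ret_eq_coord hx]
  refine (h1 _).trans ?_
  rw [mul_assoc]
  exact mul_le_mul_of_nonneg_left ((ContinuousLinearMap.le_opNorm _ _).trans
    (mul_le_mul_of_nonneg_right h2.le (norm_nonneg _))) h0

variable [IsRiemannianManifold (𝓡 d) M] {α : ℝ≥0}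

/-- The chart expressions of `emb` and `ret` are smooth, hence locally Lipschitz, so applying them
preserves every exponent `α ≤ 1`. The chartwise condition becomes one on a single map into `E`. -/
theorem isHolderVectorField_iff (hα : 0 < α) (hα1 : α ≤ 1) {X : VectorField d K} :
    IsHolderVectorField d α X ↔ ∀ p : K, HolderNear α (fun x : K => b.emb x (X x)) p := by
  refine forall_congr' fun p => ⟨fun h => ?_, fun h => ?_⟩
  · refine (((holderNear_one_subtype (b.contMDiffAt_emb p p.2)).of_le hα1).clm_apply h hα).congr ?_
    filter_upwards [eventually_mem_baseSet (d := d) p] with x hx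
    exact (b.emb_eq_coord hx _).symm
  · refine (((holderNear_one_subtype (b.contMDiffAt_ret p p.2)).of_le hα1).clm_apply h hα).congr
      (Eventually.of_forall fun x => ?_)
    simp only [ContinuousLinearMap.comp_apply, vecCoord]
    rw [b.ret_emb x x.2]

theorem isHolderCovectorField_iff (hα : 0 < α) (hα1 : α ≤ 1) {om : CovectorField d K} :
    IsHolderCovectorField d α om ↔ ∀ p : K, HolderNear α (fun x : K => (om x).comp (b.ret x)) p := by
  refine forall_congr' fun p => ⟨fun h => ?_, fun h => ?_⟩
  · refine (h.clm_comp ((holderNear_one_subtype (b.contMDiffAt_ret p p.2)).of_le hα1) hα).congr ?_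
    filter_upwards [eventually_mem_baseSet (d := d) p] with x hx
    ext w
    simp only [ContinuousLinearMap.comp_apply, covCoord]
    rw [Trivialization.symmL_continuousLinearMapAt _ hx]
  · refine (h.clm_comp ((holderNear_one_subtype (b.contMDiffAt_emb p p.2)).of_le hα1) hα).congr
      (Eventually.of_forall fun x => ?_)
    ext w
    simp only [ContinuousLinearMap.comp_apply, covCoord]
    rw [b.ret_emb x x.2]

end TangentEmbedding

section Differential

variable {d : ℕ} {M : Type*} [EMetricSpace M]
  [ChartedSpace (EuclideanSpace ℝ (Fin d)) M] [IsManifold (𝓡 d) ∞ M]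
  [RiemannianBundle (fun x : M => TangentSpace (𝓡 d) x)]
  [IsContMDiffRiemannianBundle (𝓡 d) ∞ (EuclideanSpace ℝ (Fin d))
      (fun x : M => TangentSpace (𝓡 d) x)] [IsRiemannianManifold (𝓡 d) M]

theorem isHolderCovectorField_differential (K : Set M) {φ : M → ℝ}
    (hφ : ContMDiff (𝓡 d) 𝓘(ℝ, ℝ) ∞ φ) : IsHolderCovectorField d 1 (differential d K φ) := by
  intro p
  refine (holderNear_one_subtype (contMDiffAt_mfderiv_coord (hφ (p : M)))).congr
    (Eventually.of_forall fun x => ?_)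
  simp only [covCoord, differential, TangentBundle.continuousLinearMapAt_model_space]
  rfl

end Differential

end AdjointShadowing
end

/-! ### The derivative of `f` over a hyperbolic set as a cocycle on a fixed space. -/

noncomputable section
namespace AdjointShadowing

section Dynamics

variable {d : ℕ} {M : Type*} [EMetricSpace M] [ChartedSpace (EuclideanSpace ℝ (Fin d)) M]
  {K : Set M} {f : M ≃ₘ⟮𝓡 d, 𝓡 d⟯ M}

theorem iter_add (m n : ℤ) : iter f (m + n) = iter f m ∘ iter f n := by
  ext x
  simp [iter, zpow_add]

theorem iter_zero : iter f 0 = id := by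
  ext x
  simp [iter]

theorem iter_one : iter f 1 = f := by
  ext x
  simp [iter]

theorem iter_neg_one : iter f (-1) = f.symm := by
  ext x
  simp only [iter, zpow_neg, zpow_one]
  rfl

theorem contMDiff_iter (n : ℤ) : ContMDiff (𝓡 d) (𝓡 d) ∞ (iter f n) := by
  induction n using Int.induction_on with
  | zero => rw [iter_zero]; exact contMDiff_id
  | succ n ih => rw [iter_add, iter_one]; exact ih.comp f.contMDiff
  | pred n ih => rw [sub_eq_add_neg, iter_add, iter_neg_one]; exact ih.comp f.symm.contMDiff

/-- `f` as a permutation of the invariant set `K`. -/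
def stepPerm (hK : f '' K = K) : Equiv.Perm K :=
  Equiv.Perm.subtypePerm (f.toEquiv : Equiv.Perm M) fun x =>
    ⟨fun hx => by
      have h := iter_mem hK (-1) hx
      rw [iter_neg_one] at h
      have h2 : f.symm (f.toEquiv x) = x := f.toEquiv.symm_apply_apply x
      rwa [h2] at h,
    fun hx => hK.subset (Set.mem_image_of_mem f hx)⟩

theorem stepPerm_zpow (hK : f '' K = K) (n : ℤ) (x : K) : (stepPerm hK ^ n) x = iterOn hK n x := by
  rw [stepPerm, Equiv.Perm.subtypePerm_zpow]
  rfl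

theorem Splitting.Ps_of_mem (V : Splitting d K) (x : K) {v} (hv : v ∈ V.Vs x) : V.Ps x v = v :=
  Submodule.projection_apply_of_mem_left (V.isCompl x) hv

theorem Splitting.Ps_of_mem_Vu (V : Splitting d K) (x : K) {v} (hv : v ∈ V.Vu x) : V.Ps x v = 0 :=
  (Submodule.projection_apply_eq_zero_iff (V.isCompl x)).2 hv

theorem Splitting.Ps_mem (V : Splitting d K) (x : K) (v) : V.Ps x v ∈ V.Vs x :=
  Submodule.projection_apply_mem (V.isCompl x) v

theorem Splitting.Pu_mem (V : Splitting d K) (x : K) (v) : V.Pu x v ∈ V.Vu x :=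
  Submodule.projection_apply_mem (V.isCompl x).symm v

theorem Splitting.Ps_add_Pu (V : Splitting d K) (x : K) (v) : V.Ps x v + V.Pu x v = v :=
  Submodule.projection_add_projection_eq_self (V.isCompl x) v

variable [IsManifold (𝓡 d) ∞ M] [RiemannianBundle (fun x : M => TangentSpace (𝓡 d) x)]
  {V : Splitting d K}

/-- By invariance of both subbundles, `f_*` carries the decomposition of `v` to the decomposition of
`f_* v`. -/
theorem IsHyperbolicSet.Ps_mfderiv (hK : IsHyperbolicSet f K V) (x : K)
    (v : TangentSpace (𝓡 d) (x : M)) :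
    V.Ps (stepOn hK.image_eq x) (mfderiv (𝓡 d) (𝓡 d) f (x : M) v) =
      mfderiv (𝓡 d) (𝓡 d) f (x : M) (V.Ps x v) := by
  have h1 : mfderiv (𝓡 d) (𝓡 d) f (x : M) (V.Ps x v) ∈ V.Vs (stepOn hK.image_eq x) := by
    rw [← hK.map_Vs]
    exact Submodule.mem_map_of_mem (V.Ps_mem x v)
  have h2 : mfderiv (𝓡 d) (𝓡 d) f (x : M) (V.Pu x v) ∈ V.Vu (stepOn hK.image_eq x) := by
    rw [← hK.map_Vu]
    exact Submodule.mem_map_of_mem (V.Pu_mem x v)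
  conv_lhs => rw [← V.Ps_add_Pu x v, map_add]
  refine (map_add (V.Ps (stepOn hK.image_eq x)) _ _).trans ?_
  rw [V.Ps_of_mem _ h1, V.Ps_of_mem_Vu _ h2]
  exact add_zero _

end Dynamics

namespace TangentEmbedding

variable {d : ℕ} {M : Type*} [EMetricSpace M]
  [ChartedSpace (EuclideanSpace ℝ (Fin d)) M] [IsManifold (𝓡 d) ∞ M]
  {K : Set M} {E : Type*} [NormedAddCommGroup E] [NormedSpace ℝ E] (b : TangentEmbedding d K E)
  {f : M ≃ₘ⟮𝓡 d, 𝓡 d⟯ M} {V : Splitting d K}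

variable (f) in
/-- The pushforward by `fⁿ` in the embedding. -/
def embPush (n : ℤ) (x : K) : E →L[ℝ] E :=
  (b.emb (iter f n x)).comp ((push f n (x : M)).comp (b.ret x))

/-- An endomorphism of the tangent spaces in the embedding. -/
def conj (A : (x : K) → TangentSpace (𝓡 d) (x : M) →L[ℝ] TangentSpace (𝓡 d) (x : M)) (x : K) :
    E →L[ℝ] E :=
  (b.emb x).comp ((A x).comp (b.ret x))

/-- The two derivatives take values in fibres over formally different points; `emb` moves both into
`E`, where they can be compared. -/
theorem emb_mfderiv_congr {g h : M → M} (hgh : g = h) (x : M) (v : TangentSpace (𝓡 d) x) :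
    b.emb (g x) (mfderiv (𝓡 d) (𝓡 d) g x v) = b.emb (h x) (mfderiv (𝓡 d) (𝓡 d) h x v) := by
  subst hgh; rfl

theorem emb_push_zero (x : M) (v : TangentSpace (𝓡 d) x) :
    b.emb (iter f 0 x) (push f 0 x v) = b.emb x v := by
  rw [push, b.emb_mfderiv_congr iter_zero, mfderiv_id]
  rfl

theorem emb_push_one (x : M) (v : TangentSpace (𝓡 d) x) :
    b.emb (iter f 1 x) (push f 1 x v) = b.emb (f x) (mfderiv (𝓡 d) (𝓡 d) f x v) := by
  rw [push, b.emb_mfderiv_congr iter_one]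

theorem emb_push_add (m n : ℤ) (x : M) (v : TangentSpace (𝓡 d) x) :
    b.emb (iter f (m + n) x) (push f (m + n) x v) =
      b.emb (iter f m (iter f n x)) (push f m (iter f n x) (push f n x v)) := by
  rw [push, b.emb_mfderiv_congr (iter_add m n), mfderiv_comp x
    ((contMDiff_iter m).mdifferentiable (by simp) _) ((contMDiff_iter n).mdifferentiable (by simp) _)]
  rfl

theorem embPush_zero_apply (x : K) (w : E) : b.embPush f 0 x w = b.emb x (b.ret x w) :=
  b.emb_push_zero _ _

theorem embPush_one_apply (x : K) (w : E) :
    b.embPush f 1 x w = b.emb (f x) (mfderiv (𝓡 d) (𝓡 d) f (x : M) (b.ret x w)) :=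
  b.emb_push_one _ _

theorem embPush_add (hK : f '' K = K) (m n : ℤ) (x : K) :
    b.embPush f (m + n) x = b.embPush f m ((stepPerm hK ^ n) x) * b.embPush f n x := by
  ext w
  rw [stepPerm_zpow, mul_apply_eq_comp]
  simp only [embPush, ContinuousLinearMap.comp_apply]
  rw [b.emb_push_add]
  exact congrArg (fun v => b.emb (iter f m (iter f n x)) (push f m (iter f n x) v))
    (b.ret_emb _ (iter_mem hK n x.2) _).symm

theorem embPush_mul_conj (n : ℤ)
    (A : (x : K) → TangentSpace (𝓡 d) (x : M) →L[ℝ] TangentSpace (𝓡 d) (x : M)) (x : K) (w : E) :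
    (b.embPush f n x * b.conj A x) w = b.emb (iter f n x) (push f n x (A x (b.ret x w))) := by
  rw [mul_apply_eq_comp]
  simp only [embPush, conj, ContinuousLinearMap.comp_apply]
  rw [b.ret_emb x x.2]

theorem embPush_zero_mul_conj
    (A : (x : K) → TangentSpace (𝓡 d) (x : M) →L[ℝ] TangentSpace (𝓡 d) (x : M)) (x : K) :
    b.embPush f 0 x * b.conj A x = b.conj A x := by
  ext w
  rw [b.embPush_mul_conj, b.emb_push_zero]
  rfl

theorem conj_mul_embPush_zero
    (A : (x : K) → TangentSpace (𝓡 d) (x : M) →L[ℝ] TangentSpace (𝓡 d) (x : M)) (x : K) :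
    b.conj A x * b.embPush f 0 x = b.conj A x := by
  ext w
  rw [mul_apply_eq_comp, b.embPush_zero_apply]
  simp only [conj, ContinuousLinearMap.comp_apply]
  rw [b.ret_emb x x.2]

theorem conj_Ps_add_conj_Pu (x : K) :
    b.conj V.Ps x + b.conj V.Pu x = b.embPush f 0 x := by
  ext w
  rw [add_apply, b.embPush_zero_apply]
  simp only [conj, ContinuousLinearMap.comp_apply]
  rw [← map_add, V.Ps_add_Pu]

/-- Commutation with the first iterate implies commutation with all iterates. -/
theorem conj_comm_embPush (hK : f '' K = K) {P : K → E →L[ℝ] E}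
    (hl : ∀ x, b.embPush f 0 x * P x = P x) (hr : ∀ x, P x * b.embPush f 0 x = P x)
    (h1 : ∀ x, P (stepPerm hK x) * b.embPush f 1 x = b.embPush f 1 x * P x) (n : ℤ) (x : K) :
    P ((stepPerm hK ^ n) x) * b.embPush f n x = b.embPush f n x * P x := by
  -- The relation for time `1` is multiplied by the time `-1` propagator on both sides; the products
  -- are `Φ 0`, which `P` absorbs.
  have hneg : ∀ x, P ((stepPerm hK ^ (-1 : ℤ)) x) * b.embPush f (-1) x = b.embPush f (-1) x * P x := by
    intro x
    obtain ⟨y, rfl⟩ := (stepPerm hK).surjective x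
    have e1 : (stepPerm hK ^ (-1 : ℤ)) (stepPerm hK y) = y := by simp
    have e2 := b.embPush_add hK (-1) 1 y
    have e3 := b.embPush_add hK 1 (-1) (stepPerm hK y)
    rw [zpow_one, neg_add_cancel] at e2
    rw [e1, add_neg_cancel] at e3
    rw [e1]
    calc P y * b.embPush f (-1) (stepPerm hK y)
        = b.embPush f (-1) (stepPerm hK y) * (b.embPush f 1 y * P y) *
            b.embPush f (-1) (stepPerm hK y) := by rw [← mul_assoc, ← e2, hl]
      _ = b.embPush f (-1) (stepPerm hK y) * P (stepPerm hK y) := by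
          rw [← h1, mul_assoc, mul_assoc, ← e3, hr]
  induction n using Int.induction_on generalizing x with
  | zero => rw [zpow_zero, Equiv.Perm.one_apply, hl, hr]
  | succ n ih =>
    rw [b.embPush_add hK, zpow_add_one, Equiv.Perm.mul_apply, zpow_one, ← mul_assoc, ih, mul_assoc,
      h1, mul_assoc]
  | pred n ih =>
    rw [sub_eq_add_neg, b.embPush_add hK, zpow_add, Equiv.Perm.mul_apply, ← mul_assoc, ih,
      mul_assoc, hneg, mul_assoc]

variable [RiemannianBundle (fun x : M => TangentSpace (𝓡 d) x)]

theorem conj_Ps_comm_one (hK : IsHyperbolicSet f K V) (x : K) :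
    b.conj V.Ps (stepPerm hK.image_eq x) * b.embPush f 1 x = b.embPush f 1 x * b.conj V.Ps x := by
  ext w
  rw [b.embPush_mul_conj, b.emb_push_one, mul_apply_eq_comp, b.embPush_one_apply]
  have h := hK.Ps_mfderiv x (b.ret x w)
  rw [← h]
  refine congrArg (fun v => b.emb (f x) (V.Ps (stepOn hK.image_eq x) v)) ?_
  exact b.ret_emb (f x) (stepOn hK.image_eq x).2 _

theorem conj_Ps_comm (hK : IsHyperbolicSet f K V) (n : ℤ) (x : K) :
    b.conj V.Ps ((stepPerm hK.image_eq ^ n) x) * b.embPush f n x =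
      b.embPush f n x * b.conj V.Ps x :=
  b.conj_comm_embPush hK.image_eq (fun x => b.embPush_zero_mul_conj V.Ps x)
    (fun x => b.conj_mul_embPush_zero V.Ps x) (b.conj_Ps_comm_one hK) n x

theorem conj_Pu_comm (hK : IsHyperbolicSet f K V) (n : ℤ) (x : K) :
    b.conj V.Pu ((stepPerm hK.image_eq ^ n) x) * b.embPush f n x =
      b.embPush f n x * b.conj V.Pu x := by
  have h1 : ∀ y, b.conj V.Pu y = b.embPush f 0 y - b.conj V.Ps y := fun y => by
    rw [← b.conj_Ps_add_conj_Pu (V := V), add_sub_cancel_left]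
  have h2 := b.embPush_add hK.image_eq 0 n x
  have h3 := b.embPush_add hK.image_eq n 0 x
  rw [zero_add] at h2
  rw [add_zero, zpow_zero, Equiv.Perm.one_apply] at h3
  rw [h1, h1, sub_mul, mul_sub, ← h2, ← h3, b.conj_Ps_comm hK]

variable [IsContMDiffRiemannianBundle (𝓡 d) ∞ (EuclideanSpace ℝ (Fin d))
      (fun x : M => TangentSpace (𝓡 d) x)]

/-- Continuity of the splitting and compactness bound the projections uniformly, which turns decay
on the subspaces into operator norm decay. Comparison of the norms on `E` and on the tangent spaces
affects the constant, not `lam`. -/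
theorem exists_rate (hK : IsHyperbolicSet f K V) : ∃ C lam : ℝ, 0 ≤ C ∧ 0 ≤ lam ∧ lam < 1 ∧
    (∀ (n : ℕ) (x : K), ‖b.embPush f n x * b.conj V.Ps x‖ ≤ C * lam ^ n) ∧
    (∀ (n : ℕ) (x : K), ‖b.embPush f (-(n : ℤ)) x * b.conj V.Pu x‖ ≤ C * lam ^ n) := by
  have := isCompact_iff_compactSpace.1 hK.isCompact
  obtain ⟨C, lam, hC0, hl0, hl1, hrate⟩ := hK.exists_rate
  obtain ⟨Ce, he0, he⟩ := b.exists_norm_emb_le hK.isCompact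
  obtain ⟨Cr, hr0, hr⟩ := b.exists_norm_ret_le hK.isCompact
  obtain ⟨Bs, hBs⟩ : ∃ B, ∀ x, ‖b.conj V.Ps x‖ ≤ B := by
    have hcont : Continuous (b.conj V.Ps) :=
      continuous_iff_continuousAt.2 fun p => b.continuousAt_conj (hK.isContinuous p)
    obtain ⟨B, hB⟩ := isCompact_univ.exists_bound_of_continuousOn hcont.continuousOn
    exact ⟨B, fun x => hB x trivial⟩
  have hs : ∀ (x : K) (w : E), ‖V.Ps x (b.ret x w)‖ ≤ Cr * (|Bs| * ‖w‖) := by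
    intro x w
    have h1 : V.Ps x (b.ret x w) = b.ret x (b.conj V.Ps x w) := (b.ret_emb x x.2 _).symm
    rw [h1]
    refine (hr x x.2 _).trans (mul_le_mul_of_nonneg_left ?_ hr0)
    exact ContinuousLinearMap.le_of_opNorm_le _ ((hBs x).trans (le_abs_self _)) w
  have hu : ∀ (x : K) (w : E), ‖V.Pu x (b.ret x w)‖ ≤ Cr * ((|Bs| + 1) * ‖w‖) := by
    intro x w
    have h1 : V.Pu x (b.ret x w) = b.ret x w - V.Ps x (b.ret x w) := by
      rw [eq_sub_iff_add_eq', V.Ps_add_Pu]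
    rw [h1]
    refine (norm_sub_le _ _).trans ?_
    have := hr x x.2 w
    have := hs x w
    linarith
  refine ⟨Ce * (C * (Cr * (|Bs| + 1))), lam, by positivity, hl0.le, hl1, fun n x => ?_,
    fun n x => ?_⟩
  · refine ContinuousLinearMap.opNorm_le_bound _ (by positivity) fun w => ?_
    rw [b.embPush_mul_conj]
    calc _ ≤ Ce * ‖push f n (x : M) (V.Ps x (b.ret x w))‖ :=
          he _ (iter_mem hK.image_eq n x.2) _
      _ ≤ Ce * (C * lam ^ n * ‖V.Ps x (b.ret x w)‖) := by
          gcongr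
          exact (hrate x n).2 _ (V.Ps_mem x _)
      _ ≤ Ce * (C * lam ^ n * (Cr * ((|Bs| + 1) * ‖w‖))) := by
          gcongr
          exact (hs x w).trans (by gcongr; linarith)
      _ = Ce * (C * (Cr * (|Bs| + 1))) * lam ^ n * ‖w‖ := by ring
  · refine ContinuousLinearMap.opNorm_le_bound _ (by positivity) fun w => ?_
    rw [b.embPush_mul_conj]
    calc _ ≤ Ce * ‖push f (-(n : ℤ)) (x : M) (V.Pu x (b.ret x w))‖ :=
          he _ (iter_mem hK.image_eq _ x.2) _
      _ ≤ Ce * (C * lam ^ n * ‖V.Pu x (b.ret x w)‖) := by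
          gcongr
          exact (hrate x n).1 _ (V.Pu_mem x _)
      _ ≤ Ce * (C * lam ^ n * (Cr * ((|Bs| + 1) * ‖w‖))) := by
          gcongr
          exact hu x w
      _ = Ce * (C * (Cr * (|Bs| + 1))) * lam ^ n * ‖w‖ := by ring

/-- The derivative cocycle over a hyperbolic set, in an embedding of the tangent bundle. -/
def cocycle (hK : IsHyperbolicSet f K V) : HyperbolicCocycle K E where
  T := stepPerm hK.image_eq
  Φ := b.embPush f
  Ps := b.conj V.Ps
  Pu := b.conj V.Pu
  C := (b.exists_rate hK).choose
  lam := (b.exists_rate hK).choose_spec.choose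
  C_nonneg := (b.exists_rate hK).choose_spec.choose_spec.1
  lam_nonneg := (b.exists_rate hK).choose_spec.choose_spec.2.1
  lam_lt_one := (b.exists_rate hK).choose_spec.choose_spec.2.2.1
  Φ_add := b.embPush_add hK.image_eq
  Ps_add_Pu := b.conj_Ps_add_conj_Pu
  Φ_zero_Ps := b.embPush_zero_mul_conj V.Ps
  Φ_zero_Pu := b.embPush_zero_mul_conj V.Pu
  Ps_comm := b.conj_Ps_comm hK
  Pu_comm := b.conj_Pu_comm hK
  norm_Φ_Ps := (b.exists_rate hK).choose_spec.choose_spec.2.2.2.1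
  norm_Φ_Pu := (b.exists_rate hK).choose_spec.choose_spec.2.2.2.2

variable [IsRiemannianManifold (𝓡 d) M]

theorem exists_truncDist_le {g : M → M} (hg : ContMDiff (𝓡 d) (𝓡 d) ∞ g) {T : K → K}
    (hT : ∀ x, (T x : M) = g x) (hK : IsCompact K) :
    ∃ L, 0 ≤ L ∧ ∀ x y, truncDist (T x) (T y) ≤ L * truncDist x y := by
  have := isCompact_iff_compactSpace.1 hK
  have h := exists_forall_le_truncDist_rpow (Q := fun x y : K => truncDist (T x) (T y)) (α := 1)
    zero_le_one (fun x y => truncDist_le_one _ _) fun p => ?_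
  · simpa only [Real.rpow_one] using h
  · obtain ⟨C, W, hW, hC⟩ := exists_lipschitzOnWith_of_contMDiff (d := d) hg (p : M)
    obtain ⟨W', hW', h1⟩ := edist_le_one_nhds p
    refine ⟨C, Subtype.val ⁻¹' W ∩ W',
      inter_mem (continuous_subtype_val.continuousAt hW) hW', fun x hx y hy => ?_⟩
    rw [Real.rpow_one]
    have h2 : edist (T x) (T y) ≤ C * edist x y := by
      rw [Subtype.edist_eq, hT, hT]
      exact hC hx.1 hy.1
    rw [edist_eq_truncDist (h1 x hx.2 y hy.2), ← ENNReal.ofReal_coe_nnreal,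
      ← ENNReal.ofReal_mul C.coe_nonneg] at h2
    exact (ENNReal.ofReal_le_ofReal_iff (mul_nonneg C.coe_nonneg (truncDist_nonneg _ _))).1
      ((ofReal_truncDist_le _ _).trans h2)

theorem exists_isLipschitzBase (hK : IsHyperbolicSet f K V) :
    ∃ L, (b.cocycle hK).IsLipschitzBase truncDist L := by
  obtain ⟨L₁, h1, hL₁⟩ := exists_truncDist_le (d := d) f.contMDiff
    (T := (b.cocycle hK).T) (fun x => rfl) hK.isCompact
  obtain ⟨L₂, h2, hL₂⟩ := exists_truncDist_le (d := d) f.symm.contMDiff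
    (T := ((b.cocycle hK).T⁻¹ : Equiv.Perm K)) (fun x => rfl) hK.isCompact
  refine ⟨1 + L₁ + L₂, truncDist_nonneg, by linarith, fun x y => (hL₁ x y).trans ?_,
    fun x y => (hL₂ x y).trans ?_⟩
  · exact mul_le_mul_of_nonneg_right (by linarith) (truncDist_nonneg _ _)
  · exact mul_le_mul_of_nonneg_right (by linarith) (truncDist_nonneg _ _)

/-- The regularity of the cocycle needed for Hölder solutions is that of its one-step map alone; no
modulus of continuity of the splitting is used. -/
theorem holderNear_embPush_one (hK : f '' K = K) (p : K) : HolderNear 1 (b.embPush f 1) p := by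
  refine (holderNear_one_subtype (b.contMDiffAt_conj_mfderiv f.contMDiff p.2
    (stepOn hK p).2)).congr (Eventually.of_forall fun x => ?_)
  ext w
  exact (b.embPush_one_apply x w).symm

end TangentEmbedding

end AdjointShadowing
end

/-! ### The dual Green series, admissible exponents, and time averages. -/

noncomputable section
namespace AdjointShadowing

namespace HyperbolicCocycle

variable {K E : Type*} [NormedAddCommGroup E] [NormedSpace ℝ E] (c : HyperbolicCocycle K E)

theorem dual_Φ_zero_apply (x : K) (η : E →L[ℝ] ℝ) : c.dual.Φ 0 x η = η.comp (c.Φ 0 x) := by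
  simp only [dual, ContinuousLinearMap.precomp_apply, neg_zero, zpow_zero, Equiv.Perm.one_apply]

theorem dual_Φ_one_apply (x : K) (η : E →L[ℝ] ℝ) :
    c.dual.Φ 1 (c.T x) η = η.comp (c.Φ 1 x) := by
  simp [dual]

theorem dual_zpow (n : ℤ) : c.dual.T ^ n = c.T ^ (-n) := inv_zpow' c.T n

/-- Over the inverse base the dual past is the future of `T`, so the dual stable terms are the
pullbacks of the stable parts of `W` along the forward orbit: the first series of the expansion. -/
theorem dual_sTerm (W : K → E →L[ℝ] ℝ) (x : K) (n : ℕ) :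
    c.dual.sTerm W x n = ((W ((c.T ^ (n : ℤ)) x)).comp (c.Ps ((c.T ^ (n : ℤ)) x))).comp
      (c.Φ n x) := by
  rw [sTerm, dual_zpow, neg_neg]
  simp only [dual, ContinuousLinearMap.precomp_apply]
  rw [c.zpow_zpow, neg_add_cancel, zpow_zero, Equiv.Perm.one_apply]

theorem dual_uTerm (W : K → E →L[ℝ] ℝ) (x : K) (n : ℕ) :
    c.dual.uTerm W x n = ((W ((c.T ^ (-((n : ℤ) + 1))) x)).comp
      (c.Pu ((c.T ^ (-((n : ℤ) + 1))) x))).comp (c.Φ (-((n : ℤ) + 1)) x) := by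
  rw [uTerm, dual_zpow]
  simp only [dual, ContinuousLinearMap.precomp_apply]
  rw [c.zpow_zpow, neg_neg, add_neg_cancel, zpow_zero, Equiv.Perm.one_apply]

variable {c}

theorem IsLipschitzBase.dual {D : K → K → ℝ} {L : ℝ} (h : c.IsLipschitzBase D L) :
    c.dual.IsLipschitzBase D L :=
  ⟨h.nonneg, h.one_le, h.le_T_symm, fun x y => by
    have : c.dual.T⁻¹ = c.T := inv_inv c.T
    rw [this]
    exact h.le_T x y⟩

/-- The one-step dual map at `T x` is precomposition with `Φ 1 x`. Expressing the distance through
the image points costs the factor `L ^ α`. -/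
theorem IsLipschitzBase.norm_dual_Φ_one_sub_le {D : K → K → ℝ} {L a α : ℝ}
    (h : c.IsLipschitzBase D L) (hα : 0 ≤ α) (ha0 : 0 ≤ a)
    (ha : ∀ x y, ‖c.Φ 1 x - c.Φ 1 y‖ ≤ a * D x y ^ α) (x y : K) :
    ‖c.dual.Φ 1 x - c.dual.Φ 1 y‖ ≤ a * L ^ α * D x y ^ α := by
  have hL : 0 ≤ L := zero_le_one.trans h.one_le
  obtain ⟨x, rfl⟩ := c.T.surjective x
  obtain ⟨y, rfl⟩ := c.T.surjective y
  have h1 : D x y ^ α ≤ L ^ α * D (c.T x) (c.T y) ^ α := by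
    rw [← Real.mul_rpow hL (h.nonneg _ _)]
    refine Real.rpow_le_rpow (h.nonneg _ _) ?_ hα
    simpa using h.le_T_symm (c.T x) (c.T y)
  have h0 : 0 ≤ D (c.T x) (c.T y) ^ α := Real.rpow_nonneg (h.nonneg _ _) α
  refine ContinuousLinearMap.opNorm_le_bound _ (by positivity) fun η => ?_
  rw [sub_apply, c.dual_Φ_one_apply, c.dual_Φ_one_apply, ← ContinuousLinearMap.comp_sub, mul_comm]
  refine (ContinuousLinearMap.opNorm_comp_le _ _).trans
    (mul_le_mul_of_nonneg_left ((ha x y).trans ?_) (norm_nonneg _))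
  rw [mul_assoc]
  exact mul_le_mul_of_nonneg_left h1 ha0

variable (c)

/-- At exponent zero the product is `lam < 1`, and it depends continuously on the exponent. -/
theorem exists_exponent {L : ℝ} (hL : 1 ≤ L) : ∃ α₀ : ℝ≥0, 0 < α₀ ∧ α₀ ≤ 1 ∧
    ∀ α : ℝ≥0, α ≤ α₀ → c.lam * L ^ (α : ℝ) < 1 := by
  have hcont : ContinuousAt (fun a : ℝ≥0 => c.lam * L ^ (a : ℝ)) 0 :=
    continuousAt_const.mul ((Real.continuous_const_rpow (by linarith)).continuousAt.comp
      NNReal.continuous_coe.continuousAt)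
  have hev : ∀ᶠ a : ℝ≥0 in 𝓝 0, c.lam * L ^ (a : ℝ) < 1 :=
    hcont.eventually_lt continuousAt_const (by simpa using c.lam_lt_one)
  obtain ⟨ε, hε, hball⟩ := Metric.eventually_nhds_iff.1 hev
  refine ⟨min 1 (ε / 2).toNNReal, lt_min one_pos (by simpa using hε), min_le_left _ _,
    fun α hα => hball ?_⟩
  rw [NNReal.dist_eq, NNReal.coe_zero, sub_zero, abs_of_nonneg α.coe_nonneg]
  have h1 : (α : ℝ) ≤ ((ε / 2).toNNReal : ℝ) := by exact_mod_cast hα.trans (min_le_right _ _)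
  rw [Real.coe_toNNReal _ (by linarith)] at h1
  linarith

variable [CompleteSpace E] {X : K → E}

/-- `solve X` is the unique bounded invariant solution. -/
theorem bounded_field_iff {B : ℝ} (hB : ∀ x, ‖X x‖ ≤ B) (hX : ∀ x, c.Φ 0 x (X x) = X x)
    {v : K → E} : ((∃ A, ∀ x, ‖v x‖ ≤ A) ∧ ∀ x, v (c.T x) = c.Φ 1 x (v x) + X (c.T x)) ↔
      v = c.solve X := by
  constructor
  · rintro ⟨⟨A, hA⟩, hv⟩
    funext x
    have hx : ∀ n : ℤ, (c.T ^ (n + 1)) x = c.T ((c.T ^ n) x) := fun n => by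
      rw [add_comm, zpow_add, zpow_one, Equiv.Perm.mul_apply]
    have := (c.bounded_solution_iff (x := fun n => (c.T ^ n) x) (v := fun n => v ((c.T ^ n) x))
      hB hX hx).1 ⟨⟨A, fun n => hA _⟩, fun n => by rw [hx, hv]⟩ 0
    simpa using this
  · rintro rfl
    exact ⟨c.exists_norm_solve_le hB, fun x => by rw [c.solve_step hB, hX]⟩

theorem holderNear_solve [PseudoEMetricSpace K] [CompactSpace K] {L a : ℝ} {α : ℝ≥0}
    (hD : c.IsLipschitzBase truncDist L) (hα : 0 < α) (hLα : c.lam * L ^ (α : ℝ) < 1)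
    (ha : ∀ x y, ‖c.Φ 1 x - c.Φ 1 y‖ ≤ a * truncDist x y ^ (α : ℝ))
    (hX : ∀ p, HolderNear α X p) (hX0 : ∀ x, c.Φ 0 x (X x) = X x) (p : K) :
    HolderNear α (c.solve X) p := by
  obtain ⟨B, hB⟩ := exists_norm_le_of_holderNear hα hX
  obtain ⟨C, -, hC⟩ := exists_norm_sub_le_of_holderNear hα hX
  obtain ⟨C', hC'⟩ := exists_holder_solve hD α.coe_nonneg hLα ha hC hB hX0
  exact holderNear_of_forall_norm_sub_le hC' p

end HyperbolicCocycle

section Averages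

/-- The new average is `1 + 1/N` times the old one of length `N + 1`, minus `a 0 / N`. -/
theorem tendsto_average_Icc {a : ℕ → ℝ} {l : ℝ}
    (h : Tendsto (fun N : ℕ => (1 / (N : ℝ)) * ∑ k ∈ Finset.range N, a k) atTop (𝓝 l)) :
    Tendsto (fun N : ℕ => (1 / (N : ℝ)) * ∑ n ∈ Finset.Icc 1 N, a n) atTop (𝓝 l) := by
  have h1 := (tendsto_add_atTop_iff_nat 1).2 h
  have h2 : Tendsto (fun N : ℕ => 1 + 1 / (N : ℝ)) atTop (𝓝 (1 + 0)) :=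
    tendsto_const_nhds.add tendsto_one_div_atTop_nhds_zero_nat
  have h3 : Tendsto (fun N : ℕ => a 0 * (1 / (N : ℝ))) atTop (𝓝 (a 0 * 0)) :=
    tendsto_one_div_atTop_nhds_zero_nat.const_mul _
  have h4 := (h2.mul h1).sub h3
  rw [add_zero, one_mul, mul_zero, sub_zero] at h4
  refine h4.congr' ?_
  filter_upwards [eventually_gt_atTop 0] with N hN
  have hN0 : (N : ℝ) ≠ 0 := by exact_mod_cast hN.ne'
  have hN1 : (N : ℝ) + 1 ≠ 0 := by positivity
  have h5 : ∑ k ∈ Finset.range (N + 1), a k = ∑ n ∈ Finset.Icc 1 N, a n + a 0 := by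
    rw [Finset.sum_range_succ', Finset.range_eq_Ico, Finset.sum_Ico_add' a 0 N 1]
    rfl
  rw [h5]
  push_cast
  field_simp
  ring

variable {d : ℕ} {M : Type*} [EMetricSpace M] [ChartedSpace (EuclideanSpace ℝ (Fin d)) M]

theorem IsLebesgueNull.mono {A B : Set M} (hB : IsLebesgueNull d B) (h : A ⊆ B) :
    IsLebesgueNull d A := fun p =>
  measure_mono_null (Set.image_mono (Set.inter_subset_inter_left _ h)) (hB p)

theorem IsLebesgueNull.iUnion {A : ℕ → Set M} (hA : ∀ m, IsLebesgueNull d (A m)) :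
    IsLebesgueNull d (⋃ m, A m) := fun p => by
  rw [Set.iUnion_inter, Set.image_iUnion]
  exact measure_iUnion_null fun m => hA m p

theorem integrable_of_continuous {A : Type*} [TopologicalSpace A] [CompactSpace A]
    [MeasurableSpace A] [BorelSpace A] {μ : Measure A} [IsFiniteMeasure μ] {g : A → ℝ}
    (hg : Continuous g) : Integrable g μ := by
  obtain ⟨B, hB⟩ := isCompact_univ.exists_bound_of_continuousOn hg.continuousOn
  exact Integrable.of_bound hg.measurable.aestronglyMeasurable B
    (Eventually.of_forall fun x => hB x trivial)

/-- A physical measure describes the time averages of all continuous observables. -/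
theorem IsSRBMeasure.tendsto_of_continuous [IsManifold (𝓡 d) ∞ M] [SigmaCompactSpace M]
    [MeasurableSpace M] [BorelSpace M] {f : M ≃ₘ⟮𝓡 d, 𝓡 d⟯ M} {K U : Set M} {hK : f '' K = K}
    {ρ : Measure K} (hρ : IsSRBMeasure f K U hK ρ) (hKc : IsCompact K) {g : M → ℝ}
    (hg : Continuous g) :
    IsLebesgueNull d {x ∈ U | ¬ Tendsto
      (fun N : ℕ => (1 / (N : ℝ)) * ∑ k ∈ Finset.range N, g (iter f k x)) atTop
      (𝓝 (∫ y : K, g y ∂ρ))} := by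
  have := hρ.isProbabilityMeasure
  have := isCompact_iff_compactSpace.1 hKc
  -- The approximation is uniform on all of `M`, so it changes every time average and the
  -- `ρ`-average by at most `1 / (m + 1)`, wherever the orbit goes. Countably many approximants
  -- leave a null exceptional set.
  have happrox : ∀ m : ℕ, ∃ φ : M → ℝ, ContMDiff (𝓡 d) 𝓘(ℝ, ℝ) ∞ φ ∧
      ∀ x, |φ x - g x| < 1 / ((m : ℝ) + 1) := by
    intro m
    obtain ⟨φ, hφ, -⟩ := hg.exists_contMDiff_approx (𝓡 d) ⊤ (ε := fun _ => 1 / ((m : ℝ) + 1))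
      continuous_const (fun _ => by positivity)
    exact ⟨φ, φ.contMDiff, hφ⟩
  choose φ hφ hφg using happrox
  refine (IsLebesgueNull.iUnion fun m => hρ.physical (φ m) (hφ m)).mono ?_
  rintro x ⟨hxU, hx⟩
  by_contra hcon
  simp only [Set.mem_iUnion, not_exists] at hcon
  refine hx (Metric.tendsto_atTop.2 fun ε hε => ?_)
  obtain ⟨m, hm⟩ := exists_nat_one_div_lt (show 0 < ε / 3 by linarith)
  have hconv : Tendsto (fun N : ℕ => (1 / (N : ℝ)) * ∑ k ∈ Finset.range N, φ m (iter f k x)) atTop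
      (𝓝 (∫ y : K, φ m y ∂ρ)) := by
    by_contra h
    exact hcon m ⟨hxU, h⟩
  obtain ⟨N₀, hN₀⟩ := Metric.tendsto_atTop.1 hconv (ε / 3) (by linarith)
  refine ⟨N₀, fun N hN => ?_⟩
  have h1 := hN₀ N hN
  have h2 : |(1 / (N : ℝ)) * ∑ k ∈ Finset.range N, g (iter f k x) -
      (1 / (N : ℝ)) * ∑ k ∈ Finset.range N, φ m (iter f k x)| ≤ 1 / ((m : ℝ) + 1) := by
    rw [← mul_sub, ← Finset.sum_sub_distrib, abs_mul, abs_of_nonneg (by positivity)]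
    rcases Nat.eq_zero_or_pos N with rfl | hN0
    · simp; positivity
    · have hN0' : (0 : ℝ) < N := by exact_mod_cast hN0
      rw [one_div_mul_eq_div, div_le_iff₀ hN0']
      refine (Finset.abs_sum_le_sum_abs _ _).trans ?_
      calc ∑ k ∈ Finset.range N, |g (iter f k x) - φ m (iter f k x)|
          ≤ ∑ k ∈ Finset.range N, 1 / ((m : ℝ) + 1) := Finset.sum_le_sum fun k _ => by
            rw [abs_sub_comm]; exact (hφg m _).le
        _ = 1 / ((m : ℝ) + 1) * N := by simp [mul_comm]
  have h3 : |∫ y : K, φ m y ∂ρ - ∫ y : K, g y ∂ρ| ≤ 1 / ((m : ℝ) + 1) := by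
    have i1 : Integrable (fun y : K => φ m y) ρ :=
      integrable_of_continuous ((hφ m).continuous.comp continuous_subtype_val)
    have i2 : Integrable (fun y : K => g y) ρ :=
      integrable_of_continuous (hg.comp continuous_subtype_val)
    rw [← integral_sub i1 i2]
    have := norm_integral_le_of_norm_le_const (μ := ρ) (f := fun y : K => φ m y - g y)
      (C := 1 / ((m : ℝ) + 1)) (Eventually.of_forall fun y => (hφg m y).le)
    simpa using this
  rw [Real.dist_eq] at h1 ⊢
  have h4 := abs_le.1 h2
  have h5 := abs_le.1 h3
  have h6 := abs_lt.1 h1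
  rw [abs_lt]
  constructor <;> linarith [h4.1, h4.2, h5.1, h5.2, h6.1, h6.2]

end Averages

end AdjointShadowing
end

/-! ### Transfer of the step equations between tangent fields and the embedding. -/

noncomputable section
namespace AdjointShadowing

namespace TangentEmbedding

variable {d : ℕ} {M : Type*} [EMetricSpace M]
  [ChartedSpace (EuclideanSpace ℝ (Fin d)) M] [IsManifold (𝓡 d) ∞ M]
  {K : Set M} {E : Type*} [NormedAddCommGroup E] [NormedSpace ℝ E] (b : TangentEmbedding d K E)
  {f : M ≃ₘ⟮𝓡 d, 𝓡 d⟯ M} {V : Splitting d K}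

/-- A vector field in the embedding. -/
def hatV (X : VectorField d K) (x : K) : E := b.emb x (X x)

/-- A covector field in the embedding. -/
def hatC (om : CovectorField d K) (x : K) : E →L[ℝ] ℝ := (om x).comp (b.ret x)

theorem ret_hatV (X : VectorField d K) (x : K) : b.ret x (b.hatV X x) = X x := b.ret_emb x x.2 _

theorem hatC_comp_emb (om : CovectorField d K) (x : K) : (b.hatC om x).comp (b.emb x) = om x := by
  ext v
  exact congrArg (om x) (b.ret_emb x x.2 v)

theorem hatC_hatV (om : CovectorField d K) (X : VectorField d K) (x : K) :
    b.hatC om x (b.hatV X x) = om x (X x) := congrArg (om x) (b.ret_hatV X x)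

theorem mk_eq_mk_iff {x y : M} (hx : x ∈ K) (hxy : x = y) (v : TangentSpace (𝓡 d) x)
    (w : TangentSpace (𝓡 d) y) :
    (⟨x, v⟩ : TangentBundle (𝓡 d) M) = ⟨y, w⟩ ↔ b.emb x v = b.emb y w := by
  refine ⟨fun h => congrArg (fun q : TangentBundle (𝓡 d) M => b.emb q.1 q.2) h, fun h => ?_⟩
  subst hxy
  have := congrArg (b.ret x) h
  rw [b.ret_emb x hx, b.ret_emb x hx] at this
  rw [this]

theorem embPush_one_emb (x : K) (v : TangentSpace (𝓡 d) (x : M)) :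
    b.embPush f 1 x (b.emb x v) = b.emb (f x) (mfderiv (𝓡 d) (𝓡 d) f (x : M) v) := by
  rw [b.embPush_one_apply, b.ret_emb x x.2]

theorem eq_pullOne_add_iff (hK : f '' K = K) (om ν : CovectorField d K) (x : K) :
    ν x = pullOne hK x (ν (stepOn hK x)) + om x ↔
      b.hatC ν x = (b.hatC ν (stepPerm hK x)).comp (b.embPush f 1 x) + b.hatC om x := by
  have key : ∀ v : TangentSpace (𝓡 d) (x : M),
      b.hatC ν (stepPerm hK x) (b.emb (f x) (mfderiv (𝓡 d) (𝓡 d) f (x : M) v)) =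
        pullOne hK x (ν (stepOn hK x)) v := fun v =>
    congrArg (ν (stepOn hK x)) (b.ret_emb (f x) (stepOn hK x).2 _)
  constructor
  · intro h
    ext w
    rw [add_apply, ContinuousLinearMap.comp_apply, b.embPush_one_apply, key]
    exact congrArg (fun η : TangentSpace (𝓡 d) (x : M) →L[ℝ] ℝ => η (b.ret x w)) h
  · intro h
    ext v
    have h1 := congrArg (fun η : E →L[ℝ] ℝ => η (b.emb x v)) h
    simp only [add_apply, ContinuousLinearMap.comp_apply, b.embPush_one_emb, key] at h1
    have h2 : ∀ η : CovectorField d K, b.hatC η x (b.emb x v) = η x v := fun η =>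
      congrArg (η x) (b.ret_emb x x.2 v)
    rw [h2, h2] at h1
    rw [h1, add_apply]

theorem isTangentSolution_iff (X : VectorField d K) {x : ℤ → K}
    (hx : ∀ n, (x (n + 1) : M) = f (x n)) (u : (n : ℤ) → TangentSpace (𝓡 d) (x n : M)) :
    IsTangentSolution f X x u ↔ ∀ n, b.emb (x (n + 1)) (u (n + 1)) =
      b.embPush f 1 (x n) (b.emb (x n) (u n)) + b.hatV X (x (n + 1)) := by
  refine forall_congr' fun n => ?_
  rw [← sub_eq_iff_eq_add, b.embPush_one_emb, hatV, ← map_sub]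
  exact b.mk_eq_mk_iff (x (n + 1)).2 (hx n) _ _

theorem isAdjointSolution_iff (om : CovectorField d K) {x : ℤ → K}
    (hx : ∀ n, (x (n + 1) : M) = f (x n))
    (η : (n : ℤ) → (TangentSpace (𝓡 d) (x n : M) →L[ℝ] ℝ)) :
    IsAdjointSolution f om x η ↔ ∀ n, (η n).comp (b.ret (x n)) =
      ((η (n + 1)).comp (b.ret (x (n + 1)))).comp (b.embPush f 1 (x n)) + b.hatC om (x n) := by
  refine forall_congr' fun n => ?_
  have htm : ∀ u w, tangentMap (𝓡 d) (𝓡 d) f ⟨(x n : M), u⟩ = ⟨(x (n + 1) : M), w⟩ ↔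
      b.embPush f 1 (x n) (b.emb (x n) u) = b.emb (x (n + 1)) w := by
    intro u w
    rw [b.embPush_one_emb, eq_comm, eq_comm (b := b.emb (x (n + 1)) w)]
    exact b.mk_eq_mk_iff (x (n + 1)).2 (hx n) _ _
  constructor
  · intro h
    ext w
    have h1 := h (b.ret (x n) w) (b.ret (x (n + 1)) (b.embPush f 1 (x n) w)) ((htm _ _).2 ?_)
    · exact h1
    · have e1 : b.embPush f 1 (x n) (b.emb (x n) (b.ret (x n) w)) = b.embPush f 1 (x n) w := by
        rw [b.embPush_one_apply, b.embPush_one_apply, b.ret_emb _ (x n).2]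
      have hmem : f (x n) ∈ K := hx n ▸ (x (n + 1)).2
      rw [e1, b.embPush_one_apply, hx n, b.ret_emb _ hmem]
  · intro h u w huw
    have h1 := congrArg (fun ξ : E →L[ℝ] ℝ => ξ (b.emb (x n) u)) h
    simp only [add_apply, ContinuousLinearMap.comp_apply, (htm u w).1 huw, hatC,
      b.ret_emb _ (x n).2, b.ret_emb _ (x (n + 1)).2] at h1
    exact h1

variable [RiemannianBundle (fun x : M => TangentSpace (𝓡 d) x)]
  [IsContMDiffRiemannianBundle (𝓡 d) ∞ (EuclideanSpace ℝ (Fin d))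
      (fun x : M => TangentSpace (𝓡 d) x)] (hK : IsHyperbolicSet f K V)

theorem cocycle_Φ_zero_hatV (X : VectorField d K) (x : K) :
    (b.cocycle hK).Φ 0 x (b.hatV X x) = b.hatV X x := by
  refine (b.embPush_zero_apply x _).trans ?_
  rw [b.ret_hatV]
  rfl

theorem cocycle_dual_Φ_zero_hatC (om : CovectorField d K) (x : K) :
    (b.cocycle hK).dual.Φ 0 x (b.hatC om x) = b.hatC om x := by
  rw [HyperbolicCocycle.dual_Φ_zero_apply]
  ext w
  refine (congrArg (b.hatC om x) (b.embPush_zero_apply x w)).trans ?_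
  exact congrArg (om x) (b.ret_emb x x.2 _)

/-- The linear shadowing operator on arbitrary vector fields. -/
def shadow (X : VectorField d K) : VectorField d K :=
  fun x => b.ret x ((b.cocycle hK).solve (b.hatV X) x)

/-- The adjoint shadowing operator on arbitrary covector fields. -/
def adjShadow (om : CovectorField d K) : CovectorField d K :=
  fun x => ((b.cocycle hK).dual.solve (b.hatC om) x).comp (b.emb x)

theorem bounded_iff_emb {x : ℤ → K} (u : (n : ℤ) → TangentSpace (𝓡 d) (x n : M))
    (hKc : IsCompact K) : (∃ B : ℝ, ∀ n, ‖u n‖ ≤ B) ↔ ∃ B : ℝ, ∀ n, ‖b.emb (x n) (u n)‖ ≤ B := by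
  obtain ⟨Ce, he0, he⟩ := b.exists_norm_emb_le hKc
  obtain ⟨Cr, hr0, hr⟩ := b.exists_norm_ret_le hKc
  constructor
  · rintro ⟨B, hB⟩
    exact ⟨Ce * B, fun n => (he _ (x n).2 _).trans (mul_le_mul_of_nonneg_left (hB n) he0)⟩
  · rintro ⟨B, hB⟩
    refine ⟨Cr * B, fun n => ?_⟩
    rw [← b.ret_emb _ (x n).2 (u n)]
    exact (hr _ (x n).2 _).trans (mul_le_mul_of_nonneg_left (hB n) hr0)

theorem exists_norm_comp_ret_le (hKc : IsCompact K) : ∃ C, 0 ≤ C ∧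
    ∀ (x : K) (η : TangentSpace (𝓡 d) (x : M) →L[ℝ] ℝ), ‖η.comp (b.ret x)‖ ≤ C * ‖η‖ := by
  obtain ⟨Cr, hr0, hr⟩ := b.exists_norm_ret_le hKc
  refine ⟨Cr, hr0, fun x η => ContinuousLinearMap.opNorm_le_bound _
    (mul_nonneg hr0 (norm_nonneg η)) fun w => ?_⟩
  calc ‖η (b.ret x w)‖ ≤ ‖η‖ * ‖b.ret x w‖ := ContinuousLinearMap.le_opNorm η _
    _ ≤ ‖η‖ * (Cr * ‖w‖) := mul_le_mul_of_nonneg_left (hr x x.2 w) (norm_nonneg η)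
    _ = Cr * ‖η‖ * ‖w‖ := by ring

theorem exists_norm_le_comp_ret (hKc : IsCompact K) : ∃ C, 0 ≤ C ∧
    ∀ (x : K) (η : TangentSpace (𝓡 d) (x : M) →L[ℝ] ℝ), ‖η‖ ≤ C * ‖η.comp (b.ret x)‖ := by
  obtain ⟨Ce, he0, he⟩ := b.exists_norm_emb_le hKc
  refine ⟨Ce, he0, fun x η => ContinuousLinearMap.opNorm_le_bound _
    (mul_nonneg he0 (norm_nonneg _)) fun v => ?_⟩
  have h1 : η v = (η.comp (b.ret x)) (b.emb x v) := congrArg η (b.ret_emb x x.2 v).symm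
  rw [h1]
  calc _ ≤ ‖η.comp (b.ret x)‖ * ‖b.emb x v‖ := ContinuousLinearMap.le_opNorm _ _
    _ ≤ ‖η.comp (b.ret x)‖ * (Ce * ‖v‖) := mul_le_mul_of_nonneg_left (he x x.2 v) (norm_nonneg _)
    _ = _ := by ring

theorem bounded_covector_iff {ι : Type*} {x : ι → K}
    (η : (n : ι) → (TangentSpace (𝓡 d) (x n : M) →L[ℝ] ℝ)) (hKc : IsCompact K) :
    (∃ B : ℝ, ∀ n, ‖η n‖ ≤ B) ↔ ∃ B : ℝ, ∀ n, ‖(η n).comp (b.ret (x n))‖ ≤ B := by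
  obtain ⟨C, h0, h⟩ := b.exists_norm_comp_ret_le hKc
  obtain ⟨C', h0', h'⟩ := b.exists_norm_le_comp_ret hKc
  constructor
  · rintro ⟨B, hB⟩
    exact ⟨C * B, fun n => (h _ _).trans (mul_le_mul_of_nonneg_left (hB n) h0)⟩
  · rintro ⟨B, hB⟩
    exact ⟨C' * B, fun n => (h' _ _).trans (mul_le_mul_of_nonneg_left (hB n) h0')⟩

/-- The dual solution is fixed by the dual `Φ 0`, which is precomposition with `emb ∘ ret`; passing
to tangent covectors and back therefore loses nothing. -/
theorem hatC_adjShadow {om : CovectorField d K} {B : ℝ} (hB : ∀ x, ‖b.hatC om x‖ ≤ B) :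
    b.hatC (b.adjShadow hK om) = (b.cocycle hK).dual.solve (b.hatC om) := by
  funext x
  rw [← (b.cocycle hK).dual.Φ_zero_solve hB x, HyperbolicCocycle.dual_Φ_zero_apply]
  ext w
  exact congrArg ((b.cocycle hK).dual.solve (b.hatC om) x) (b.embPush_zero_apply x w).symm

theorem hatV_shadow [CompleteSpace E] {X : VectorField d K} {B : ℝ} (hB : ∀ x, ‖b.hatV X x‖ ≤ B) :
    b.hatV (b.shadow hK X) = (b.cocycle hK).solve (b.hatV X) := by
  funext x
  rw [← (b.cocycle hK).Φ_zero_solve hB x]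
  exact (b.embPush_zero_apply x _).symm

theorem isShadowingField_shadow [CompleteSpace E] {X : VectorField d K} {B : ℝ} (hB : ∀ x, ‖b.hatV X x‖ ≤ B) :
    IsShadowingField f X (b.shadow hK X) := by
  intro x hx u
  rw [b.isTangentSolution_iff X hx u, b.bounded_iff_emb u hK.isCompact]
  have h := (b.cocycle hK).bounded_solution_iff (x := x) (v := fun n => b.emb (x n) (u n)) hB
    (b.cocycle_Φ_zero_hatV hK X) (fun n => Subtype.ext (hx n))
  refine h.trans (forall_congr' fun n => ⟨fun hn => ?_, fun hn => ?_⟩)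
  · rw [← b.ret_emb _ (x n).2 (u n), hn]
    rfl
  · rw [hn, ← b.hatV_shadow hK hB]
    rfl

/-- The adjoint equation determines `η n` from `η (n + 1)`. Under the time reversal `n ↦ -n` it is
the step equation of the dual cocycle, to which `bounded_solution_iff` applies. -/
theorem adjoint_solution_iff {om : CovectorField d K} {B : ℝ} (hB : ∀ x, ‖b.hatC om x‖ ≤ B)
    {x : ℤ → K} (hx : ∀ n, (x (n + 1) : M) = f (x n))
    (η : (n : ℤ) → (TangentSpace (𝓡 d) (x n : M) →L[ℝ] ℝ)) :
    ((∃ B : ℝ, ∀ n, ‖η n‖ ≤ B) ∧ IsAdjointSolution f om x η) ↔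
      ∀ n, η n = b.adjShadow hK om (x n) := by
  have hxT : ∀ n, x (n + 1) = (b.cocycle hK).T (x n) := fun n => Subtype.ext (hx n)
  have hinv : ∀ n, x (-(n + 1)) = (b.cocycle hK).dual.T (x (-n)) := by
    intro n
    have : x (-n) = (b.cocycle hK).T (x (-(n + 1))) := by rw [← hxT]; congr 1; ring
    rw [this]
    exact ((b.cocycle hK).T.symm_apply_apply _).symm
  rw [b.isAdjointSolution_iff om hx η, b.bounded_covector_iff η hK.isCompact]
  have h := (b.cocycle hK).dual.bounded_solution_iff (x := fun n => x (-n))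
    (v := fun n => (η (-n)).comp (b.ret (x (-n)))) hB (b.cocycle_dual_Φ_zero_hatC hK om) hinv
  have hstep : (∀ n, (η n).comp (b.ret (x n)) =
      ((η (n + 1)).comp (b.ret (x (n + 1)))).comp (b.embPush f 1 (x n)) + b.hatC om (x n)) ↔
      ∀ n : ℤ, (η (-(n + 1))).comp (b.ret (x (-(n + 1)))) =
        (b.cocycle hK).dual.Φ 1 (x (-n)) ((η (-n)).comp (b.ret (x (-n)))) +
          b.hatC om (x (-(n + 1))) := by
    have hterm : ∀ n : ℤ, (b.cocycle hK).dual.Φ 1 (x (n + 1)) ((η (n + 1)).comp (b.ret (x (n + 1))))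
        = ((η (n + 1)).comp (b.ret (x (n + 1)))).comp (b.embPush f 1 (x n)) := by
      intro n
      rw [hxT n]
      exact (b.cocycle hK).dual_Φ_one_apply (x n) _
    constructor
    · intro h n
      have := h (-(n + 1))
      rw [← hterm] at this
      have e : -(n + 1) + 1 = -n := by ring
      rwa [e] at this
    · intro h n
      rw [← hterm]
      have := h (-(n + 1))
      have e1 : -(-(n + 1) + 1) = n := by ring
      have e2 : -(-(n + 1)) = n + 1 := by ring
      rwa [e1, e2] at this
  have hbdd : (∃ A : ℝ, ∀ n, ‖(η n).comp (b.ret (x n))‖ ≤ A) ↔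
      ∃ A : ℝ, ∀ n : ℤ, ‖(η (-n)).comp (b.ret (x (-n)))‖ ≤ A :=
    exists_congr fun A => ⟨fun h n => h (-n), fun h n => by
      obtain ⟨m, rfl⟩ : ∃ m, n = -m := ⟨-n, (neg_neg n).symm⟩
      exact h m⟩
  rw [hstep, hbdd]
  refine h.trans ⟨fun hn n => ?_, fun hn n => ?_⟩
  · obtain ⟨m, rfl⟩ : ∃ m, n = -m := ⟨-n, (neg_neg n).symm⟩
    have h2 : η (-m) = ((η (-m)).comp (b.ret (x (-m)))).comp (b.emb (x (-m))) := by
      ext v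
      exact congrArg (η (-m)) (b.ret_emb _ (x (-m)).2 v).symm
    exact h2.trans (congrArg (fun ξ : E →L[ℝ] ℝ => ξ.comp (b.emb (x (-m)))) (hn m))
  · rw [hn, ← b.hatC_adjShadow hK hB]
    rfl

theorem adjoint_field_iff {om : CovectorField d K} {B : ℝ} (hB : ∀ x, ‖b.hatC om x‖ ≤ B)
    (ν : CovectorField d K) : ((∃ B : ℝ, ∀ x, ‖ν x‖ ≤ B) ∧
      ∀ x, ν x = pullOne hK.image_eq x (ν (stepOn hK.image_eq x)) + om x) ↔
        ν = b.adjShadow hK om := by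
  rw [b.bounded_covector_iff (x := fun x : K => x) ν hK.isCompact]
  simp only [b.eq_pullOne_add_iff]
  have h := (b.cocycle hK).dual.bounded_field_iff hB (b.cocycle_dual_Φ_zero_hatC hK om)
    (v := b.hatC ν)
  have hstep : (∀ x, b.hatC ν x = (b.hatC ν (stepPerm hK.image_eq x)).comp (b.embPush f 1 x) +
      b.hatC om x) ↔ ∀ x, b.hatC ν ((b.cocycle hK).dual.T x) =
        (b.cocycle hK).dual.Φ 1 x (b.hatC ν x) + b.hatC om ((b.cocycle hK).dual.T x) := by
    -- The pullback equation at `x` is the dual step equation based at `T x`, so the quantifier is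
    -- reindexed along `T`.
    rw [← (b.cocycle hK).T.forall_congr_right (q := fun x => b.hatC ν ((b.cocycle hK).dual.T x) =
      (b.cocycle hK).dual.Φ 1 x (b.hatC ν x) + b.hatC om ((b.cocycle hK).dual.T x))]
    refine forall_congr' fun x => ?_
    have e : (b.cocycle hK).dual.T ((b.cocycle hK).T x) = x :=
      (b.cocycle hK).T.symm_apply_apply x
    rw [e, (b.cocycle hK).dual_Φ_one_apply]
    rfl
  rw [hstep]
  refine h.trans ⟨fun hν => ?_, fun hν => ?_⟩
  · funext x
    rw [← b.hatC_comp_emb ν x, hν]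
    rfl
  · rw [hν, b.hatC_adjShadow hK hB]

/-- The expansion of the adjoint shadowing operator. -/
theorem hasSum_adjShadow {om : CovectorField d K} {B : ℝ} (hB : ∀ x, ‖b.hatC om x‖ ≤ B) (x : K) :
    ∃ a c : TangentSpace (𝓡 d) (x : M) →L[ℝ] ℝ,
      HasSum (fun n : ℕ => pull hK.image_eq (n : ℤ) x
        (V.adjPs (iterOn hK.image_eq (n : ℤ) x) (om (iterOn hK.image_eq (n : ℤ) x)))) a ∧
      HasSum (fun n : ℕ => pull hK.image_eq (-((n : ℤ) + 1)) x
        (V.adjPu (iterOn hK.image_eq (-((n : ℤ) + 1)) x)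
          (om (iterOn hK.image_eq (-((n : ℤ) + 1)) x)))) c ∧
      b.adjShadow hK om x = a - c := by
  -- Precomposition with `emb` is continuous and linear, so it carries the two Green series termwise
  -- to covectors on the tangent space.
  have hs := ((b.cocycle hK).dual.summable_sTerm hB x).hasSum.mapL
    (ContinuousLinearMap.precomp ℝ (b.emb x))
  have hu := ((b.cocycle hK).dual.summable_uTerm hB x).hasSum.mapL
    (ContinuousLinearMap.precomp ℝ (b.emb x))
  -- Each `ret` meets the `emb` before it over a point of `K` and cancels.
  have hterm : ∀ (n : ℤ) (A : (y : K) → TangentSpace (𝓡 d) (y : M) →L[ℝ] TangentSpace (𝓡 d) (y : M)),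
      ((((b.hatC om ((stepPerm hK.image_eq ^ n) x)).comp
        (b.conj A ((stepPerm hK.image_eq ^ n) x))).comp (b.embPush f n x)).comp (b.emb x)) =
      pull hK.image_eq n x ((om (iterOn hK.image_eq n x)).comp (A (iterOn hK.image_eq n x))) := by
    intro n A
    rw [stepPerm_zpow]
    ext v
    have h1 : b.ret x (b.emb x v) = v := b.ret_emb x x.2 v
    have h2 : b.ret (iterOn hK.image_eq n x) (b.embPush f n x (b.emb x v)) = push f n x v :=
      (b.ret_emb _ (iterOn hK.image_eq n x).2 _).trans (congrArg (push f n (x : M)) h1)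
    have h3 : b.conj A (iterOn hK.image_eq n x) (b.embPush f n x (b.emb x v)) =
        b.emb (iterOn hK.image_eq n x) (A (iterOn hK.image_eq n x) (push f n x v)) :=
      congrArg (fun u => b.emb (iterOn hK.image_eq n x) (A (iterOn hK.image_eq n x) u)) h2
    refine (congrArg (b.hatC om (iterOn hK.image_eq n x)) h3).trans ?_
    exact congrArg (om (iterOn hK.image_eq n x)) (b.ret_emb _ (iterOn hK.image_eq n x).2 _)
  have hs' := funext fun n : ℕ => (congrArg (ContinuousLinearMap.precomp ℝ (b.emb x))
    ((b.cocycle hK).dual_sTerm (b.hatC om) x n)).trans (hterm n V.Ps)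
  have hu' := funext fun n : ℕ => (congrArg (ContinuousLinearMap.precomp ℝ (b.emb x))
    ((b.cocycle hK).dual_uTerm (b.hatC om) x n)).trans (hterm (-((n : ℤ) + 1)) V.Pu)
  rw [hs'] at hs
  rw [hu'] at hu
  exact ⟨_, _, hs, hu, rfl⟩

end TangentEmbedding

end AdjointShadowing
end

/-! ### The two shadowing operators on Hölder fields, and their duality. -/

noncomputable section
namespace AdjointShadowing

namespace TangentEmbedding

variable {d : ℕ} {M : Type*} [EMetricSpace M]
  [ChartedSpace (EuclideanSpace ℝ (Fin d)) M] [IsManifold (𝓡 d) ∞ M]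
  [RiemannianBundle (fun x : M => TangentSpace (𝓡 d) x)]
  [IsContMDiffRiemannianBundle (𝓡 d) ∞ (EuclideanSpace ℝ (Fin d))
      (fun x : M => TangentSpace (𝓡 d) x)]
  [IsRiemannianManifold (𝓡 d) M]
  {K : Set M} {E : Type*} [NormedAddCommGroup E] [NormedSpace ℝ E] (b : TangentEmbedding d K E)
  {f : M ≃ₘ⟮𝓡 d, 𝓡 d⟯ M} {V : Splitting d K} (hK : IsHyperbolicSet f K V)

theorem continuous_hatV (X : HolderVectorField d K) : Continuous (b.hatV X.1) := by
  obtain ⟨α, hα, hα1, hX⟩ := X.2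
  exact continuous_of_holderNear hα ((b.isHolderVectorField_iff hα hα1).1 hX)

theorem continuous_hatC (om : HolderCovectorField d K) : Continuous (b.hatC om.1) := by
  obtain ⟨α, hα, hα1, hX⟩ := om.2
  exact continuous_of_holderNear hα ((b.isHolderCovectorField_iff hα hα1).1 hX)

theorem exists_norm_hatV_le (hKc : IsCompact K) (X : HolderVectorField d K) :
    ∃ B : ℝ, ∀ x, ‖b.hatV X.1 x‖ ≤ B := by
  have := isCompact_iff_compactSpace.1 hKc
  obtain ⟨B, hB⟩ := isCompact_univ.exists_bound_of_continuousOn (b.continuous_hatV X).continuousOn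
  exact ⟨B, fun x => hB x trivial⟩

theorem exists_norm_hatC_le (hKc : IsCompact K) (om : HolderCovectorField d K) :
    ∃ B : ℝ, ∀ x, ‖b.hatC om.1 x‖ ≤ B := by
  have := isCompact_iff_compactSpace.1 hKc
  obtain ⟨B, hB⟩ := isCompact_univ.exists_bound_of_continuousOn (b.continuous_hatC om).continuousOn
  exact ⟨B, fun x => hB x trivial⟩

/-- Both shadowing operators preserve every sufficiently small Hölder exponent. -/
theorem exists_exponent [CompleteSpace E] : ∃ α₀ : ℝ≥0, 0 < α₀ ∧ α₀ ≤ 1 ∧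
    ∀ α : ℝ≥0, 0 < α → α ≤ α₀ →
      (∀ X : VectorField d K, IsHolderVectorField d α X →
        IsHolderVectorField d α (b.shadow hK X)) ∧
      (∀ om : CovectorField d K, IsHolderCovectorField d α om →
        IsHolderCovectorField d α (b.adjShadow hK om)) := by
  have := isCompact_iff_compactSpace.1 hK.isCompact
  obtain ⟨L, hL⟩ := b.exists_isLipschitzBase hK
  obtain ⟨α₀, h0, h1, hα₀⟩ := (b.cocycle hK).exists_exponent hL.one_le
  refine ⟨α₀, h0, h1, fun α hα hαα₀ => ?_⟩
  have hα1 : α ≤ 1 := hαα₀.trans h1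
  obtain ⟨a, ha0, ha⟩ := exists_norm_sub_le_of_holderNear hα
    (fun p => (b.holderNear_embPush_one hK.image_eq p).of_le hα1)
  constructor
  · intro X hX
    have hX' : ∀ p, HolderNear α (b.hatV X) p := (b.isHolderVectorField_iff hα hα1).1 hX
    obtain ⟨B, hB⟩ := exists_norm_le_of_holderNear hα hX'
    refine (b.isHolderVectorField_iff hα hα1).2 fun p => ?_
    have h := (b.cocycle hK).holderNear_solve hL hα (hα₀ α hαα₀) ha hX'
      (b.cocycle_Φ_zero_hatV hK X) p
    rw [← b.hatV_shadow hK hB] at h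
    exact h
  · intro om hom
    have hom' : ∀ p, HolderNear α (b.hatC om) p := (b.isHolderCovectorField_iff hα hα1).1 hom
    obtain ⟨B, hB⟩ := exists_norm_le_of_holderNear hα hom'
    refine (b.isHolderCovectorField_iff hα hα1).2 fun p => ?_
    -- The dual cocycle has the same `lam` and the same Lipschitz constant `L`, so one `α₀` serves
    -- both operators.
    have h := (b.cocycle hK).dual.holderNear_solve hL.dual hα (hα₀ α hαα₀)
      (hL.norm_dual_Φ_one_sub_le α.coe_nonneg ha0 ha) hom' (b.cocycle_dual_Φ_zero_hatC hK om) p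
    rw [← b.hatC_adjShadow hK hB] at h
    exact h

theorem shadow_mem [CompleteSpace E] (X : HolderVectorField d K) :
    b.shadow hK X.1 ∈ HolderVectorField d K := by
  obtain ⟨α₀, h0, h1, h⟩ := b.exists_exponent hK
  obtain ⟨α, hα, hα1, hX⟩ := X.2
  refine ⟨min α α₀, lt_min hα h0, (min_le_left _ _).trans hα1,
    (h _ (lt_min hα h0) (min_le_right _ _)).1 _ fun p => (hX p).of_le (min_le_left _ _)⟩

theorem adjShadow_mem [CompleteSpace E] (om : HolderCovectorField d K) :
    b.adjShadow hK om.1 ∈ HolderCovectorField d K := by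
  obtain ⟨α₀, h0, h1, h⟩ := b.exists_exponent hK
  obtain ⟨α, hα, hα1, hX⟩ := om.2
  refine ⟨min α α₀, lt_min hα h0, (min_le_left _ _).trans hα1,
    (h _ (lt_min hα h0) (min_le_right _ _)).2 _ fun p => (hX p).of_le (min_le_left _ _)⟩

/-- The linear shadowing operator on Hölder vector fields. -/
def shadowOp [CompleteSpace E] : HolderVectorField d K →ₗ[ℝ] HolderVectorField d K where
  toFun X := ⟨b.shadow hK X.1, b.shadow_mem hK X⟩
  map_add' X Y := by
    obtain ⟨B, hB⟩ := b.exists_norm_hatV_le hK.isCompact X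
    obtain ⟨B', hB'⟩ := b.exists_norm_hatV_le hK.isCompact Y
    refine Subtype.ext (funext fun x => ?_)
    have h : b.hatV (X + Y).1 = fun x => b.hatV X.1 x + b.hatV Y.1 x :=
      funext fun x => map_add (b.emb x) (X.1 x) (Y.1 x)
    change b.ret x ((b.cocycle hK).solve (b.hatV (X + Y).1) x) = _
    rw [h, (b.cocycle hK).solve_add hB hB', map_add]
    rfl
  map_smul' a X := by
    refine Subtype.ext (funext fun x => ?_)
    have h : b.hatV (a • X).1 = fun x => a • b.hatV X.1 x :=
      funext fun x => map_smul (b.emb x) a (X.1 x)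
    change b.ret x ((b.cocycle hK).solve (b.hatV (a • X).1) x) = _
    rw [h, (b.cocycle hK).solve_smul, map_smul]
    rfl

/-- The adjoint shadowing operator on Hölder covector fields. -/
def adjShadowOp [CompleteSpace E] : HolderCovectorField d K →ₗ[ℝ] HolderCovectorField d K where
  toFun om := ⟨b.adjShadow hK om.1, b.adjShadow_mem hK om⟩
  map_add' X Y := by
    obtain ⟨B, hB⟩ := b.exists_norm_hatC_le hK.isCompact X
    obtain ⟨B', hB'⟩ := b.exists_norm_hatC_le hK.isCompact Y
    refine Subtype.ext (funext fun x => ?_)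
    have h : b.hatC (X + Y).1 = fun x => b.hatC X.1 x + b.hatC Y.1 x := rfl
    change ((b.cocycle hK).dual.solve (b.hatC (X + Y).1) x).comp (b.emb x) = _
    rw [h, (b.cocycle hK).dual.solve_add hB hB']
    rfl
  map_smul' a X := by
    refine Subtype.ext (funext fun x => ?_)
    have h : b.hatC (a • X).1 = fun x => a • b.hatC X.1 x := rfl
    change ((b.cocycle hK).dual.solve (b.hatC (a • X).1) x).comp (b.emb x) = _
    rw [h, (b.cocycle hK).dual.solve_smul]
    rfl

theorem continuous_pairing (om : HolderCovectorField d K) (X : HolderVectorField d K) :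
    Continuous fun x => b.hatC om.1 x (b.hatV X.1 x) :=
  (b.continuous_hatC om).clm_apply (b.continuous_hatV X)

theorem adjShadowOp_eq [CompleteSpace E] (om : HolderCovectorField d K) (x : K) :
    b.hatC (b.adjShadowOp hK om).1 x =
      (b.hatC (b.adjShadowOp hK om).1 (stepPerm hK.image_eq x)).comp (b.embPush f 1 x) +
        b.hatC om.1 x := by
  obtain ⟨B, hB⟩ := b.exists_norm_hatC_le hK.isCompact om
  exact (b.eq_pullOne_add_iff hK.image_eq om.1 _ x).1 (((b.adjoint_field_iff hK hB _).2 rfl).2 x)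

theorem shadowOp_step [CompleteSpace E] (X : HolderVectorField d K) (x : K) :
    b.hatV (b.shadowOp hK X).1 (stepPerm hK.image_eq x) =
      b.embPush f 1 x (b.hatV (b.shadowOp hK X).1 x) + b.hatV X.1 (stepPerm hK.image_eq x) := by
  obtain ⟨B, hB⟩ := b.exists_norm_hatV_le hK.isCompact X
  have h := b.hatV_shadow hK hB
  have h1 := (b.cocycle hK).solve_step hB x
  rw [b.cocycle_Φ_zero_hatV, ← h] at h1
  exact h1

variable [MeasurableSpace M] [BorelSpace M] {ρ : Measure K} [IsProbabilityMeasure ρ]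

/-- With `g = ν v` and `q = ν X`, the adjoint equation gives `g = ν₁(f_* v) + ω v` and the tangent
equation gives `g∘f = ν₁(f_* v) + q∘f`. Hence `ω v = g - g∘f + q∘f`, and invariance leaves `∫ q`. No
series is exchanged with the integral. -/
theorem integral_shadowOp_eq [CompleteSpace E]
    (hinv : MeasurePreserving (stepOn hK.image_eq) ρ ρ)
    (om : HolderCovectorField d K) (X : HolderVectorField d K) :
    ∫ x, om.1 x ((b.shadowOp hK X).1 x) ∂ρ = ∫ x, (b.adjShadowOp hK om).1 x (X.1 x) ∂ρ := by
  have := isCompact_iff_compactSpace.1 hK.isCompact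
  set v := b.shadowOp hK X
  set ν := b.adjShadowOp hK om
  set g : K → ℝ := fun x => b.hatC ν.1 x (b.hatV v.1 x)
  set q : K → ℝ := fun x => b.hatC ν.1 x (b.hatV X.1 x)
  have hgc : Continuous g := b.continuous_pairing ν v
  have hqc : Continuous q := b.continuous_pairing ν X
  have hTc : Continuous (stepOn hK.image_eq) :=
    (f.continuous.comp continuous_subtype_val).subtype_mk _
  have key : ∀ x, om.1 x (v.1 x) =
      g x - (g (stepOn hK.image_eq x) - q (stepOn hK.image_eq x)) := by
    intro x
    have h1 : g x = b.hatC ν.1 (stepPerm hK.image_eq x) (b.embPush f 1 x (b.hatV v.1 x)) +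
        b.hatC om.1 x (b.hatV v.1 x) :=
      congrArg (fun η : E →L[ℝ] ℝ => η (b.hatV v.1 x)) (b.adjShadowOp_eq hK om x)
    have h2 : g (stepOn hK.image_eq x) =
        b.hatC ν.1 (stepPerm hK.image_eq x) (b.embPush f 1 x (b.hatV v.1 x)) +
          q (stepOn hK.image_eq x) := by
      have := congrArg (b.hatC ν.1 (stepPerm hK.image_eq x)) (b.shadowOp_step hK X x)
      rw [map_add] at this
      exact this
    rw [h1, h2, b.hatC_hatV]
    ring
  simp_rw [key]
  have hig : Integrable (fun x => g (stepOn hK.image_eq x)) ρ :=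
    integrable_of_continuous (hgc.comp hTc)
  have hiq : Integrable (fun x => q (stepOn hK.image_eq x)) ρ :=
    integrable_of_continuous (hqc.comp hTc)
  have hi : Integrable (fun x => g (stepOn hK.image_eq x) - q (stepOn hK.image_eq x)) ρ :=
    hig.sub hiq
  rw [integral_sub (integrable_of_continuous hgc) hi, integral_sub hig hiq,
    integral_comp_of_measurePreserving hinv hgc.measurable,
    integral_comp_of_measurePreserving hinv hqc.measurable, sub_sub_cancel]
  exact integral_congr_ae (Eventually.of_forall fun x => b.hatC_hatV ν.1 X.1 x)

end TangentEmbedding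

end AdjointShadowing
end

/-! ### Uniqueness on the support of the measure, and averages of the pairing. -/

noncomputable section
namespace AdjointShadowing

theorem HolderNear.smul_fun {A F : Type*} [PseudoEMetricSpace A] [NormedAddCommGroup F]
    [NormedSpace ℝ F] {α : ℝ≥0} {p : A} {χ : A → ℝ} {g : A → F} (hχ : HolderNear α χ p)
    (hg : HolderNear α g p) (hα : 0 < α) : HolderNear α (fun x => χ x • g x) p :=
  HolderNear.contDiffAt_comp (φ := fun q : ℝ × F => q.1 • q.2) contDiff_smul.contDiffAt
    (hχ.prodMk hg) hα

theorem iterate_stepOn {d : ℕ} {M : Type*} [EMetricSpace M]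
    [ChartedSpace (EuclideanSpace ℝ (Fin d)) M] {K : Set M} {f : M ≃ₘ⟮𝓡 d, 𝓡 d⟯ M}
    (hK : f '' K = K) (k : ℕ) (x : K) : (stepOn hK)^[k] x = iterOn hK k x := by
  rw [← stepPerm_zpow, zpow_natCast]
  exact congrFun (Equiv.Perm.iterate_eq_pow (stepPerm hK) k) x

/-- A bump function adapted to a neighbourhood. -/
theorem exists_bump {A : Type*} [PseudoEMetricSpace A] {x₀ : A} {W : Set A} (hW : W ∈ 𝓝 x₀) :
    ∃ χ : A → ℝ, (∀ p, HolderNear 1 χ p) ∧ χ x₀ = 1 ∧ (∀ x, 0 ≤ χ x) ∧ ∀ x ∉ W, χ x = 0 := by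
  obtain ⟨ε, hε, hball⟩ := EMetric.mem_nhds_iff.1 hW
  -- The radius `ε` may be infinite, whereas the thickened indicator needs a finite one.
  obtain ⟨δ, hδ, hδε⟩ := ENNReal.lt_iff_exists_nnreal_btwn.1 hε
  have hδ0 : (0 : ℝ) < δ := by exact_mod_cast hδ
  refine ⟨fun x => thickenedIndicator hδ0 {x₀} x, fun p => ?_, ?_, fun x => NNReal.coe_nonneg _,
    fun x hx => ?_⟩
  · refine ⟨(δ : ℝ).toNNReal⁻¹, Set.univ, univ_mem, ?_⟩
    have h := (lipschitzWith_thickenedIndicator hδ0 ({x₀} : Set A)).holderWith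
    intro x _ y _
    exact h x y
  · simp [thickenedIndicator_one hδ0 {x₀} (Set.mem_singleton x₀)]
  · rw [NNReal.coe_eq_zero]
    refine thickenedIndicator_zero hδ0 _ fun hmem => hx (hball ?_)
    obtain ⟨z, rfl, hz⟩ := (Metric.mem_thickening_iff_exists_edist_lt _ _).1 hmem
    refine hz.trans (lt_of_le_of_lt ?_ hδε)
    simp

namespace TangentEmbedding

variable {d : ℕ} {M : Type*} [EMetricSpace M]
  [ChartedSpace (EuclideanSpace ℝ (Fin d)) M] [IsManifold (𝓡 d) ∞ M]
  [RiemannianBundle (fun x : M => TangentSpace (𝓡 d) x)]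
  [IsContMDiffRiemannianBundle (𝓡 d) ∞ (EuclideanSpace ℝ (Fin d))
      (fun x : M => TangentSpace (𝓡 d) x)]
  [IsRiemannianManifold (𝓡 d) M]
  {K : Set M} {E : Type*} [NormedAddCommGroup E] [NormedSpace ℝ E] (b : TangentEmbedding d K E)
  {f : M ≃ₘ⟮𝓡 d, 𝓡 d⟯ M}

theorem isHolderVectorField_smul_ret {χ : K → ℝ} (hχ : ∀ p, HolderNear 1 χ p) (w : E) :
    IsHolderVectorField d 1 fun x : K => χ x • b.ret x w := by
  intro p
  have h1 : HolderNear 1 (fun x : K =>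
      (((tangentTriv d (p : M)).continuousLinearMapAt ℝ (x : M)).comp (b.ret x)) w) p :=
    (holderNear_one_subtype (b.contMDiffAt_ret p p.2)).clm_apply (HolderNear.const w) one_pos
  refine ((hχ p).smul_fun h1 one_pos).congr (Eventually.of_forall fun x => ?_)
  exact (map_smul ((tangentTriv d (p : M)).continuousLinearMapAt ℝ (x : M)) (χ x) (b.ret x w)).symm

variable [MeasurableSpace M] [BorelSpace M] {ρ : Measure K} [IsProbabilityMeasure ρ]

/-- A Hölder covector field is determined on the support of the measure by its pairing with
Hölder vector fields. -/
theorem eq_of_integral_eq (b : TangentEmbedding d K E) (hKc : IsCompact K) {ν ν' : HolderCovectorField d K} {α : ℝ≥0}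
    (hα1 : α ≤ 1)
    (h : ∀ X : HolderVectorField d K, IsHolderVectorField d α X.1 →
      ∫ x, ν.1 x (X.1 x) ∂ρ = ∫ x, ν'.1 x (X.1 x) ∂ρ) {x₀ : K} (hx₀ : x₀ ∈ ρ.support) :
    ν.1 x₀ = ν'.1 x₀ := by
  have := isCompact_iff_compactSpace.1 hKc
  by_contra hne
  have hne' : b.hatC ν.1 x₀ ≠ b.hatC ν'.1 x₀ := fun he => hne <| by
    rw [← b.hatC_comp_emb ν.1, ← b.hatC_comp_emb ν'.1, he]
  obtain ⟨w, hw⟩ : ∃ w, 0 < b.hatC ν.1 x₀ w - b.hatC ν'.1 x₀ w := by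
    obtain ⟨w, hw⟩ := DFunLike.ne_iff.1 hne'
    rcases lt_or_gt_of_ne hw with h1 | h1
    · refine ⟨-w, ?_⟩
      rw [map_neg, map_neg]
      linarith
    · exact ⟨w, sub_pos.2 h1⟩
  have hmc : Continuous fun x => b.hatC ν.1 x w - b.hatC ν'.1 x w :=
    ((b.continuous_hatC ν).clm_apply continuous_const).sub
      ((b.continuous_hatC ν').clm_apply continuous_const)
  -- The test field is `χ • ret w`, with `χ` vanishing wherever `(ν - ν') w` is not positive. It is
  -- Lipschitz, hence admissible for every exponent `α ≤ 1`.
  obtain ⟨χ, hχ, hχ1, hχ0, hχW⟩ := exists_bump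
    (hmc.continuousAt.eventually (lt_mem_nhds hw))
  have hX := b.isHolderVectorField_smul_ret hχ w
  set X : HolderVectorField d K := ⟨fun x : K => χ x • b.ret x w, 1, one_pos, le_rfl, hX⟩
  have hpair : ∀ (η : HolderCovectorField d K) (x : K),
      η.1 x (X.1 x) = χ x * b.hatC η.1 x w := fun η x => map_smul (η.1 x) (χ x) (b.ret x w)
  have hχc : Continuous χ := continuous_of_holderNear one_pos hχ
  have hpc : ∀ η : HolderCovectorField d K, Continuous fun x => χ x * b.hatC η.1 x w := fun η =>
    hχc.mul ((b.continuous_hatC η).clm_apply continuous_const)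
  have hinteg := h X fun p => (hX p).of_le hα1
  simp_rw [hpair] at hinteg
  have hzero : ∫ x, χ x * (b.hatC ν.1 x w - b.hatC ν'.1 x w) ∂ρ = 0 := by
    simp_rw [mul_sub]
    rw [integral_sub (integrable_of_continuous (hpc ν)) (integrable_of_continuous (hpc ν')), hinteg,
      sub_self]
  have hgc : Continuous fun x => χ x * (b.hatC ν.1 x w - b.hatC ν'.1 x w) := hχc.mul hmc
  have hpos := (integral_pos_iff_support_of_nonneg (μ := ρ)
    (f := fun x => χ x * (b.hatC ν.1 x w - b.hatC ν'.1 x w)) (fun x => ?_)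
    (integrable_of_continuous hgc)).2 ?_
  · exact hpos.ne' hzero
  · by_cases hx : x ∈ {x | 0 < b.hatC ν.1 x w - b.hatC ν'.1 x w}
    · exact mul_nonneg (hχ0 x) (le_of_lt hx)
    · exact (mul_eq_zero_of_left (hχW x hx) _).ge
  -- The nonnegative integrand is nonzero near the support point `x₀`, on a set of positive measure,
  -- which contradicts the vanishing integral.
  · refine (Measure.mem_support_iff_forall x₀).1 hx₀ _ (hgc.isOpen_support.mem_nhds ?_)
    rw [Function.mem_support, hχ1, one_mul]
    exact hw.ne'

theorem ae_tendsto_average_pairing (b : TangentEmbedding d K E) (hKc : IsCompact K) {hf : f '' K = K}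
    (herg : Ergodic (stepOn hf) ρ) (ν : HolderCovectorField d K) (X : HolderVectorField d K) :
    ∀ᵐ x ∂ρ, Tendsto (fun N : ℕ => (1 / (N : ℝ)) * ∑ n ∈ Finset.Icc 1 N,
      ν.1 (iterOn hf n x) (X.1 (iterOn hf n x))) atTop (𝓝 (∫ x, ν.1 x (X.1 x) ∂ρ)) := by
  have := isCompact_iff_compactSpace.1 hKc
  have hc : Continuous fun x => ν.1 x (X.1 x) := by
    simpa only [b.hatC_hatV] using b.continuous_pairing ν X
  filter_upwards [ae_tendsto_birkhoffAverage herg hc.measurable (integrable_of_continuous hc)]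
    with x hx
  refine tendsto_average_Icc (a := fun n => ν.1 (iterOn hf n x) (X.1 (iterOn hf n x)))
    (hx.congr fun N => ?_)
  rw [birkhoffAverage, birkhoffSum, smul_eq_mul, one_div]
  congr 1
  exact Finset.sum_congr rfl fun k _ => by rw [iterate_stepOn]

end TangentEmbedding

end AdjointShadowing
end

/-! ### The adjoint shadowing lemma. -/

theorem theorem1 {d : ℕ} {M : Type*} [EMetricSpace M] [SecondCountableTopology M]
    [ChartedSpace (EuclideanSpace ℝ (Fin d)) M] [IsManifold (𝓡 d) ∞ M]
    [RiemannianBundle (fun x : M => TangentSpace (𝓡 d) x)]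
    [IsContMDiffRiemannianBundle (𝓡 d) ∞ (EuclideanSpace ℝ (Fin d))
      (fun x : M => TangentSpace (𝓡 d) x)]
    [IsRiemannianManifold (𝓡 d) M] [MeasurableSpace M] [BorelSpace M]
    (f : M ≃ₘ⟮𝓡 d, 𝓡 d⟯ M) (K U : Set M) (V : Splitting d K)
    (hK : IsHyperbolicSet f K V) (hU : IsAttractor f K U)
    (ρ : Measure K) (hρ : IsSRBMeasure f K U hK.image_eq ρ) :
    ∃ (S : HolderVectorField d K →ₗ[ℝ] HolderVectorField d K)
      (AS : HolderCovectorField d K →ₗ[ℝ] HolderCovectorField d K),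
      -- `S` is the linear shadowing operator
      (∀ X : HolderVectorField d K, IsShadowingField f X.1 (S X).1) ∧
      -- `S` and `AS` preserve every sufficiently small Hölder exponent
      (∃ α₀ : ℝ≥0, 0 < α₀ ∧ α₀ ≤ 1 ∧ ∀ α : ℝ≥0, 0 < α → α ≤ α₀ →
        (∀ X : HolderVectorField d K,
          IsHolderVectorField d α X.1 → IsHolderVectorField d α (S X).1) ∧
        (∀ om : HolderCovectorField d K,
          IsHolderCovectorField d α om.1 → IsHolderCovectorField d α (AS om).1)) ∧
      -- (a) duality
      (∀ (om : HolderCovectorField d K) (X : HolderVectorField d K),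
        ∫ x, om.1 x ((S X).1 x) ∂ρ = ∫ x, (AS om).1 x (X.1 x) ∂ρ) ∧
      -- (a) duality determines `AS om` on the support of `ρ`, already when it is tested on
      -- `α`-Hölder vector fields only
      (∀ (om ν : HolderCovectorField d K) (α : ℝ≥0), 0 < α → α ≤ 1 →
        (∀ X : HolderVectorField d K, IsHolderVectorField d α X.1 →
          ∫ x, om.1 x ((S X).1 x) ∂ρ = ∫ x, ν.1 x (X.1 x) ∂ρ) →
        ∀ x ∈ ρ.support, ν.1 x = (AS om).1 x) ∧
      -- (a) the shadowing contribution
      (∀ Φ : M → ℝ, ContMDiff (𝓡 d) 𝓘(ℝ, ℝ) ∞ Φ →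
        ∃ dΦ : HolderCovectorField d K, dΦ.1 = differential d K Φ ∧
          ∀ X : HolderVectorField d K,
            ∫ x, dΦ.1 x ((S X).1 x) ∂ρ = ∫ x, (AS dΦ).1 x (X.1 x) ∂ρ ∧
            (∀ᵐ x ∂ρ, Tendsto
              (fun N : ℕ => (1 / (N : ℝ)) * ∑ n ∈ Finset.Icc 1 N,
                (AS dΦ).1 (iterOn hK.image_eq n x) (X.1 (iterOn hK.image_eq n x)))
              atTop (𝓝 (∫ x, dΦ.1 x ((S X).1 x) ∂ρ))) ∧
            (∀ g : M → ℝ, Continuous g → (∀ x : K, g x = (AS dΦ).1 x (X.1 x)) →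
              IsLebesgueNull d {x ∈ U | ¬ Tendsto
                (fun N : ℕ => (1 / (N : ℝ)) * ∑ n ∈ Finset.Icc 1 N, g (iter f n x))
                atTop (𝓝 (∫ x, dΦ.1 x ((S X).1 x) ∂ρ))})) ∧
      -- (b) the split-propagate expansion
      (∀ (om : HolderCovectorField d K) (x : K),
        ∃ a b : TangentSpace (𝓡 d) (x : M) →L[ℝ] ℝ,
          HasSum (fun n : ℕ => pull hK.image_eq (n : ℤ) x
            (V.adjPs (iterOn hK.image_eq (n : ℤ) x) (om.1 (iterOn hK.image_eq (n : ℤ) x)))) a ∧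
          HasSum (fun n : ℕ => pull hK.image_eq (-((n : ℤ) + 1)) x
            (V.adjPu (iterOn hK.image_eq (-((n : ℤ) + 1)) x)
              (om.1 (iterOn hK.image_eq (-((n : ℤ) + 1)) x)))) b ∧
          (AS om).1 x = a - b) ∧
      -- (c) `AS om` is the unique bounded solution of the adjoint equation
      (∀ (om : HolderCovectorField d K) (ν : CovectorField d K),
        ((∃ B : ℝ, ∀ x, ‖ν x‖ ≤ B) ∧
          ∀ x, ν x = pullOne hK.image_eq x (ν (stepOn hK.image_eq x)) + om.1 x) ↔
        ν = (AS om).1) ∧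
      -- (c) along every single orbit
      (∀ (om : HolderCovectorField d K) (x : ℤ → K), (∀ n, (x (n + 1) : M) = f (x n)) →
        ∀ η : (n : ℤ) → (TangentSpace (𝓡 d) (x n : M) →L[ℝ] ℝ),
          ((∃ B : ℝ, ∀ n, ‖η n‖ ≤ B) ∧ IsAdjointSolution f om.1 x η) ↔
          ∀ n, η n = (AS om).1 (x n)) := by
  -- Local compactness and second countability give σ-compactness, on which the partition of unity
  -- and the smooth approximation rest.
  have : LocallyCompactSpace M :=
    ChartedSpace.locallyCompactSpace (EuclideanSpace ℝ (Fin d)) M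
  have : SigmaCompactSpace M := sigmaCompactSpace_of_locallyCompact_secondCountable
  have := hρ.isProbabilityMeasure
  obtain ⟨t, ⟨b⟩⟩ := exists_tangentEmbedding (d := d) hK.isCompact
  have hdual := fun om X => b.integral_shadowOp_eq hK hρ.ergodic.toMeasurePreserving om X
  refine ⟨b.shadowOp hK, b.adjShadowOp hK, fun X => ?_, ?_, hdual, ?_, ?_, fun om x => ?_,
    fun om ν => ?_, fun om x hx η => ?_⟩
  · obtain ⟨B, hB⟩ := b.exists_norm_hatV_le hK.isCompact X
    exact b.isShadowingField_shadow hK hB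
  · obtain ⟨α₀, h0, h1, h⟩ := b.exists_exponent hK
    exact ⟨α₀, h0, h1, fun α hα hα' => ⟨fun X => (h α hα hα').1 X.1, fun om => (h α hα hα').2 om.1⟩⟩
  · intro om ν α _ hα1 h x hx
    -- By the duality already proved, the hypothesis says that `ν` and `AS om` have the same
    -- pairings with the test fields.
    exact b.eq_of_integral_eq hK.isCompact hα1
      (fun X hX => (h X hX).symm.trans (hdual om X)) hx
  · intro φ hφ
    refine ⟨⟨differential d K φ, 1, one_pos, le_rfl, isHolderCovectorField_differential K hφ⟩, rfl,
      fun X => ⟨hdual _ X, ?_, fun g hg hgK => ?_⟩⟩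
    · rw [hdual]
      exact b.ae_tendsto_average_pairing hK.isCompact hρ.ergodic _ X
    · rw [hdual, ← integral_congr_ae (Eventually.of_forall hgK)]
      refine (hρ.tendsto_of_continuous hK.isCompact hg).mono fun x hx => ⟨hx.1, fun h => hx.2 ?_⟩
      exact tendsto_average_Icc h
  · obtain ⟨B, hB⟩ := b.exists_norm_hatC_le hK.isCompact om
    exact b.hasSum_adjShadow hK hB x
  · obtain ⟨B, hB⟩ := b.exists_norm_hatC_le hK.isCompact om
    exact b.adjoint_field_iff hK hB ν
  · obtain ⟨B, hB⟩ := b.exists_norm_hatC_le hK.isCompact om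
    exact b.adjoint_solution_iff hK hB hx η
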